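/- **Setting.** Let $\Lambda\subset\mathbb R^2$ be a bounded, open, connected, polygonal set, $T>0$, $(\Omega,\mathcal A,\mathbb P)$ a probability space with a right-continuous, complete filtration $(\mathcal F_t)_{t\ge 0}$, and $W$ a standard real Brownian motion with respect to $(\mathcal F_t)$. Let $u_0\in L^2(\Omega;H^1(\Lambda))$ be $\mathcal F_0$-measurable, let $g,\beta:\mathbb R\to\mathbb R$ be Lipschitz continuous with $\beta(0)=0$, and let $\mathbf v\in C^1([0,T]\times\Lambda;\mathbb R^2)$ be continuous on $[0,T]\times\overline\Lambda$, with $\operatorname{div}_x\mathbf v=0$ in $[0,T]\times\Lambda$ and $\mathbf v\cdot\mathbf n=0$ on $[0,T]\times\partial\Lambda$, where $\mathbf n$ is normal to $\partial\Lambda$. **Meshes.** An admissible mesh $\mathcal T$ of $\Lambda$ is a finite family of nonempty, open, convex, polygonal sets $K\subseteq\Lambda$ with pairwise disjoint interiors and $\overline\Lambda=\bigcup_{K\in\mathcal T}\overline K$, together with points $x_K\in\overline K$, such that for any two neighbours $K\neq L$ (i.e. $\sigma=K|L:=\overline K\cap\overline L$ has positive length $m_\sigma$) one has $x_K\ne x_L$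 and the line through $x_K,x_L$ is orthogonal to $\sigma$. Put $m_K=|K|$, $d_{K|L}=|x_K-x_L|$, let $\mathbf n_{K,\sigma}$ be the unit normal to $\sigma$ pointing out of $K$, and $\operatorname{size}(\mathcal T)=\max_K\operatorname{diam}K$. The edge $\sigma=K|L$ is interior if $\sigma\not\subseteq\partial\Lambda$; its diamond $D_\sigma$ is the open quadrangle with diagonals $\sigma$ and $[x_K,x_L]$, i.e. the interior of the union of the triangles with base $\sigma$ and apexes $x_K$, $x_L$. For $w=(w_K)_{K\in\mathcal T}$, the discrete gradient $\nabla^h w$ is the function equal to $2\,\frac{w_L-w_K}{d_{K|L}}\,\mathbf n_{K,\sigma}$ on $D_\sigma$ for each interior edge $\sigma=K|L$, and $0$ elsewhere. **Scheme.** For $N\in\mathbb N^\star$ put $\Delta t=T/N$ and $t_n=n\Delta t$. A discrete solution consists of random vectors $u^n=(u^n_K)_{K\in\mathcal T}$, $0\le n\le N$, such that almost surely $u_K^0=\frac1{m_K}\int_K u_0\,dx$ and, for all $0\le n<N$ and $K\in\mathcal T$, $$\frac{m_K}{\Delta t}(u_K^{n+1}-u_K^n)+\sum_{\sigma=K|L}m_\sigma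 v^{n+1}_{K,\sigma}u^{n+1}_\sigma+\sum_{\sigma=K|L}\frac{m_\sigma}{d_{K|L}}(u_K^{n+1}-u_L^{n+1})=\frac{m_K}{\Delta t}g(u_K^n)\big(W(t_{n+1})-W(t_n)\big)+m_K\beta(u_K^{n+1}),$$ where the sums are over the interior edges of $K$, $v^{n+1}_{K,\sigma}=\frac1{\Delta t\,m_\sigma}\int_{t_n}^{t_{n+1}}\int_\sigma\mathbf v\cdot\mathbf n_{K,\sigma}\,d\gamma\,dt$ with $\gamma$ the length measure, and $u^{n+1}_\sigma=u^{n+1}_K$ if $v^{n+1}_{K,\sigma}\ge0$, $u^{n+1}_\sigma=u^{n+1}_L$ otherwise. Let $u^r_{h,N}$ and $u^l_{h,N}$ be the functions on $\Omega\times(0,T)\times\Lambda$ equal to $u^{n+1}_K$ and $u^n_K$, respectively, for $t\in[t_n,t_{n+1})$ and $x\in K$, and let $\nabla^h u^r_{h,N}$ be equal to $\nabla^h u^{n+1}$ for $t\in[t_n,t_{n+1})$. **Proposition.** Let $(\mathcal T_m)_m$ be a sequence of admissible meshes of $\Lambda$ with $h_m=\operatorname{size}(\mathcal T_m)\to0$,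 let $(N_m)_m\subset\mathbb N^\star$ with $N_m\to\infty$, and for all sufficiently large $m$ let a discrete solution for $\mathcal T_m$ and $N_m$ be given. Then there are a subsequence $(m_k)_k$ and a process $u\in L^2(\Omega;L^2(0,T;H^1(\Lambda)))$ which is predictable with values in $L^2(\Lambda)$, i.e. $u\in L^2_{\mathcal P_T}(\Omega\times(0,T);L^2(\Lambda))$, such that, as $k\to\infty$, $$u^r_{h_{m_k},N_{m_k}}\rightharpoonup u\quad\text{and}\quad u^l_{h_{m_k},N_{m_k}}\rightharpoonup u\quad\text{weakly in }L^2(\Omega;L^2(0,T;L^2(\Lambda))),$$ $$\nabla^h u^r_{h_{m_k},N_{m_k}}\rightharpoonup\nabla u\quad\text{weakly in }L^2(\Omega;L^2(0,T;L^2(\Lambda)^2)).$$ -/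

import Mathlib

open MeasureTheory ProbabilityTheory Filter Topology Set
open scoped NNReal ENNReal RealInnerProductSpace

/-- The Euclidean plane. -/
abbrev Plane : Type := EuclideanSpace ℝ (Fin 2)

/-! ### The spatial domain and the function spaces on it -/

/-- A set of the plane is polygonal if its boundary is a finite union of line segments. -/
def IsPolygonal (S : Set Plane) : Prop :=
  ∃ s : Finset (Plane × Plane), frontier S = ⋃ p ∈ s, segment ℝ p.1 p.2

/-- A bounded, open, connected and polygonal set of the plane. -/
structure PolygonalDomain where
  carrier : Set Plane
  isOpen : IsOpen carrier
  isBounded : Bornology.IsBounded carrier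
  isConnected : IsConnected carrier
  isPolygonal : IsPolygonal carrier

namespace PolygonalDomain

/-- Lebesgue measure on the domain. -/
noncomputable abbrev measure (Λ : PolygonalDomain) : Measure Plane :=
  volume.restrict Λ.carrier

instance instIsFiniteMeasure (Λ : PolygonalDomain) : IsFiniteMeasure Λ.measure :=
  ⟨by simpa using Λ.isBounded.measure_lt_top⟩

/-- The space `L²(Λ)`. -/
abbrev L2 (Λ : PolygonalDomain) : Type := Lp ℝ 2 Λ.measure

/-- The space `L²(Λ; ℝ²)`. -/
abbrev L2Vec (Λ : PolygonalDomain) : Type := Lp Plane 2 Λ.measure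

/-- `G` is the gradient of `f` in the sense of distributions on `Λ`: for every test function
`φ ∈ C_c^∞(Λ)` and every coordinate `i`, `∫_Λ f ∂ᵢφ = - ∫_Λ Gᵢ φ`. -/
def IsWeakGradient (Λ : PolygonalDomain) (f : Λ.L2) (G : Λ.L2Vec) : Prop :=
  ∀ φ : Plane → ℝ, ContDiff ℝ (⊤ : ℕ∞) φ → HasCompactSupport φ → tsupport φ ⊆ Λ.carrier →
    ∀ i : Fin 2,
      ∫ x in Λ.carrier, f x * fderiv ℝ φ x (EuclideanSpace.single i 1)
        = - ∫ x in Λ.carrier, G x i * φ x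

theorem integrable_mul_of_continuous (Λ : PolygonalDomain) {f : Plane → ℝ}
    (hf : MemLp f 2 Λ.measure) {ψ : Plane → ℝ} (hψ : Continuous ψ)
    (hc : HasCompactSupport ψ) : Integrable (fun x => f x * ψ x) Λ.measure :=
  MemLp.integrable_mul (q := 2) hf (hψ.memLp_of_hasCompactSupport hc)

theorem memLp_coord (Λ : PolygonalDomain) (G : Λ.L2Vec) (i : Fin 2) :
    MemLp (fun x => G x i) 2 Λ.measure :=
  ((EuclideanSpace.proj i : Plane →L[ℝ] ℝ).comp_memLp' (Lp.memLp G))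

theorem continuous_partial {φ : Plane → ℝ} (hφ : ContDiff ℝ (⊤ : ℕ∞) φ) (e : Plane) :
    Continuous (fun x => fderiv ℝ φ x e) :=
  (hφ.continuous_fderiv (by simp)).clm_apply continuous_const

theorem hasCompactSupport_partial {φ : Plane → ℝ} (hφ : HasCompactSupport φ) (e : Plane) :
    HasCompactSupport (fun x => fderiv ℝ φ x e) :=
  hφ.fderiv_apply ℝ e

/-- The pairs `(f, ∇f)` in `L²(Λ) × L²(Λ; ℝ²)` with `∇f` the weak gradient of `f`. -/
def sobolevGraph (Λ : PolygonalDomain) : Submodule ℝ (WithLp 2 (Λ.L2 × Λ.L2Vec)) where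
  carrier := {w | Λ.IsWeakGradient w.fst w.snd}
  zero_mem' := by
    intro φ _ _ _ i
    have h1 : ∫ x in Λ.carrier, ((0 : Λ.L2) : Plane → ℝ) x
        * fderiv ℝ φ x (EuclideanSpace.single i 1) = 0 := by
      rw [← integral_zero Plane ℝ (μ := Λ.measure)]
      refine integral_congr_ae ?_
      filter_upwards [Lp.coeFn_zero ℝ 2 Λ.measure] with x hx
      rw [hx, Pi.zero_apply, zero_mul]
    have h2 : ∫ x in Λ.carrier, ((0 : Λ.L2Vec) : Plane → Plane) x i * φ x = 0 := by
      rw [← integral_zero Plane ℝ (μ := Λ.measure)]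
      refine integral_congr_ae ?_
      filter_upwards [Lp.coeFn_zero Plane 2 Λ.measure] with x hx
      rw [hx, Pi.zero_apply, PiLp.zero_apply, zero_mul]
    exact h1.trans (by rw [← neg_zero, ← h2]; rfl)
  add_mem' := by
    intro a b ha hb φ h1 h2 h3 i
    have hA := Λ.integrable_mul_of_continuous (Lp.memLp a.fst)
      (continuous_partial h1 (EuclideanSpace.single i 1))
      (hasCompactSupport_partial h2 (EuclideanSpace.single i 1))
    have hB := Λ.integrable_mul_of_continuous (Lp.memLp b.fst)
      (continuous_partial h1 (EuclideanSpace.single i 1))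
      (hasCompactSupport_partial h2 (EuclideanSpace.single i 1))
    have hC := Λ.integrable_mul_of_continuous (Λ.memLp_coord a.snd i) h1.continuous h2
    have hD := Λ.integrable_mul_of_continuous (Λ.memLp_coord b.snd i) h1.continuous h2
    have e1 : ∫ x in Λ.carrier, ((a.fst + b.fst : Λ.L2) : Plane → ℝ) x
        * fderiv ℝ φ x (EuclideanSpace.single i 1)
        = (∫ x in Λ.carrier, a.fst x * fderiv ℝ φ x (EuclideanSpace.single i 1))
          + ∫ x in Λ.carrier, b.fst x * fderiv ℝ φ x (EuclideanSpace.single i 1) := by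
      rw [← integral_add hA hB]
      refine integral_congr_ae ?_
      filter_upwards [Lp.coeFn_add a.fst b.fst] with x hx
      rw [hx, Pi.add_apply, add_mul]
    have e2 : ∫ x in Λ.carrier, ((a.snd + b.snd : Λ.L2Vec) : Plane → Plane) x i * φ x
        = (∫ x in Λ.carrier, a.snd x i * φ x) + ∫ x in Λ.carrier, b.snd x i * φ x := by
      rw [← integral_add hC hD]
      refine integral_congr_ae ?_
      filter_upwards [Lp.coeFn_add a.snd b.snd] with x hx
      rw [hx, Pi.add_apply, PiLp.add_apply, add_mul]
    change ∫ x in Λ.carrier, ((a.fst + b.fst : Λ.L2) : Plane → ℝ) x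
        * fderiv ℝ φ x (EuclideanSpace.single i 1)
      = - ∫ x in Λ.carrier, ((a.snd + b.snd : Λ.L2Vec) : Plane → Plane) x i * φ x
    rw [e1, e2, ha φ h1 h2 h3 i, hb φ h1 h2 h3 i, neg_add]
  smul_mem' := by
    intro c a ha φ h1 h2 h3 i
    have e1 : ∫ x in Λ.carrier, ((c • a.fst : Λ.L2) : Plane → ℝ) x
        * fderiv ℝ φ x (EuclideanSpace.single i 1)
        = c * ∫ x in Λ.carrier, a.fst x * fderiv ℝ φ x (EuclideanSpace.single i 1) := by
      rw [← integral_const_mul]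
      refine integral_congr_ae ?_
      filter_upwards [Lp.coeFn_smul c a.fst] with x hx
      rw [hx, Pi.smul_apply, smul_eq_mul, mul_assoc]
    have e2 : ∫ x in Λ.carrier, ((c • a.snd : Λ.L2Vec) : Plane → Plane) x i * φ x
        = c * ∫ x in Λ.carrier, a.snd x i * φ x := by
      rw [← integral_const_mul]
      refine integral_congr_ae ?_
      filter_upwards [Lp.coeFn_smul c a.snd] with x hx
      rw [hx, Pi.smul_apply, PiLp.smul_apply, smul_eq_mul, mul_assoc]
    change ∫ x in Λ.carrier, ((c • a.fst : Λ.L2) : Plane → ℝ) x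
        * fderiv ℝ φ x (EuclideanSpace.single i 1)
      = - ∫ x in Λ.carrier, ((c • a.snd : Λ.L2Vec) : Plane → Plane) x i * φ x
    rw [e1, e2, ha φ h1 h2 h3 i, mul_neg]

/-- The Sobolev space `H¹(Λ)`: functions `f` in `L²(Λ)` with a weak gradient in `L²(Λ; ℝ²)`,
realized as the pairs `(f, ∇f)`. It carries the norm `(‖f‖² + ‖∇f‖²)^(1/2)`. -/
abbrev H1 (Λ : PolygonalDomain) : Type := Λ.sobolevGraph

/-- The function underlying an element of `H¹(Λ)`. -/
def H1.toL2 {Λ : PolygonalDomain} (w : Λ.H1) : Λ.L2 := (w : WithLp 2 (Λ.L2 × Λ.L2Vec)).fst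

/-- The gradient of an element of `H¹(Λ)`. -/
def H1.grad {Λ : PolygonalDomain} (w : Λ.H1) : Λ.L2Vec := (w : WithLp 2 (Λ.L2 × Λ.L2Vec)).snd

/-- The convection field: `v ∈ C¹([0,T] × Λ; ℝ²)`, continuous up to the boundary of `Λ`, with
`div_x v = 0` in `[0,T] × Λ` and `v · n = 0` on `[0,T] × ∂Λ`. The last condition is stated at the
relative interior points of the line segments contained in `∂Λ`, for the vectors `n` orthogonal to
the segment. -/
structure IsConvectionField (Λ : PolygonalDomain) (T : ℝ≥0) (v : ℝ → Plane → Plane) : Prop where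
  contDiffOn : ContDiffOn ℝ 1 (fun p : ℝ × Plane => v p.1 p.2) (Icc 0 (T : ℝ) ×ˢ Λ.carrier)
  continuousOn :
    ContinuousOn (fun p : ℝ × Plane => v p.1 p.2) (Icc 0 (T : ℝ) ×ˢ closure Λ.carrier)
  div_eq_zero : ∀ t ∈ Icc 0 (T : ℝ), ∀ x ∈ Λ.carrier,
    ∑ i : Fin 2, fderiv ℝ (v t) x (EuclideanSpace.single i 1) i = 0
  normal_eq_zero : ∀ t ∈ Icc 0 (T : ℝ), ∀ a b : Plane, a ≠ b →
    segment ℝ a b ⊆ frontier Λ.carrier → ∀ x ∈ openSegment ℝ a b,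
      ∀ n : Plane, ⟪n, b - a⟫ = 0 → ⟪v t x, n⟫ = 0

end PolygonalDomain

/-! ### Admissible finite-volume meshes -/

/-- An admissible finite-volume mesh of `Λ`: a finite family of nonempty open polygonal convex
subsets of `Λ` (the control volumes `K`), with centers `x_K`. Two control volumes `K ≠ L` are
neighbours if `closure K ∩ closure L` has positive length; this set is then their common edge. -/
structure AdmissibleMesh (Λ : PolygonalDomain) where
  /-- the number of control volumes -/
  card : ℕ
  /-- the control volumes -/
  cell : Fin card → Set Plane
  /-- the centers of the control volumes -/
  center : Fin card → Plane
  cell_nonempty : ∀ i, (cell i).Nonempty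
  cell_isOpen : ∀ i, IsOpen (cell i)
  cell_isPolygonal : ∀ i, IsPolygonal (cell i)
  cell_convex : ∀ i, Convex ℝ (cell i)
  cell_subset : ∀ i, cell i ⊆ Λ.carrier
  closure_eq : closure Λ.carrier = ⋃ i, closure (cell i)
  disjoint : ∀ i j, i ≠ j → Disjoint (interior (cell i)) (interior (cell j))
  center_mem : ∀ i, center i ∈ closure (cell i)
  /-- the centers of neighbours span a straight line, which is orthogonal to the common edge -/
  orthogonal : ∀ i j, i ≠ j → 0 < μH[1] (closure (cell i) ∩ closure (cell j)) →
    center i ≠ center j ∧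
      ∀ x ∈ closure (cell i) ∩ closure (cell j), ∀ y ∈ closure (cell i) ∩ closure (cell j),
        ⟪center j - center i, y - x⟫ = 0

namespace AdmissibleMesh

variable {Λ : PolygonalDomain}

/-- The mesh size: the largest diameter of a control volume. -/
noncomputable def size (M : AdmissibleMesh Λ) : ℝ := ⨆ i, Metric.diam (M.cell i)

/-- The common edge `σ = K|L`. -/
def edge (M : AdmissibleMesh Λ) (i j : Fin M.card) : Set Plane :=
  closure (M.cell i) ∩ closure (M.cell j)

/-- `K` and `L` are separated by an interior edge, i.e. they are neighbours and their common edge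
is not contained in `∂Λ`. -/
def Interior (M : AdmissibleMesh Λ) (i j : Fin M.card) : Prop :=
  i ≠ j ∧ 0 < μH[1] (M.edge i j) ∧ ¬ M.edge i j ⊆ frontier Λ.carrier

/-- The area `m_K` of a control volume. -/
noncomputable def cellArea (M : AdmissibleMesh Λ) (i : Fin M.card) : ℝ := volume.real (M.cell i)

/-- The length `m_σ` of the edge `σ = K|L`. -/
noncomputable def edgeLength (M : AdmissibleMesh Λ) (i j : Fin M.card) : ℝ :=
  (μH[1] : Measure Plane).real (M.edge i j)

/-- The distance `d_{K|L}` of the centers. -/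
noncomputable def centerDist (M : AdmissibleMesh Λ) (i j : Fin M.card) : ℝ :=
  dist (M.center i) (M.center j)

/-- The unit normal vector `n_{K,σ}` to the edge `σ = K|L` pointing out of `K`. Since
`x_K ∈ closure K`, `x_L ∈ closure L` and `x_L - x_K` is nonzero and orthogonal to `σ`, it is
`(x_L - x_K) / |x_L - x_K|`. -/
noncomputable def normal (M : AdmissibleMesh Λ) (i j : Fin M.card) : Plane :=
  (M.centerDist i j)⁻¹ • (M.center j - M.center i)

/-- The diamond `D_σ` of an edge `σ = K|L`: the open quadrangle with diagonals `σ` and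
`[x_K, x_L]`, i.e. the interior of the union of the two triangles with base `σ` and apexes `x_K`
and `x_L`. -/
def diamond (M : AdmissibleMesh Λ) (i j : Fin M.card) : Set Plane :=
  interior (convexHull ℝ (insert (M.center i) (M.edge i j)) ∪
    convexHull ℝ (insert (M.center j) (M.edge i j)))

/-- The piecewise constant function `∑_K w_K 1_K` as an element of `L²(Λ)`. -/
noncomputable def cellFunction (M : AdmissibleMesh Λ) (w : Fin M.card → ℝ) : Λ.L2 :=
  ∑ i, indicatorConstLp 2 (M.cell_isOpen i).measurableSet (measure_ne_top Λ.measure _) (w i)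

open scoped Classical in
/-- The discrete gradient `∇^h w` as an element of `L²(Λ; ℝ²)`: it takes the value
`2 (w_L - w_K) / d_{K|L} n_{K,σ}` on the diamond of each interior edge `σ = K|L`, and the exterior
edges do not contribute. Every edge is counted once (for `i < j`); the value is symmetric in `K`
and `L`. -/
noncomputable def discreteGradient (M : AdmissibleMesh Λ) (w : Fin M.card → ℝ) : Λ.L2Vec :=
  ∑ i, ∑ j, if i < j ∧ M.Interior i j then
    indicatorConstLp 2 (s := M.diamond i j) isOpen_interior.measurableSet
      (measure_ne_top Λ.measure _)
      ((2 * ((w j - w i) / M.centerDist i j)) • M.normal i j)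
    else 0

end AdmissibleMesh

/-! ### The finite-volume scheme -/

/-- The time nodes `t_n = n Δt = n T / N`. -/
noncomputable def timeNode (T : ℝ≥0) (N n : ℕ) : ℝ≥0 := n * T / N

/-- The time step `Δt = T / N`. -/
noncomputable def timeStep (T : ℝ≥0) (N : ℕ) : ℝ := T / N

/-- The function of time equal to `a n` on `[t_n, t_{n+1})` for `0 ≤ n < N` (and `0` elsewhere). -/
noncomputable def stepFunction {X : Type*} [AddCommMonoid X] (T : ℝ≥0) (N : ℕ) (a : ℕ → X)
    (t : ℝ) : X :=
  ∑ n ∈ Finset.range N,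
    (Ico (timeNode T N n : ℝ) (timeNode T N (n + 1) : ℝ)).indicator (fun _ => a n) t

namespace AdmissibleMesh

variable {Λ : PolygonalDomain}

/-- The mean normal velocity `v_{K,σ}^{n+1} = 1 / (Δt m_σ) ∫_{t_n}^{t_{n+1}} ∫_σ v · n_{K,σ}`. -/
noncomputable def edgeVelocity (M : AdmissibleMesh Λ) (T : ℝ≥0) (N : ℕ) (v : ℝ → Plane → Plane)
    (n : ℕ) (i j : Fin M.card) : ℝ :=
  (timeStep T N * M.edgeLength i j)⁻¹ *
    ∫ t in (timeNode T N n : ℝ)..(timeNode T N (n + 1) : ℝ),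
      ∫ x in M.edge i j, ⟪v t x, M.normal i j⟫ ∂μH[1]

/-- The upstream value on the edge `σ = K|L`: `w_K` if the normal velocity is nonnegative, `w_L`
otherwise. -/
noncomputable def upwind (M : AdmissibleMesh Λ) (T : ℝ≥0) (N : ℕ) (v : ℝ → Plane → Plane)
    (n : ℕ) (w : Fin M.card → ℝ) (i j : Fin M.card) : ℝ :=
  if 0 ≤ M.edgeVelocity T N v n i j then w i else w j

open scoped Classical in
/-- `w = u^{n+1}` solves the scheme at step `n + 1`, given `w' = u^n` and the increment
`dW = W(t_{n+1}) - W(t_n)`. -/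
def StepEquation (M : AdmissibleMesh Λ) (T : ℝ≥0) (N : ℕ) (v : ℝ → Plane → Plane) (g β : ℝ → ℝ)
    (n : ℕ) (w' w : Fin M.card → ℝ) (dW : ℝ) : Prop :=
  ∀ i : Fin M.card,
    M.cellArea i / timeStep T N * (w i - w' i)
      + (∑ j, if M.Interior i j then
          M.edgeLength i j * M.edgeVelocity T N v n i j * M.upwind T N v n w i j else 0)
      + (∑ j, if M.Interior i j then
          M.edgeLength i j / M.centerDist i j * (w i - w j) else 0)
      = M.cellArea i / timeStep T N * g (w' i) * dW + M.cellArea i * β (w i)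

/-- The random vectors `u^0, …, u^N` solve the finite-volume scheme: almost surely,
`u_K^0` is the mean value of `u_0` over `K`, and `u^{n+1}` solves the equations of the scheme for
`0 ≤ n < N`. -/
structure IsDiscreteSolution {Ω : Type*} [MeasurableSpace Ω] (M : AdmissibleMesh Λ) (T : ℝ≥0)
    (N : ℕ) (v : ℝ → Plane → Plane) (g β : ℝ → ℝ) (P : Measure Ω) (W : ℝ≥0 → Ω → ℝ)
    (u₀ : Ω → Λ.H1) (u : ℕ → Ω → Fin M.card → ℝ) : Prop where
  initial : ∀ᵐ ω ∂P, ∀ i,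
    u 0 ω i = (M.cellArea i)⁻¹ * ∫ x in M.cell i, (u₀ ω).toL2 x
  step : ∀ n < N, ∀ᵐ ω ∂P, M.StepEquation T N v g β n (u n ω) (u (n + 1) ω)
    (W (timeNode T N (n + 1)) ω - W (timeNode T N n) ω)

/-- The right-in-time approximation `u^r_{h,N}`, equal to `u^{n+1}` on `[t_n, t_{n+1})`. -/
noncomputable def rightApprox {Ω : Type*} (M : AdmissibleMesh Λ) (T : ℝ≥0) (N : ℕ)
    (u : ℕ → Ω → Fin M.card → ℝ) (p : Ω × ℝ) : Λ.L2 :=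
  stepFunction T N (fun n => M.cellFunction (u (n + 1) p.1)) p.2

/-- The left-in-time approximation `u^l_{h,N}`, equal to `u^n` on `[t_n, t_{n+1})`. -/
noncomputable def leftApprox {Ω : Type*} (M : AdmissibleMesh Λ) (T : ℝ≥0) (N : ℕ)
    (u : ℕ → Ω → Fin M.card → ℝ) (p : Ω × ℝ) : Λ.L2 :=
  stepFunction T N (fun n => M.cellFunction (u n p.1)) p.2

/-- The discrete gradient `∇^h u^r_{h,N}` of the right-in-time approximation. -/
noncomputable def rightGradient {Ω : Type*} (M : AdmissibleMesh Λ) (T : ℝ≥0) (N : ℕ)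
    (u : ℕ → Ω → Fin M.card → ℝ) (p : Ω × ℝ) : Λ.L2Vec :=
  stepFunction T N (fun n => M.discreteGradient (u (n + 1) p.1)) p.2

end AdmissibleMesh

/-! ### Probabilistic notions -/

/-- `W` is a standard real Brownian motion with respect to the filtration `F`. -/
structure IsBrownianMotionWrt {Ω : Type*} {mΩ : MeasurableSpace Ω} (F : Filtration ℝ≥0 mΩ)
    (P : Measure Ω) (W : ℝ≥0 → Ω → ℝ) : Prop where
  isBrownian : IsBrownianReal W P
  adapted : StronglyAdapted F W
  indep : ∀ s t : ℝ≥0, s ≤ t →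
    Indep (MeasurableSpace.comap (fun ω => W t ω - W s ω) inferInstance) (F s) P

/-- The product measure `dP ⊗ dt` on `Ω × (0,T)`. -/
noncomputable def timeProduct {Ω : Type*} [MeasurableSpace Ω] (P : Measure Ω) (T : ℝ≥0) :
    Measure (Ω × ℝ) :=
  P.prod (volume.restrict (Ioo 0 (T : ℝ)))

/-- Weak convergence of `f k` to `f'` in the Hilbert space `L²(X, μ; H)`. -/
def TendstoWeakL2 {X H : Type*} [MeasurableSpace X] [NormedAddCommGroup H]
    [InnerProductSpace ℝ H] (μ : Measure X) (f : ℕ → X → H) (f' : X → H) : Prop :=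
  ∃ (hf : ∀ k, MemLp (f k) 2 μ) (hf' : MemLp f' 2 μ),
    Tendsto (fun k => toWeakSpace ℝ (Lp H 2 μ) ((hf k).toLp (f k))) atTop
      (𝓝 (toWeakSpace ℝ (Lp H 2 μ) (hf'.toLp f')))

/-! The result is weak compactness, fed by an energy estimate that is uniform in the mesh and the
time step.

Energy. A step of the scheme is tested with $u^{n+1}$. Diffusion yields the discrete $H^1$ seminorm.
Convection contributes a nonnegative amount: the coefficients $m_\sigma v_{K,\sigma}$ are
antisymmetric and sum to zero around each control volume, and for such coefficients $a$ the upwind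
form equals $\frac12\sum a_{KL}^+(w_K-w_L)^2$ (`sum_upwind_nonneg`). The vanishing sums come from
$\operatorname{div}\mathbf v=0$ and $\mathbf v\cdot\mathbf n=0$ through a divergence theorem on
convex sets with flat faces (`integral_fderiv_eq_sum_faces`, `sum_flux_eq_zero`). The noise splits
into $g(u^n)u^n\Delta W$, of mean zero, and $g(u^n)(u^{n+1}-u^n)\Delta W$, absorbed by the squared
increment. A discrete Grönwall argument bounds $E\|u^n\|^2$, $\sum_n E\|u^{n+1}-u^n\|^2$ and $\Delta
t\sum_n E|u^{n+1}|_{1,h}^2$.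

Adaptedness. Nothing is assumed about measurability of the discrete solutions. Once $4L\Delta
t\le1$, with $L$ a Lipschitz constant of $\beta$, the solution of a step is a continuous function of
the data $u^n+g(u^n)\Delta W$ (`exists_solution_map`), so by induction $u^n$ agrees almost surely
with an $\mathcal F_{t_n}$-measurable vector, and the left approximation agrees almost everywhere
with a predictable process.

Consistency. Cellwise integration by parts writes $\langle\nabla^hw,\varphi e_l\rangle+\langle
w,\partial_l\varphi\rangle$ as a sum over the interior edges of
$(w_L-w_K)\,n_l\,\big(\frac2d\int_{D_\sigma}\varphi-\int_\sigma\varphi\big)$. Since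
$|D_\sigma|=m_\sigma d/2$, the bracket is $O(h\,m_\sigma)$, and Cauchy–Schwarz bounds the sum by
$Ch|w|_{1,h}$ (`abs_inner_add_inner_le`). This needs no regularity of the meshes beyond
admissibility.

Limit. The left approximations and the discrete gradients are bounded in a Hilbert space, so a
subsequence of both converges weakly. The right approximations have the same limit, being at
distance $O(\sqrt{\Delta t})$. Predictability survives because it defines a closed subspace. The
consistency bound becomes, for almost every $(\omega,t)$, the relation saying that the limit of the
gradients is the weak gradient of the limit. -/

/-! ### Coordinates in the plane and length integrals along a line. -/

/-- The point of the plane with `i`-th coordinate `p.2` and other coordinate `p.1`. -/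
noncomputable def frame (i : Fin 2) (p : ℝ × ℝ) : Plane :=
  WithLp.toLp 2 (fun j => if j = i then p.2 else p.1)

/-- The index of the other coordinate. -/
def other (i : Fin 2) : Fin 2 := if i = 0 then 1 else 0

theorem other_ne (i : Fin 2) : other i ≠ i := by fin_cases i <;> simp [other]

@[simp] theorem frame_same (i : Fin 2) (p : ℝ × ℝ) : frame i p i = p.2 := by simp [frame]

@[simp] theorem frame_other (i : Fin 2) (p : ℝ × ℝ) : frame i p (other i) = p.1 := by
  simp [frame, other_ne]

theorem Plane.ext_frame (i : Fin 2) {x y : Plane} (h : x i = y i) (h' : x (other i) = y (other i)) :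
    x = y := by
  ext j
  fin_cases i <;> fin_cases j <;> simp_all [other]

theorem frame_eta (i : Fin 2) (x : Plane) : frame i (x (other i), x i) = x :=
  Plane.ext_frame i (by simp) (by simp)

theorem inner_eq_frame (i : Fin 2) (x y : Plane) :
    ⟪x, y⟫ = x (other i) * y (other i) + x i * y i := by
  rw [PiLp.inner_apply, Fin.sum_univ_two]
  fin_cases i <;> simp [other] <;> ring

theorem norm_sq_eq_frame (i : Fin 2) (x : Plane) :
    ‖x‖ ^ 2 = x (other i) ^ 2 + x i ^ 2 := by
  rw [← real_inner_self_eq_norm_sq, inner_eq_frame i]; ring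

theorem continuous_frame (i : Fin 2) : Continuous (frame i) := by
  unfold frame
  refine (PiLp.continuous_toLp 2 _).comp (continuous_pi fun j => ?_)
  split_ifs <;> fun_prop

theorem frame_add_smul (i : Fin 2) (s t : ℝ) :
    frame i (s, t) = frame i (s, 0) + t • EuclideanSpace.single i (1 : ℝ) := by
  refine Plane.ext_frame i ?_ ?_ <;> simp [other_ne]

theorem hasDerivAt_frame (i : Fin 2) (s t : ℝ) :
    HasDerivAt (fun t => frame i (s, t)) (EuclideanSpace.single i (1 : ℝ)) t := by
  have : (fun t => frame i (s, t)) =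
      fun t => frame i (s, 0) + t • EuclideanSpace.single i (1 : ℝ) :=
    funext fun t => frame_add_smul i s t
  rw [this]
  simpa using ((hasDerivAt_id t).smul_const (EuclideanSpace.single i (1 : ℝ))).const_add
    (frame i (s, 0))

/-- `frame i` as a measurable equivalence. -/
noncomputable def frameEquiv (i : Fin 2) : ℝ × ℝ ≃ᵐ Plane where
  toFun := frame i
  invFun x := (x (other i), x i)
  left_inv p := by simp
  right_inv x := frame_eta i x
  measurable_toFun := (continuous_frame i).measurable
  measurable_invFun := by
    change Measurable (fun x : Plane => (x (other i), x i))
    fun_prop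

theorem measurePreserving_frame (i : Fin 2) : MeasurePreserving (frame i) volume volume := by
  have h1 : MeasurePreserving (fun p : ℝ × ℝ => (WithLp.toLp 2 ![p.1, p.2] : Plane)) :=
    (PiLp.volume_preserving_toLp (Fin 2)).comp
      (volume_preserving_finTwoArrow ℝ).symm
  have h2 : MeasurePreserving (Prod.swap : ℝ × ℝ → ℝ × ℝ) volume volume :=
    Measure.measurePreserving_swap
  fin_cases i
  · have e : frame 0 = (fun p : ℝ × ℝ => (WithLp.toLp 2 ![p.1, p.2] : Plane)) ∘ Prod.swap := by
      funext p
      ext j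
      fin_cases j <;> simp [frame]
    exact e ▸ h1.comp h2
  · have e : frame 1 = fun p : ℝ × ℝ => (WithLp.toLp 2 ![p.1, p.2] : Plane) := by
      funext p
      ext j
      fin_cases j <;> simp [frame]
    exact e ▸ h1

theorem integral_frame (i : Fin 2) (f : Plane → ℝ) :
    ∫ p : ℝ × ℝ, f (frame i p) = ∫ x, f x :=
  (measurePreserving_frame i).integral_comp (frameEquiv i).measurableEmbedding f

/-- A coordinate does not increase Hausdorff measure. -/
theorem ae_forall_coord_ne {A : Set Plane} (hA : μH[1] A = 0) (j : Fin 2) :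
    ∀ᵐ s : ℝ, ∀ x ∈ A, x j ≠ s := by
  have hl : LipschitzWith 1 (fun x : Plane => x j) := by
    refine LipschitzWith.of_dist_le_mul fun x y => ?_
    rw [NNReal.coe_one, one_mul, dist_eq_norm, dist_eq_norm]
    exact PiLp.norm_apply_le (x - y) j
  have h := (hl.lipschitzOnWith (s := A)).hausdorffMeasure_image_le (d := 1) zero_le_one
  rw [hA, mul_zero, nonpos_iff_eq_zero, hausdorffMeasure_real] at h
  filter_upwards [measure_eq_zero_iff_ae_notMem.1 h] with s hs x hx hxs
  exact hs ⟨x, hx, hxs⟩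

/-- The point with free coordinate `s` on the line `⟪n, x⟫ = c`. -/
noncomputable def linePoint (i : Fin 2) (n : Plane) (c s : ℝ) : Plane :=
  frame i (s, (c - n (other i) * s) / n i)

theorem continuous_linePoint (i : Fin 2) (n : Plane) (c : ℝ) : Continuous (linePoint i n c) :=
  (continuous_frame i).comp (by fun_prop)

theorem linePoint_eq {i : Fin 2} {n : Plane} (hn : n i ≠ 0) {c : ℝ} {x : Plane} (hx : ⟪n, x⟫ = c) :
    linePoint i n c (x (other i)) = x := by
  rw [inner_eq_frame i] at hx
  refine Plane.ext_frame i ?_ ?_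
  · simp only [linePoint, frame_same]
    rw [← hx]; field_simp; ring
  · simp [linePoint]

/-- Integration along a line, in terms of a coordinate. -/
theorem integral_line {i : Fin 2} {n : Plane} (hn1 : ‖n‖ = 1) (hn : n i ≠ 0) (c : ℝ)
    {E : Set Plane} (hEm : MeasurableSet E) (hE : ∀ x ∈ E, ⟪n, x⟫ = c) (φ : Plane → ℝ) :
    ∫ x in E, φ x ∂μH[1] = |n i|⁻¹ * ∫ s, E.indicator φ (linePoint i n c s) := by
  have hpos : 0 < |n i| := abs_pos.2 hn
  -- A unit of the free coordinate corresponds to length $1/|n_i|$ on the line, so rescaling by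
  -- $|n_i|$ gives the arc length parametrization, an isometry that carries Lebesgue measure to
  -- `μH[1]`.
  set δ : ℝ → Plane := fun r => linePoint i n c (|n i| * r) with hδ
  have hiso : Isometry δ := by
    refine Isometry.of_dist_eq fun r r' => ?_
    rw [dist_eq_norm, Real.dist_eq, ← sq_eq_sq₀ (norm_nonneg _) (abs_nonneg _),
      norm_sq_eq_frame i, sq_abs]
    have h1 := norm_sq_eq_frame i n
    rw [hn1] at h1
    simp only [hδ, linePoint, PiLp.sub_apply, frame_same, frame_other]
    have h2 : |n i| ^ 2 = n i ^ 2 := sq_abs _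
    have e : (|n i| * r - |n i| * r') ^ 2 +
        ((c - n (other i) * (|n i| * r)) / n i - (c - n (other i) * (|n i| * r')) / n i) ^ 2
        = |n i| ^ 2 * (n i ^ 2 + n (other i) ^ 2) / n i ^ 2 * (r - r') ^ 2 := by
      field_simp; ring
    rw [e, h2, add_comm (n i ^ 2), ← h1]
    field_simp
  have hemb : MeasurableEmbedding δ := hiso.isClosedEmbedding.measurableEmbedding
  have hmap : Measure.map δ volume = (μH[1] : Measure Plane).restrict (range δ) := by
    rw [← hausdorffMeasure_real]
    exact hiso.map_hausdorffMeasure (Or.inl zero_le_one)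
  have hsub : E ⊆ range δ := by
    intro x hx
    refine ⟨|n i|⁻¹ * x (other i), ?_⟩
    simp only [hδ]
    rw [← mul_assoc, mul_inv_cancel₀ hpos.ne', one_mul]
    exact linePoint_eq hn (hE x hx)
  have h1 : ∫ x in E, φ x ∂μH[1] = ∫ r, E.indicator φ (δ r) := by
    rw [← hemb.integral_map, hmap, integral_indicator hEm, Measure.restrict_restrict hEm,
      inter_eq_left.2 hsub]
  rw [h1]
  have := Measure.integral_comp_mul_left (fun s => E.indicator φ (linePoint i n c s)) |n i|
  simp only [hδ]
  rw [this, smul_eq_mul, abs_inv, abs_abs]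

/-! ### Slices of open convex sets. -/

theorem exists_Ioo_eq {S : Set ℝ} (ho : IsOpen S) (hc : Convex ℝ S) (hb : Bornology.IsBounded S)
    (hne : S.Nonempty) : ∃ a b, a < b ∧ S = Ioo a b := by
  have hconn : IsConnected S := ⟨hne, hc.isPreconnected⟩
  have hba := hb.bddAbove
  have hbb := hb.bddBelow
  have hsub := hconn.Ioo_csInf_csSup_subset hbb hba
  have e : S = Ioo (sInf S) (sSup S) := by
    refine Subset.antisymm (fun x hx => ?_) hsub
    obtain ⟨ε, hε, hball⟩ := Metric.isOpen_iff.1 ho x hx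
    have h1 : x - ε / 2 ∈ S := hball (by simp [abs_of_pos, hε])
    have h2 : x + ε / 2 ∈ S := hball (by simp [abs_of_pos, hε])
    have := csInf_le hbb h1
    have := le_csSup hba h2
    exact ⟨by linarith, by linarith⟩
  refine ⟨_, _, ?_, e⟩
  rw [e] at hne
  exact nonempty_Ioo.1 hne

/-- The slice of a set in the `i`-th coordinate direction. -/
def slice (i : Fin 2) (K : Set Plane) (s : ℝ) : Set ℝ := {t | frame i (s, t) ∈ K}

theorem slice_isOpen {i : Fin 2} {K : Set Plane} (hK : IsOpen K) (s : ℝ) : IsOpen (slice i K s) :=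
  hK.preimage ((continuous_frame i).comp (by fun_prop : Continuous fun t : ℝ => (s, t)))

theorem frame_convexComb (i : Fin 2) (s a b t t' : ℝ) (hab : a + b = 1) :
    frame i (s, a * t + b * t') = a • frame i (s, t) + b • frame i (s, t') := by
  refine Plane.ext_frame i ?_ ?_
  · simp
  · simp [← add_mul, hab]

theorem slice_convex {i : Fin 2} {K : Set Plane} (hK : Convex ℝ K) (s : ℝ) :
    Convex ℝ (slice i K s) := by
  intro t ht t' ht' a b ha hb hab
  change frame i (s, a * t + b * t') ∈ K
  rw [frame_convexComb i s a b t t' hab]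
  exact hK ht ht' ha hb hab

theorem slice_isBounded {i : Fin 2} {K : Set Plane} (hK : Bornology.IsBounded K) (s : ℝ) :
    Bornology.IsBounded (slice i K s) := by
  obtain ⟨C, hC⟩ := hK.exists_norm_le
  refine isBounded_iff_forall_norm_le.2 ⟨C, fun t ht => ?_⟩
  refine le_trans ?_ (hC _ ht)
  simpa using PiLp.norm_apply_le (frame i (s, t)) i

/-- In a nonempty slice of an open convex set, the slice of the closure lies in the closure of
the slice. -/
theorem mem_Icc_of_mem_closure {i : Fin 2} {K : Set Plane} (hKo : IsOpen K) (hKc : Convex ℝ K)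
    {s a b : ℝ} (hab : a < b) (hs : slice i K s = Ioo a b) {t : ℝ}
    (ht : frame i (s, t) ∈ closure K) : t ∈ Icc a b := by
  have hmid : (a + b) / 2 ∈ slice i K s := by rw [hs]; constructor <;> linarith
  have key : ∀ r ∈ Ioo (0 : ℝ) 1, r * ((a + b) / 2) + (1 - r) * t ∈ Ioo a b := by
    intro r hr
    rw [← hs]
    -- A proper convex combination of an interior point with a point of the closure is interior; the
    -- claim follows as the weight of the interior point tends to zero.
    change frame i (s, _) ∈ K
    rw [frame_convexComb i s r (1 - r) _ t (by ring), ← hKo.interior_eq]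
    refine hKc.combo_interior_closure_mem_interior ?_ ht hr.1 (by linarith [hr.2]) (by ring)
    rw [hKo.interior_eq]
    exact hmid
  have hlim : Tendsto (fun r : ℝ => r * ((a + b) / 2) + (1 - r) * t) (𝓝[>] 0) (𝓝 t) := by
    have : Continuous (fun r : ℝ => r * ((a + b) / 2) + (1 - r) * t) := by fun_prop
    have h := this.tendsto 0
    simp only [zero_mul, sub_zero, one_mul, zero_add] at h
    exact h.mono_left nhdsWithin_le_nhds
  refine isClosed_Icc.mem_of_tendsto hlim ?_
  filter_upwards [Ioo_mem_nhdsGT (zero_lt_one' ℝ)] with r hr using Ioo_subset_Icc_self (key r hr)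

theorem frame_mem_closure {i : Fin 2} {K : Set Plane} {s a b : ℝ} (hab : a < b)
    (hs : slice i K s = Ioo a b) {t : ℝ} (ht : t ∈ Icc a b) : frame i (s, t) ∈ closure K := by
  rw [← closure_Ioo hab.ne] at ht
  have hc : Continuous (fun t => frame i (s, t)) := (continuous_frame i).comp (by fun_prop)
  refine closure_mono ?_ (image_closure_subset_closure_image hc (mem_image_of_mem _ ht))
  rintro _ ⟨t, ht, rfl⟩
  rw [← hs] at ht
  exact ht

theorem frame_endpoint_mem_frontier {i : Fin 2} {K : Set Plane} (hKo : IsOpen K) {s a b : ℝ}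
    (hab : a < b) (hs : slice i K s = Ioo a b) {t : ℝ} (ht : t = a ∨ t = b) :
    frame i (s, t) ∈ frontier K := by
  rw [hKo.frontier_eq]
  refine ⟨frame_mem_closure hab hs ?_, fun h => ?_⟩
  · rcases ht with rfl | rfl
    · exact left_mem_Icc.2 hab.le
    · exact right_mem_Icc.2 hab.le
  · have : t ∈ slice i K s := h
    rw [hs] at this
    rcases ht with rfl | rfl
    · exact lt_irrefl _ this.1
    · exact lt_irrefl _ this.2

/-- The contribution of a flat face to the boundary term on a slice. -/
theorem face_slice {i : Fin 2} {K : Set Plane} (hKo : IsOpen K) (hKc : Convex ℝ K)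
    {s a b : ℝ} (hab : a < b) (hs : slice i K s = Ioo a b) {E : Set Plane} {n : Plane} {c : ℝ}
    (hE : E ⊆ frontier K) (hEn : ∀ x ∈ E, ⟪n, x⟫ = c) (hKn : ∀ x ∈ K, ⟪n, x⟫ < c)
    (hn0 : n i = 0 → ∀ x ∈ E, x (other i) ≠ s) (φ : Plane → ℝ) :
    n i * (|n i|⁻¹ * E.indicator φ (linePoint i n c s)) =
      E.indicator φ (frame i (s, b)) - E.indicator φ (frame i (s, a)) := by
  have hlt : ∀ t ∈ Ioo a b, n (other i) * s + n i * t < c := by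
    intro t ht
    rw [← hs] at ht
    have := hKn _ ht
    rw [inner_eq_frame i] at this
    simpa using this
  have heq : ∀ t, frame i (s, t) ∈ E → n (other i) * s + n i * t = c := by
    intro t ht
    have := hEn _ ht
    rw [inner_eq_frame i] at this
    simpa using this
  have hmid : (a + b) / 2 ∈ Ioo a b := by constructor <;> linarith
  have hE' : ∀ t, frame i (s, t) ∈ E → t = a ∨ t = b := by
    intro t ht
    have h1 := hE ht
    have h2 := mem_Icc_of_mem_closure hKo hKc hab hs (frontier_subset_closure h1)
    rw [hKo.frontier_eq] at h1
    by_contra! hne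
    apply h1.2
    change t ∈ slice i K s
    rw [hs]
    exact ⟨lt_of_le_of_ne h2.1 hne.1.symm, lt_of_le_of_ne h2.2 hne.2⟩
  -- Since `K` lies on the inner side of the line of `E`, the slice can meet `E` only at its lower
  -- end if $n_i<0$ and only at its upper end if $n_i>0$; `linePoint` is the sole candidate.
  -- Multiplication by $n_i|n_i|^{-1}$ supplies the sign of that end. A face with $n_i=0$ is
  -- excluded from the slice by `hn0`.
  rcases lt_trichotomy (n i) 0 with hneg | hzero | hpos
  · have hb : frame i (s, b) ∉ E := by
      intro h
      have h1 := heq b h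
      have h2 := hlt _ hmid
      nlinarith
    have hl : E.indicator φ (linePoint i n c s) = E.indicator φ (frame i (s, a)) := by
      by_cases h : linePoint i n c s ∈ E
      · rcases hE' _ h with h1 | h1
        · rw [linePoint, h1]
        · rw [linePoint, h1] at h
          exact absurd h hb
      · by_cases h2 : frame i (s, a) ∈ E
        · have := linePoint_eq hneg.ne (hEn _ h2)
          rw [frame_other] at this
          rw [this]
        · rw [indicator_of_notMem h, indicator_of_notMem h2]
    rw [hl, indicator_of_notMem hb, abs_of_neg hneg, inv_neg, neg_mul, mul_neg,
      mul_inv_cancel_left₀ hneg.ne, zero_sub]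
  · have hnot : ∀ t, frame i (s, t) ∉ E := fun t ht => hn0 hzero _ ht (by simp)
    rw [hzero, zero_mul, indicator_of_notMem (hnot _), indicator_of_notMem (hnot _), sub_zero]
  · have ha : frame i (s, a) ∉ E := by
      intro h
      have h1 := heq a h
      have h2 := hlt _ hmid
      nlinarith
    have hl : E.indicator φ (linePoint i n c s) = E.indicator φ (frame i (s, b)) := by
      by_cases h : linePoint i n c s ∈ E
      · rcases hE' _ h with h1 | h1
        · rw [linePoint, h1] at h
          exact absurd h ha
        · rw [linePoint, h1]
      · by_cases h2 : frame i (s, b) ∈ E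
        · have := linePoint_eq hpos.ne' (hEn _ h2)
          rw [frame_other] at this
          rw [this]
        · rw [indicator_of_notMem h, indicator_of_notMem h2]
    rw [hl, indicator_of_notMem ha, abs_of_pos hpos, mul_inv_cancel_left₀ hpos.ne', sub_zero]

/-! ### The divergence theorem on sets with flat faces. -/

/-- A set with finitely many flat faces: the faces `E k` lie on the boundary of `K`, on the line
`⟪n k, x⟫ = c k`, with `K` on the inner side of this line; they cover the boundary and overlap
only on sets of zero length. -/
structure IsFaceFamily (K : Set Plane) {ι : Type*} (E : ι → Set Plane) (n : ι → Plane)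
    (c : ι → ℝ) : Prop where
  measurableSet : ∀ k, MeasurableSet (E k)
  subset_frontier : ∀ k, E k ⊆ frontier K
  norm_normal : ∀ k, ‖n k‖ = 1
  inner_eq : ∀ k, ∀ x ∈ E k, ⟪n k, x⟫ = c k
  inner_lt : ∀ k, ∀ x ∈ K, ⟪n k, x⟫ < c k
  null_inter : ∀ k l, k ≠ l → μH[1] (E k ∩ E l) = 0
  null_compl : μH[1] (frontier K \ ⋃ k, E k) = 0

theorem integrable_indicator_linePoint {i : Fin 2} {K : Set Plane} (hKb : Bornology.IsBounded K)
    {E : Set Plane} (hEm : MeasurableSet E) (hE : E ⊆ closure K) {φ : Plane → ℝ}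
    (hφ : ContinuousOn φ (closure K)) (n : Plane) (c : ℝ) :
    Integrable (fun s => E.indicator φ (linePoint i n c s)) := by
  have hcont := continuous_linePoint i n c
  set S := linePoint i n c ⁻¹' closure K with hS
  have hSc : IsCompact S := by
    refine Metric.isCompact_of_isClosed_isBounded (isClosed_closure.preimage hcont) ?_
    obtain ⟨C, hC⟩ := hKb.closure.exists_norm_le
    refine isBounded_iff_forall_norm_le.2 ⟨C, fun t ht => ?_⟩
    refine le_trans ?_ (hC _ ht)
    simpa [linePoint] using PiLp.norm_apply_le (linePoint i n c t) (other i)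
  have h1 : IntegrableOn (fun s => φ (linePoint i n c s)) S :=
    (hφ.comp hcont.continuousOn (fun s hs => hs)).integrableOn_compact hSc
  have hm : MeasurableSet (linePoint i n c ⁻¹' E) := hcont.measurable hEm
  have h2 := (h1.mono_set (preimage_mono hE : linePoint i n c ⁻¹' E ⊆ S)).integrable_indicator hm
  exact h2

/-- **Divergence theorem** on a bounded open convex set with flat faces. -/
theorem integral_fderiv_eq_sum_faces {K : Set Plane} (hKo : IsOpen K) (hKc : Convex ℝ K)
    (hKb : Bornology.IsBounded K) {ι : Type*} [Fintype ι] {E : ι → Set Plane} {n : ι → Plane}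
    {c : ι → ℝ} (hF : IsFaceFamily K E n c) {φ : Plane → ℝ} (hφ : ContinuousOn φ (closure K))
    (hd : ∀ x ∈ K, DifferentiableAt ℝ φ x) (i : Fin 2)
    (hint : IntegrableOn (fun x => fderiv ℝ φ x (EuclideanSpace.single i 1)) K) :
    ∫ x in K, fderiv ℝ φ x (EuclideanSpace.single i 1) =
      ∑ k, n k i * ∫ x in E k, φ x ∂μH[1] := by
  set D : Plane → ℝ := K.indicator fun x => fderiv ℝ φ x (EuclideanSpace.single i 1) with hD
  have hDint : Integrable (fun p : ℝ × ℝ => D (frame i p)) :=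
    ((measurePreserving_frame i).integrable_comp_emb (frameEquiv i).measurableEmbedding).2
      (hint.integrable_indicator hKo.measurableSet)
  have hslice : ∀ᵐ s : ℝ, ∫ t, D (frame i (s, t)) =
      ∑ k, n k i * (|n k i|⁻¹ * (E k).indicator φ (linePoint i (n k) (c k) s)) := by
    -- The discarded values of `s` form a null set: free coordinates of face overlaps and of
    -- uncovered boundary points (Lipschitz images of sets of length zero), one value for each face
    -- parallel to direction `i`, and the frontier of the shadow of `K`.
    have h1 : ∀ᵐ s : ℝ, ∀ k l, k ≠ l → ∀ x ∈ E k ∩ E l, x (other i) ≠ s := by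
      refine ae_all_iff.2 fun k => ae_all_iff.2 fun l => ?_
      by_cases hkl : k = l
      · simp [hkl]
      · filter_upwards [ae_forall_coord_ne (hF.null_inter k l hkl) (other i)] with s hs _ using hs
    have h2 := ae_forall_coord_ne hF.null_compl (other i)
    have h3 : ∀ᵐ s : ℝ, ∀ k, n k i = 0 → ∀ x ∈ E k, x (other i) ≠ s := by
      refine ae_all_iff.2 fun k => ?_
      by_cases hk : n k i = 0
      · have hn : n k (other i) ≠ 0 := by
          intro h
          have := norm_sq_eq_frame i (n k)
          rw [hF.norm_normal, h, hk] at this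
          norm_num at this
        have : ∀ᵐ s : ℝ, s ≠ c k / n k (other i) := by
          simp [ae_iff]
        filter_upwards [this] with s hs _ x hx hxs
        have := hF.inner_eq k x hx
        rw [inner_eq_frame i, hk, zero_mul, add_zero, hxs] at this
        exact hs (by rw [← this]; field_simp)
      · simp [hk]
    have hconv : Convex ℝ ((fun x : Plane => x (other i)) '' K) :=
      hKc.is_linear_image (f := fun x : Plane => x (other i))
        ⟨fun x y => rfl, fun r x => rfl⟩
    have h4 : ∀ᵐ s : ℝ, s ∉ frontier ((fun x : Plane => x (other i)) '' K) :=
      measure_eq_zero_iff_ae_notMem.1 (hconv.addHaar_frontier volume)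
    have h5 : ∀ᵐ s : ℝ, Integrable (fun t => D (frame i (s, t))) := hDint.prod_right_ae
    filter_upwards [h1, h2, h3, h4, h5] with s h1 h2 h3 h4 h5
    rcases (slice i K s).eq_empty_or_nonempty with he | hne
    · have hz : ∀ t, D (frame i (s, t)) = 0 := fun t => by
        have ht : frame i (s, t) ∉ K := fun h => by
          have : t ∈ slice i K s := h
          rw [he] at this
          exact this
        exact indicator_of_notMem ht _
      rw [integral_congr_ae (Eventually.of_forall hz), integral_zero]
      refine (Finset.sum_eq_zero fun k _ => ?_).symm
      rw [indicator_of_notMem, mul_zero, mul_zero]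
      -- A face point over an empty slice would put `s` in the closure of the shadow of `K` but
      -- outside its interior, that is, on the discarded frontier.
      intro hk
      refine h4 ⟨?_, fun h => ?_⟩
      · have hc : Continuous (fun x : Plane => x (other i)) := by fun_prop
        have := image_closure_subset_closure_image hc
          (mem_image_of_mem _ (frontier_subset_closure (hF.subset_frontier k hk)))
        simpa [linePoint] using this
      · obtain ⟨x, hx, hxs⟩ := interior_subset h
        have : x i ∈ slice i K s := by
          change frame i (s, x i) ∈ K
          rw [← hxs, frame_eta]
          exact hx
        rw [he] at this
        exact this
    · obtain ⟨a, b, hab, hs⟩ := exists_Ioo_eq (slice_isOpen hKo s) (slice_convex hKc s)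
        (slice_isBounded hKb s) hne
      -- For the retained `s`, each end of the slice lies on exactly one face, so the face
      -- contributions add up to the boundary term of the fundamental theorem of calculus.
      have hone : ∀ t, t = a ∨ t = b →
          ∑ k, (E k).indicator φ (frame i (s, t)) = φ (frame i (s, t)) := by
        intro t ht
        have hfr := frame_endpoint_mem_frontier hKo hab hs ht
        have : frame i (s, t) ∈ ⋃ k, E k := by
          by_contra h
          exact h2 _ ⟨hfr, h⟩ (by simp)
        obtain ⟨k, hk⟩ := mem_iUnion.1 this
        rw [Finset.sum_eq_single k, indicator_of_mem hk]
        · intro l _ hl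
          refine indicator_of_notMem (fun h => ?_) _
          exact h1 l k hl _ ⟨h, hk⟩ (by simp)
        · simp
      rw [Finset.sum_congr rfl fun k _ => face_slice hKo hKc hab hs (hF.subset_frontier k)
        (hF.inner_eq k) (hF.inner_lt k) (h3 k) φ, Finset.sum_sub_distrib, hone b (Or.inr rfl),
        hone a (Or.inl rfl)]
      have hDs : ∀ t, D (frame i (s, t)) = (Ioo a b).indicator
          (fun t => fderiv ℝ φ (frame i (s, t)) (EuclideanSpace.single i 1)) t := by
        intro t
        rw [← hs]
        rfl
      rw [integral_congr_ae (Eventually.of_forall hDs), integral_indicator measurableSet_Ioo,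
        ← integral_Ioc_eq_integral_Ioo, ← intervalIntegral.integral_of_le hab.le]
      refine intervalIntegral.integral_eq_sub_of_hasDerivAt_of_le hab.le
        (f := fun t => φ (frame i (s, t))) ?_ ?_ ?_
      · exact hφ.comp ((continuous_frame i).comp (by fun_prop)).continuousOn
          (fun t ht => frame_mem_closure hab hs ht)
      · intro t ht
        rw [← hs] at ht
        exact (hd _ ht).hasFDerivAt.comp_hasDerivAt t (hasDerivAt_frame i s t)
      · rw [intervalIntegrable_iff_integrableOn_Ioo_of_le hab.le]
        rw [← integrable_indicator_iff measurableSet_Ioo]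
        exact h5.congr (Eventually.of_forall hDs)
  calc ∫ x in K, fderiv ℝ φ x (EuclideanSpace.single i 1)
      = ∫ x, D x := (integral_indicator hKo.measurableSet).symm
    _ = ∫ p : ℝ × ℝ, D (frame i p) := (integral_frame i D).symm
    _ = ∫ s, ∫ t, D (frame i (s, t)) := integral_prod _ hDint
    _ = ∫ s, ∑ k, n k i * (|n k i|⁻¹ * (E k).indicator φ (linePoint i (n k) (c k) s)) :=
        integral_congr_ae hslice
    _ = ∑ k, n k i * ∫ x in E k, φ x ∂μH[1] := by
        rw [integral_finsetSum]
        · refine Finset.sum_congr rfl fun k _ => ?_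
          rw [integral_const_mul, integral_const_mul]
          by_cases hk : n k i = 0
          · simp [hk]
          · rw [integral_line (hF.norm_normal k) hk (c k) (hF.measurableSet k) (hF.inner_eq k)]
        · intro k _
          exact ((integrable_indicator_linePoint hKb (hF.measurableSet k)
            ((hF.subset_frontier k).trans frontier_subset_closure) hφ _ _).const_mul _).const_mul _

/-! ### Perpendicular vectors, lines and supporting lines in the plane. -/

/-- The rotation by a right angle. -/
noncomputable def perp (n : Plane) : Plane := !₂[-n 1, n 0]

theorem inner_plane (x y : Plane) : ⟪x, y⟫ = x 0 * y 0 + x 1 * y 1 := by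
  rw [inner_eq_frame 1]; simp [other]

theorem norm_sq_plane (x : Plane) : ‖x‖ ^ 2 = x 0 ^ 2 + x 1 ^ 2 := by
  rw [← real_inner_self_eq_norm_sq, inner_plane]; ring

theorem norm_perp (n : Plane) : ‖perp n‖ = ‖n‖ := by
  rw [← sq_eq_sq₀ (norm_nonneg _) (norm_nonneg _), norm_sq_plane, norm_sq_plane]
  simp [perp]; ring

theorem eq_add_perp {n : Plane} (hn : ‖n‖ = 1) (x : Plane) :
    x = ⟪n, x⟫ • n + ⟪perp n, x⟫ • perp n := by
  have h := norm_sq_plane n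
  rw [hn] at h
  ext j
  fin_cases j
  · simp [inner_plane, perp]; linear_combination x 0 * h
  · simp [inner_plane, perp]; linear_combination x 1 * h

theorem exists_smul_of_perp {w p q : Plane} (hw : w ≠ 0) (hp : p ≠ 0) (hpw : ⟪p, w⟫ = 0)
    (hqw : ⟪q, w⟫ = 0) : ∃ r : ℝ, q = r • p := by
  rw [inner_plane] at hpw hqw
  have hp2 : p 0 ^ 2 + p 1 ^ 2 ≠ 0 := by
    rw [← norm_sq_plane]; exact pow_ne_zero _ (norm_ne_zero_iff.2 hp)
  have hw2 : w 0 ^ 2 + w 1 ^ 2 ≠ 0 := by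
    rw [← norm_sq_plane]; exact pow_ne_zero _ (norm_ne_zero_iff.2 hw)
  -- The determinant of two vectors orthogonal to `w`, multiplied by $|w|^2$, is a combination of
  -- the two orthogonality relations.
  have hc : p 0 * q 1 - p 1 * q 0 = 0 := by
    refine (mul_eq_zero.1 ?_ : w 0 ^ 2 + w 1 ^ 2 = 0 ∨ _).resolve_left hw2
    linear_combination (w 0 * q 1 - w 1 * q 0) * hpw + (w 1 * p 0 - w 0 * p 1) * hqw
  refine ⟨(p 0 * q 0 + p 1 * q 1) / (p 0 ^ 2 + p 1 ^ 2), ?_⟩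
  ext j
  fin_cases j
  · simp; field_simp; linear_combination (-p 1) * hc
  · simp; field_simp; linear_combination (p 0) * hc

theorem hausdorffMeasure_lt_top_of_line {n : Plane} (hn : ‖n‖ = 1) {c : ℝ} {E : Set Plane}
    (hb : Bornology.IsBounded E) (hE : ∀ x ∈ E, ⟪n, x⟫ = c) : μH[1] E < ∞ := by
  obtain ⟨C, hC⟩ := hb.exists_norm_le
  set w := perp n
  have hw : ‖w‖ = 1 := by rw [norm_perp, hn]
  have hsub : E ⊆ segment ℝ (c • n + (-C) • w) (c • n + C • w) := by
    intro x hx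
    have h1 : |⟪w, x⟫| ≤ C := (abs_real_inner_le_norm _ _).trans (by rw [hw, one_mul]; exact hC x hx)
    rw [eq_add_perp hn x, hE x hx]
    rcases eq_or_lt_of_le ((abs_nonneg _).trans h1) with h0 | h0
    · rw [← h0] at h1 ⊢
      have : ⟪w, x⟫ = 0 := abs_nonpos_iff.1 h1
      change c • n + ⟪w, x⟫ • w ∈ _
      simp [this]
    · rw [abs_le] at h1
      refine ⟨(C - ⟪w, x⟫) / (2 * C), (C + ⟪w, x⟫) / (2 * C), ?_, ?_, ?_, ?_⟩
      · apply div_nonneg <;> linarith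
      · apply div_nonneg <;> linarith
      · field_simp; ring
      · change _ = c • n + ⟪w, x⟫ • w
        ext j
        simp
        field_simp
        ring
  refine (measure_mono hsub).trans_lt ?_
  rw [hausdorffMeasure_segment]
  exact edist_lt_top _ _

instance : NullSingletonClass (μH[1] : Measure Plane) :=
  Measure.nullSingletonClass_hausdorff Plane one_pos

theorem exists_ne_of_hausdorffMeasure_pos {E : Set Plane} (hE : 0 < μH[1] E) :
    ∃ a ∈ E, ∃ b ∈ E, a ≠ b := by
  by_contra! h
  have hs : E.Subsingleton := fun a ha b hb => h a ha b hb
  exact hE.ne' (hs.measure_zero μH[1])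

theorem inner_le_of_mem_closure {K : Set Plane} {n : Plane} {c : ℝ} (h : ∀ x ∈ K, ⟪n, x⟫ ≤ c) :
    ∀ x ∈ closure K, ⟪n, x⟫ ≤ c := by
  intro x hx
  have hcl : IsClosed {x : Plane | ⟪n, x⟫ ≤ c} := isClosed_le (by fun_prop) continuous_const
  exact closure_minimal h hcl hx

/-- A supporting line through a segment which touches the closure of an open convex set. -/
theorem exists_supporting_line {K : Set Plane} (hKo : IsOpen K) (hKc : Convex ℝ K)
    (hne : K.Nonempty) {a b : Plane} (ha : a ∈ closure K) (hb : b ∈ closure K)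
    (hdisj : Disjoint K (segment ℝ a b)) :
    ∃ n : Plane, ‖n‖ = 1 ∧ ⟪n, b - a⟫ = 0 ∧ ∀ x ∈ K, ⟪n, x⟫ < ⟪n, a⟫ := by
  obtain ⟨f, u, hfK, hfs⟩ := geometric_hahn_banach_open hKc hKo (convex_segment a b) hdisj
  set m := (InnerProductSpace.toDual ℝ Plane).symm f
  have hm : ∀ x, f x = ⟪m, x⟫ := fun x => by simp [m]
  simp only [hm] at hfK hfs
  -- The end points lie in the closure of `K` and on the far side of the separating line, hence on
  -- the line itself; so the normal is orthogonal to the segment.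
  have hcl := inner_le_of_mem_closure (fun x hx => (hfK x hx).le)
  have hau : ⟪m, a⟫ = u := le_antisymm (hcl a ha) (hfs a (left_mem_segment ℝ a b))
  have hbu : ⟪m, b⟫ = u := le_antisymm (hcl b hb) (hfs b (right_mem_segment ℝ a b))
  have hm0 : m ≠ 0 := by
    intro h
    obtain ⟨x, hx⟩ := hne
    have h1 := hfK x hx
    rw [← hau, h] at h1
    simp at h1
  have hpos : 0 < ‖m‖⁻¹ := inv_pos.2 (norm_pos_iff.2 hm0)
  refine ⟨‖m‖⁻¹ • m, ?_, ?_, ?_⟩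
  · rw [norm_smul, norm_inv, norm_norm, inv_mul_cancel₀ (norm_ne_zero_iff.2 hm0)]
  · rw [real_inner_smul_left, inner_sub_right, hau, hbu, sub_self, mul_zero]
  · intro x hx
    rw [real_inner_smul_left, real_inner_smul_left, hau]
    exact mul_lt_mul_of_pos_left (hfK x hx) hpos

/-! ### Edges and faces of control volumes. -/

namespace AdmissibleMesh

variable {Λ : PolygonalDomain} (M : AdmissibleMesh Λ)

/-- Two control volumes are neighbours. -/
def Neighbor (i j : Fin M.card) : Prop := i ≠ j ∧ 0 < μH[1] (M.edge i j)

theorem edge_comm (i j : Fin M.card) : M.edge i j = M.edge j i := inter_comm _ _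

variable {M}

theorem Neighbor.symm {i j : Fin M.card} (h : M.Neighbor i j) : M.Neighbor j i :=
  ⟨h.1.symm, M.edge_comm i j ▸ h.2⟩

theorem Interior.neighbor {i j : Fin M.card} (h : M.Interior i j) : M.Neighbor i j := ⟨h.1, h.2.1⟩

theorem Interior.symm {i j : Fin M.card} (h : M.Interior i j) : M.Interior j i :=
  ⟨h.1.symm, M.edge_comm i j ▸ h.2.1, M.edge_comm i j ▸ h.2.2⟩

theorem centerDist_comm (i j : Fin M.card) : M.centerDist i j = M.centerDist j i := dist_comm _ _

theorem normal_swap (i j : Fin M.card) : M.normal j i = -M.normal i j := by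
  rw [normal, normal, centerDist_comm, ← smul_neg, neg_sub]

theorem edgeLength_comm (i j : Fin M.card) : M.edgeLength i j = M.edgeLength j i := by
  rw [edgeLength, edge_comm]; rfl

theorem Neighbor.centerDist_pos {i j : Fin M.card} (h : M.Neighbor i j) : 0 < M.centerDist i j :=
  dist_pos.2 (M.orthogonal i j h.1 h.2).1

theorem Neighbor.norm_normal {i j : Fin M.card} (h : M.Neighbor i j) : ‖M.normal i j‖ = 1 := by
  have := h.centerDist_pos
  rw [normal, norm_smul, norm_inv, Real.norm_of_nonneg this.le, ← dist_eq_norm, dist_comm]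
  exact inv_mul_cancel₀ this.ne'

theorem Neighbor.center_sub {i j : Fin M.card} (h : M.Neighbor i j) :
    M.center j - M.center i = M.centerDist i j • M.normal i j := by
  rw [normal, smul_smul, mul_inv_cancel₀ h.centerDist_pos.ne', one_smul]

theorem Neighbor.inner_sub {i j : Fin M.card} (h : M.Neighbor i j) {x y : Plane}
    (hx : x ∈ M.edge i j) (hy : y ∈ M.edge i j) : ⟪M.normal i j, y - x⟫ = 0 := by
  rw [normal, real_inner_smul_left, (M.orthogonal i j h.1 h.2).2 x hx y hy, mul_zero]

theorem disjoint_cell {i j : Fin M.card} (h : i ≠ j) : Disjoint (M.cell i) (M.cell j) := by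
  have := M.disjoint i j h
  rwa [(M.cell_isOpen i).interior_eq, (M.cell_isOpen j).interior_eq] at this

/-- The line through a common edge separates the two control volumes. -/
theorem Neighbor.separates {i j : Fin M.card} (h : M.Neighbor i j) {a : Plane}
    (ha : a ∈ M.edge i j) :
    (∀ x ∈ M.cell i, ⟪M.normal i j, x⟫ < ⟪M.normal i j, a⟫) ∧
      ∀ x ∈ M.cell j, ⟪M.normal i j, a⟫ < ⟪M.normal i j, x⟫ := by
  suffices key : ∃ a₀ ∈ M.edge i j,
      (∀ x ∈ M.cell i, ⟪M.normal i j, x⟫ < ⟪M.normal i j, a₀⟫) ∧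
        ∀ x ∈ M.cell j, ⟪M.normal i j, a₀⟫ < ⟪M.normal i j, x⟫ by
    obtain ⟨a₀, ha₀, hk⟩ := key
    have : ⟪M.normal i j, a⟫ = ⟪M.normal i j, a₀⟫ := by
      have := h.inner_sub ha₀ ha
      rw [inner_sub_right] at this
      linarith
    rwa [this]
  obtain ⟨a, ha, b, hb, hab⟩ := exists_ne_of_hausdorffMeasure_pos h.2
  refine ⟨a, ha, ?_⟩
  obtain ⟨f, u, hfi, hfj⟩ := geometric_hahn_banach_open_open (M.cell_convex i) (M.cell_isOpen i)
    (M.cell_convex j) (M.cell_isOpen j) (disjoint_cell h.1)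
  set m := (InnerProductSpace.toDual ℝ Plane).symm f
  have hm : ∀ x, f x = ⟪m, x⟫ := fun x => by simp [m]
  simp only [hm] at hfi hfj
  have hcli := inner_le_of_mem_closure (fun x hx => (hfi x hx).le)
  have hclj : ∀ x ∈ closure (M.cell j), u ≤ ⟪m, x⟫ := by
    intro x hx
    have := inner_le_of_mem_closure (n := -m) (c := -u)
      (fun x hx => by rw [inner_neg_left]; linarith [hfj x hx]) x hx
    rw [inner_neg_left] at this
    linarith
  have hau : ⟪m, a⟫ = u := le_antisymm (hcli a ha.1) (hclj a ha.2)
  have hbu : ⟪m, b⟫ = u := le_antisymm (hcli b hb.1) (hclj b hb.2)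
  have hn0 : M.normal i j ≠ 0 := norm_ne_zero_iff.1 (by rw [h.norm_normal]; exact one_ne_zero)
  -- A separating functional is constant on the edge, hence a multiple of the mesh normal. The
  -- multiple is nonnegative because the two centers lie in the two closures, and nonzero because
  -- the separation is strict.
  obtain ⟨r, hr⟩ := exists_smul_of_perp (sub_ne_zero.2 hab.symm) hn0 (h.inner_sub ha hb)
    (by rw [inner_sub_right, hau, hbu, sub_self] : ⟪m, b - a⟫ = 0)
  have hr0 : 0 ≤ r := by
    have h1 : 0 ≤ ⟪m, M.center j - M.center i⟫ := by
      rw [inner_sub_right]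
      linarith [hcli _ (M.center_mem i), hclj _ (M.center_mem j)]
    rw [h.center_sub, hr, real_inner_smul_left, real_inner_smul_right, real_inner_self_eq_norm_sq,
      h.norm_normal] at h1
    have := h.centerDist_pos
    by_contra! hneg
    nlinarith
  have hrpos : 0 < r := by
    refine lt_of_le_of_ne hr0 fun h0 => ?_
    obtain ⟨x, hx⟩ := M.cell_nonempty i
    have h1 := hfi x hx
    rw [← hau, hr, ← h0] at h1
    simp at h1
  constructor
  · intro x hx
    have h1 := hfi x hx
    rw [← hau, hr, real_inner_smul_left, real_inner_smul_left] at h1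
    exact lt_of_mul_lt_mul_left h1 hr0
  · intro x hx
    have h1 := hfj x hx
    rw [← hau, hr, real_inner_smul_left, real_inner_smul_left] at h1
    exact lt_of_mul_lt_mul_left h1 hr0

/-- Three different control volumes have no common boundary of positive length. -/
theorem hausdorffMeasure_edge_inter {i j k : Fin M.card} (hij : i ≠ j) (hik : i ≠ k)
    (hjk : j ≠ k) : μH[1] (M.edge i j ∩ M.edge i k) = 0 := by
  by_contra hne
  have hpos : 0 < μH[1] (M.edge i j ∩ M.edge i k) := pos_iff_ne_zero.2 hne
  obtain ⟨a, ha, b, hb, hab⟩ := exists_ne_of_hausdorffMeasure_pos hpos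
  have hNij : M.Neighbor i j := ⟨hij, hpos.trans_le (measure_mono inter_subset_left)⟩
  have hNik : M.Neighbor i k := ⟨hik, hpos.trans_le (measure_mono inter_subset_right)⟩
  have hNjk : M.Neighbor j k :=
    ⟨hjk, hpos.trans_le (measure_mono fun x hx => ⟨hx.1.2, hx.2.2⟩)⟩
  have hajk : a ∈ M.edge j k := ⟨ha.1.2, ha.2.2⟩
  have hbjk : b ∈ M.edge j k := ⟨hb.1.2, hb.2.2⟩
  have hn0 : M.normal i j ≠ 0 := norm_ne_zero_iff.1 (by rw [hNij.norm_normal]; exact one_ne_zero)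
  obtain ⟨r, hr⟩ := exists_smul_of_perp (sub_ne_zero.2 hab.symm) hn0 (hNij.inner_sub ha.1 hb.1)
    (hNik.inner_sub ha.2 hb.2)
  obtain ⟨q, hq⟩ := exists_smul_of_perp (sub_ne_zero.2 hab.symm) hn0 (hNij.inner_sub ha.1 hb.1)
    (hNjk.inner_sub hajk hbjk)
  obtain ⟨x, hx⟩ := M.cell_nonempty i
  obtain ⟨y, hy⟩ := M.cell_nonempty j
  obtain ⟨z, hz⟩ := M.cell_nonempty k
  have h1 := (hNij.separates ha.1).1 x hx
  have h2 := (hNij.separates ha.1).2 y hy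
  have h3 := (hNik.separates ha.2).1 x hx
  have h4 := (hNik.separates ha.2).2 z hz
  have h5 := (hNjk.separates hajk).1 y hy
  have h6 := (hNjk.separates hajk).2 z hz
  rw [hr, real_inner_smul_left, real_inner_smul_left] at h3 h4
  rw [hq, real_inner_smul_left, real_inner_smul_left] at h5 h6
  set A := ⟪M.normal i j, a⟫
  -- The common segment makes all three normals parallel. Then `j` and `k` both lie on the side
  -- opposite to `i`, which contradicts that the same line separates them.
  have hrpos : 0 < r := by nlinarith
  have hz' : A < ⟪M.normal i j, z⟫ := lt_of_mul_lt_mul_left h4 hrpos.le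
  nlinarith

theorem edge_subset_frontier {i j : Fin M.card} (hij : i ≠ j) :
    M.edge i j ⊆ frontier (M.cell i) := by
  intro x hx
  rw [(M.cell_isOpen i).frontier_eq]
  refine ⟨hx.1, fun h => ?_⟩
  obtain ⟨y, hy, hy'⟩ := mem_closure_iff.1 hx.2 _ (M.cell_isOpen i) h
  exact disjoint_left.1 (disjoint_cell hij) hy hy'

theorem isClosed_edge (i j : Fin M.card) : IsClosed (M.edge i j) :=
  isClosed_closure.inter isClosed_closure

theorem cell_isBounded (i : Fin M.card) : Bornology.IsBounded (M.cell i) :=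
  Λ.isBounded.subset (M.cell_subset i)

theorem closure_cell_subset (i : Fin M.card) : closure (M.cell i) ⊆ closure Λ.carrier :=
  closure_mono (M.cell_subset i)

theorem isCompact_closure_cell (i : Fin M.card) : IsCompact (closure (M.cell i)) :=
  (cell_isBounded i).isCompact_closure

/-- A point of $\Lambda$ away from the closures of the other cells has a neighbourhood contained in
the closure of the cell `i`. Convexity gives this closure the same interior as the cell, so the
point is not on the frontier. -/
theorem frontier_cell_subset (i : Fin M.card) :
    frontier (M.cell i) ⊆ (⋃ j ∈ {j | i ≠ j}, M.edge i j) ∪ frontier Λ.carrier := by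
  intro x hx
  by_contra hcon
  rw [mem_union, not_or] at hcon
  have hxc := frontier_subset_closure hx
  have hxΛ : x ∈ Λ.carrier := by
    by_contra h
    exact hcon.2 (Λ.isOpen.frontier_eq ▸ ⟨closure_cell_subset i hxc, h⟩)
  have hnot : ∀ j, i ≠ j → x ∉ closure (M.cell j) := by
    intro j hj h
    exact hcon.1 (mem_biUnion (show j ∈ {j | i ≠ j} from hj) ⟨hxc, h⟩)
  have hU : IsOpen (Λ.carrier ∩ ⋂ j ∈ {j | i ≠ j}, (closure (M.cell j))ᶜ) :=
    Λ.isOpen.inter ((Set.toFinite {j | i ≠ j}).isOpen_biInter fun j _ => isClosed_closure.isOpen_compl)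
  have hsub : Λ.carrier ∩ ⋂ j ∈ {j | i ≠ j}, (closure (M.cell j))ᶜ ⊆ closure (M.cell i) := by
    rintro y ⟨hy, hy'⟩
    have := M.closure_eq ▸ subset_closure hy
    obtain ⟨j, hj⟩ := mem_iUnion.1 this
    by_cases hij : i = j
    · exact hij ▸ hj
    · exact absurd hj (mem_iInter₂.1 hy' j hij)
  have hxint : x ∈ interior (closure (M.cell i)) :=
    interior_maximal hsub hU ⟨hxΛ, mem_iInter₂.2 hnot⟩
  rw [(M.cell_convex i).interior_closure_eq_interior_of_nonempty_interior
    (by rw [(M.cell_isOpen i).interior_eq]; exact M.cell_nonempty i)] at hxint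
  exact hx.2 hxint

/-- The boundary of a control volume consists of its interior edges and of flat pieces contained
in segments of the boundary of the domain. -/
theorem exists_faces (i : Fin M.card) :
    ∃ (m : ℕ) (S : Finset (Fin m)) (R : S → Set Plane) (n : S → Plane) (c : S → ℝ)
      (c' : {j // M.Interior i j} → ℝ),
      IsFaceFamily (M.cell i) (Sum.elim (fun j : {j // M.Interior i j} => M.edge i j) R)
        (Sum.elim (fun j : {j // M.Interior i j} => M.normal i j) n) (Sum.elim c' c) ∧
      ∀ k, ∃ a b : Plane, a ≠ b ∧ segment ℝ a b ⊆ frontier Λ.carrier ∧ R k ⊆ segment ℝ a b ∧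
        ⟪n k, b - a⟫ = 0 := by
  classical
  obtain ⟨s, hs⟩ := Λ.isPolygonal
  set e := s.equivFin
  set seg : Fin s.card → Set Plane := fun k => segment ℝ (e.symm k).1.1 (e.symm k).1.2 with hseg
  have hsegΛ : frontier Λ.carrier = ⋃ k, seg k := by
    rw [hs]
    ext x
    simp only [mem_iUnion, hseg]
    constructor
    · rintro ⟨p, hp, hx⟩
      exact ⟨e ⟨p, hp⟩, by simpa using hx⟩
    · rintro ⟨k, hx⟩
      exact ⟨_, (e.symm k).2, hx⟩
  have hsegcl : ∀ k, IsClosed (seg k) := fun k => by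
    simp only [hseg]
    rw [← convexHull_pair]
    exact (Set.toFinite _).isClosed_convexHull ℝ
  -- Removing the interior edges and the segments of smaller index makes these pieces disjoint from
  -- the edges and from each other.
  set R : Fin s.card → Set Plane := fun k =>
    (frontier (M.cell i) ∩ seg k) \
      ((⋃ j : {j // M.Interior i j}, M.edge i j) ∪ ⋃ l : {l // l < k}, seg l) with hR
  have hRm : ∀ k, MeasurableSet (R k) := fun k =>
    (isClosed_frontier.inter (hsegcl k)).measurableSet.diff
      ((MeasurableSet.iUnion fun j => (isClosed_edge _ _).measurableSet).union
        (MeasurableSet.iUnion fun l => (hsegcl _).measurableSet))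
  -- Two points of a piece span a segment in $\partial\Lambda$, which misses the open cell; the
  -- supporting line through it is the line of the whole boundary segment.
  have hRnorm : ∀ k, 0 < μH[1] (R k) → ∃ n : Plane, ‖n‖ = 1 ∧
      ⟪n, (e.symm k).1.2 - (e.symm k).1.1⟫ = 0 ∧ (e.symm k).1.1 ≠ (e.symm k).1.2 ∧
      ∀ x ∈ M.cell i, ⟪n, x⟫ < ⟪n, (e.symm k).1.1⟫ := by
    intro k hk
    obtain ⟨a, ha, b, hb, hab⟩ := exists_ne_of_hausdorffMeasure_pos hk
    have hsub : segment ℝ a b ⊆ seg k := (convex_segment _ _).segment_subset ha.1.2 hb.1.2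
    have hdisj : Disjoint (M.cell i) (segment ℝ a b) := by
      refine disjoint_left.2 fun x hx hx' => ?_
      have h1 : x ∈ frontier Λ.carrier := hsegΛ ▸ mem_iUnion.2 ⟨k, hsub hx'⟩
      rw [Λ.isOpen.frontier_eq] at h1
      exact h1.2 (M.cell_subset i hx)
    obtain ⟨n, hn1, hn2, hn3⟩ := exists_supporting_line (M.cell_isOpen i) (M.cell_convex i)
      (M.cell_nonempty i) (frontier_subset_closure ha.1.1) (frontier_subset_closure hb.1.1) hdisj
    set p := (e.symm k).1.1
    set q := (e.symm k).1.2
    have hpar : ∀ x ∈ seg k, ∃ r : ℝ, x = p + r • (q - p) := by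
      intro x hx
      have hx' : x ∈ segment ℝ p q := hx
      rw [segment_eq_image'] at hx'
      obtain ⟨r, _, hr⟩ := hx'
      exact ⟨r, hr.symm⟩
    obtain ⟨ra, hra⟩ := hpar a ha.1.2
    obtain ⟨rb, hrb⟩ := hpar b hb.1.2
    have hne : rb - ra ≠ 0 := by
      intro h
      apply hab
      rw [hra, hrb, sub_eq_zero.1 h]
    have hperp : ⟪n, q - p⟫ = 0 := by
      have : b - a = (rb - ra) • (q - p) := by rw [hra, hrb, sub_smul]; abel
      rw [this, real_inner_smul_right] at hn2
      exact (mul_eq_zero.1 hn2).resolve_left hne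
    refine ⟨n, hn1, hperp, ?_, ?_⟩
    · intro hpq
      apply hab
      rw [hra, hrb, hpq, sub_self, smul_zero, smul_zero]
    · intro x hx
      have := hn3 x hx
      rwa [hra, inner_add_right, real_inner_smul_right, hperp, mul_zero, add_zero] at this
  -- Only pieces of positive length determine a normal; the others are null and may stay uncovered.
  set S : Finset (Fin s.card) := Finset.univ.filter fun k => 0 < μH[1] (R k) with hS
  have hSpos : ∀ k : S, 0 < μH[1] (R k) := fun k => (Finset.mem_filter.1 k.2).2
  choose n hn1 hn2 hn3 hn4 using fun k : S => hRnorm k (hSpos k)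
  have hpt : ∀ j : {j // M.Interior i j}, ∃ a, a ∈ M.edge i j := fun j =>
    let ⟨a, ha, _⟩ := exists_ne_of_hausdorffMeasure_pos j.2.2.1
    ⟨a, ha⟩
  choose a ha using hpt
  refine ⟨s.card, S, fun k => R k, n, fun k => ⟪n k, (e.symm k).1.1⟫,
    fun j => ⟪M.normal i j, a j⟫, ⟨?_, ?_, ?_, ?_, ?_, ?_, ?_⟩, ?_⟩
  · rintro (j | k)
    · exact (isClosed_edge _ _).measurableSet
    · exact hRm k
  · rintro (j | k)
    · exact edge_subset_frontier j.2.1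
    · exact fun x hx => hx.1.1
  · rintro (j | k)
    · exact j.2.neighbor.norm_normal
    · exact hn1 k
  · rintro (j | k) x hx
    · have := j.2.neighbor.inner_sub (ha j) hx
      rw [inner_sub_right] at this
      simp only [Sum.elim_inl]
      linarith
    · have hx' : x ∈ segment ℝ (e.symm k).1.1 (e.symm k).1.2 := hx.1.2
      rw [segment_eq_image'] at hx'
      obtain ⟨r, _, hr⟩ := hx'
      simp only [Sum.elim_inr]
      rw [← hr, inner_add_right, real_inner_smul_right, hn2 k, mul_zero, add_zero]
  · rintro (j | k) x hx
    · exact (j.2.neighbor.separates (ha j)).1 x hx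
    · exact hn4 k x hx
  · have hmix : ∀ (j : {j // M.Interior i j}) (k : S), M.edge i j ∩ R k = ∅ := by
      intro j k
      refine eq_empty_of_forall_notMem fun x hx => hx.2.2 (Or.inl (mem_iUnion.2 ⟨j, hx.1⟩))
    have hlt : ∀ k l : S, (k : Fin s.card) < l → R k ∩ R l = ∅ := by
      intro k l hkl
      exact eq_empty_of_forall_notMem fun x hx => hx.2.2 (Or.inr (mem_iUnion.2 ⟨⟨k, hkl⟩, hx.1.1.2⟩))
    rintro (j | k) (j' | k') hne
    · refine hausdorffMeasure_edge_inter j.2.1 j'.2.1 fun h => hne ?_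
      rw [Subtype.ext h]
    · simp only [Sum.elim_inl, Sum.elim_inr]
      rw [hmix, measure_empty]
    · simp only [Sum.elim_inl, Sum.elim_inr]
      rw [inter_comm, hmix, measure_empty]
    · simp only [Sum.elim_inr]
      rcases lt_trichotomy (k : Fin s.card) k' with h | h | h
      · rw [hlt k k' h, measure_empty]
      · exact absurd (congrArg _ (Subtype.ext h)) hne
      · rw [inter_comm, hlt k' k h, measure_empty]
  · have hsub : frontier (M.cell i) \
        ⋃ k, Sum.elim (fun j : {j // M.Interior i j} => M.edge i j) (fun k : S => R k) k ⊆
        (⋃ j ∈ {j | i ≠ j ∧ μH[1] (M.edge i j) = 0}, M.edge i j) ∪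
          ⋃ k ∈ {k | μH[1] (R k) = 0}, R k := by
      rintro x ⟨hx, hx'⟩
      rw [mem_iUnion, not_exists] at hx'
      have hxe : ∀ j, M.Interior i j → x ∉ M.edge i j := fun j hj => hx' (Sum.inl ⟨j, hj⟩)
      have hxR : ∀ k, x ∈ R k → μH[1] (R k) = 0 := by
        intro k hk
        by_contra h
        exact hx' (Sum.inr ⟨k, Finset.mem_filter.2 ⟨Finset.mem_univ _, pos_iff_ne_zero.2 h⟩⟩) hk
      have hcase : (∃ j, i ≠ j ∧ μH[1] (M.edge i j) = 0 ∧ x ∈ M.edge i j) ∨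
          x ∈ frontier Λ.carrier := by
        rcases frontier_cell_subset i hx with h | h
        · obtain ⟨j, hj, hxj⟩ := mem_iUnion₂.1 h
          by_cases h0 : μH[1] (M.edge i j) = 0
          · exact Or.inl ⟨j, hj, h0, hxj⟩
          -- A common edge of positive length that is not interior is contained in
          -- $\partial\Lambda$.
          · right
            by_contra hxf
            exact hxe j ⟨hj, pos_iff_ne_zero.2 h0, fun hs => hxf (hs hxj)⟩ hxj
        · exact Or.inr h
      rcases hcase with ⟨j, hj, h0, hxj⟩ | hxf
      · exact Or.inl (mem_biUnion (show j ∈ {j | i ≠ j ∧ μH[1] (M.edge i j) = 0} from ⟨hj, h0⟩) hxj)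
      · right
        rw [hsegΛ] at hxf
        have hex : ∃ k, x ∈ seg k := mem_iUnion.1 hxf
        -- The piece containing `x` is that of the first boundary segment through `x`.
        obtain ⟨k, hk, hmin⟩ := WellFounded.has_min (wellFounded_lt (α := Fin s.card))
          {k | x ∈ seg k} hex
        have hxk : x ∈ R k := by
          refine ⟨⟨hx, hk⟩, ?_⟩
          rintro (h | h)
          · obtain ⟨j, hj⟩ := mem_iUnion.1 h
            exact hxe j j.2 hj
          · obtain ⟨l, hl⟩ := mem_iUnion.1 h
            exact hmin l hl l.2
        exact mem_biUnion (show k ∈ {k | μH[1] (R k) = 0} from hxR k hxk) hxk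
    refine measure_mono_null hsub (measure_union_null ?_ ?_)
    · exact (measure_biUnion_null_iff (Set.toFinite _).countable).2 fun j hj => hj.2
    · exact (measure_biUnion_null_iff (Set.toFinite _).countable).2 fun k hk => hk
  · intro k
    exact ⟨_, _, hn3 k, hsegΛ ▸ subset_iUnion seg k, fun x hx => hx.1.2, hn2 k⟩

end AdmissibleMesh

/-! ### Flux of a divergence free field. -/

namespace IsFaceFamily

variable {K : Set Plane} {ι : Type*} {E : ι → Set Plane} {n : ι → Plane} {c : ι → ℝ}

theorem hausdorffMeasure_lt_top (hF : IsFaceFamily K E n c) (hKb : Bornology.IsBounded K) (k : ι) :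
    μH[1] (E k) < ∞ :=
  hausdorffMeasure_lt_top_of_line (hF.norm_normal k)
    (hKb.closure.subset ((hF.subset_frontier k).trans frontier_subset_closure)) (hF.inner_eq k)

theorem isFiniteMeasure (hF : IsFaceFamily K E n c) (hKb : Bornology.IsBounded K) (k : ι) :
    IsFiniteMeasure ((μH[1] : Measure Plane).restrict (E k)) :=
  ⟨by simpa using hF.hausdorffMeasure_lt_top hKb k⟩

theorem integrableOn (hF : IsFaceFamily K E n c) (hKb : Bornology.IsBounded K) (k : ι)
    {φ : Plane → ℝ} (hφ : ContinuousOn φ (closure K)) : IntegrableOn φ (E k) μH[1] := by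
  have := hF.isFiniteMeasure hKb k
  have hsub := (hF.subset_frontier k).trans frontier_subset_closure
  obtain ⟨C, hC⟩ := hKb.isCompact_closure.exists_bound_of_continuousOn hφ
  refine Integrable.of_bound ((hφ.mono hsub).aestronglyMeasurable (hF.measurableSet k)) C ?_
  exact (ae_restrict_iff' (hF.measurableSet k)).2 (Eventually.of_forall fun x hx => hC x (hsub hx))

theorem sum_integral_div [Fintype ι] (hF : IsFaceFamily K E n c) (hKo : IsOpen K)
    (hKc : Convex ℝ K) (hKb : Bornology.IsBounded K) {w : Plane → Plane}
    (hw : ContinuousOn w (closure K)) (hd : ∀ x ∈ K, DifferentiableAt ℝ w x)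
    (hint : ∀ l, IntegrableOn (fun x => fderiv ℝ w x (EuclideanSpace.single l 1) l) K) :
    ∫ x in K, ∑ l, fderiv ℝ w x (EuclideanSpace.single l 1) l =
      ∑ k, ∫ x in E k, ⟪w x, n k⟫ ∂μH[1] := by
  have hcoord : ∀ l, ContinuousOn (fun x => w x l) (closure K) := fun l =>
    (EuclideanSpace.proj (𝕜 := ℝ) l).continuous.comp_continuousOn hw
  have hder : ∀ l, ∀ x ∈ K, HasFDerivAt (fun x => w x l)
      ((EuclideanSpace.proj (𝕜 := ℝ) l).comp (fderiv ℝ w x)) x := fun l x hx =>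
    ((EuclideanSpace.proj l : Plane →L[ℝ] ℝ).hasFDerivAt).comp x (hd x hx).hasFDerivAt
  have hfd : ∀ l, ∀ x ∈ K, fderiv ℝ (fun x => w x l) x (EuclideanSpace.single l 1) =
      fderiv ℝ w x (EuclideanSpace.single l 1) l := fun l x hx => by
    rw [(hder l x hx).fderiv]; rfl
  have hD : ∀ l, ∫ x in K, fderiv ℝ w x (EuclideanSpace.single l 1) l =
      ∑ k, n k l * ∫ x in E k, w x l ∂μH[1] := by
    intro l
    rw [← integral_fderiv_eq_sum_faces hKo hKc hKb hF (hcoord l)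
      (fun x hx => (hder l x hx).differentiableAt) l]
    · exact setIntegral_congr_fun hKo.measurableSet fun x hx => (hfd l x hx).symm
    · exact (hint l).congr_fun (fun x hx => (hfd l x hx).symm) hKo.measurableSet
  rw [integral_finsetSum _ fun l _ => hint l, Finset.sum_congr rfl fun l _ => hD l,
    Finset.sum_comm]
  refine Finset.sum_congr rfl fun k _ => ?_
  simp_rw [← integral_const_mul]
  rw [← integral_finsetSum _ fun l _ => (hF.integrableOn hKb k (hcoord l)).const_mul _]
  refine integral_congr_ae (Eventually.of_forall fun x => ?_)
  simp only [Fin.sum_univ_two, inner_plane]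
  ring

/-- A divergence free field has no flux through the boundary of a convex set with flat faces. -/
theorem sum_flux_eq_zero [Fintype ι] (hF : IsFaceFamily K E n c) (hKo : IsOpen K)
    (hKc : Convex ℝ K) (hKb : Bornology.IsBounded K) (hne : K.Nonempty) {w : Plane → Plane}
    (hw : ContinuousOn w (closure K)) (hd : ContDiffOn ℝ 1 w K)
    (hdiv : ∀ x ∈ K, ∑ l, fderiv ℝ w x (EuclideanSpace.single l 1) l = 0) :
    ∑ k, ∫ x in E k, ⟪w x, n k⟫ ∂μH[1] = 0 := by
  obtain ⟨p, hp⟩ := hne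
  -- The field is $C^1$ only inside `K`. The homothety about `p` of ratio $r_m<1$ maps the closure
  -- into `K`, and the divergence of $w\circ A_m$ is $r_m$ times that of $w$ at the image point,
  -- hence zero. Continuity up to the boundary and dominated convergence then allow $r_m\to1$.
  set r : ℕ → ℝ := fun m => 1 - 1 / ((m : ℝ) + 2) with hr
  have hr1 : ∀ m, 0 < r m ∧ r m < 1 := fun m => by
    have h2 : (1 : ℝ) < (m : ℝ) + 2 := by linarith [m.cast_nonneg (α := ℝ)]
    have h3 : 1 / ((m : ℝ) + 2) < 1 := (div_lt_one (by linarith)).2 h2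
    have h4 : 0 < 1 / ((m : ℝ) + 2) := by positivity
    constructor <;> simp only [hr] <;> linarith
  set A : ℕ → Plane → Plane := fun m x => p + r m • (x - p) with hA
  have hAc : ∀ m, Continuous (A m) := fun m => by simp only [hA]; fun_prop
  have hAK : ∀ m, ∀ x ∈ closure K, A m x ∈ K := by
    intro m x hx
    have h := hKc.combo_interior_closure_mem_interior (hKo.interior_eq.symm ▸ hp) hx
      (sub_pos.2 (hr1 m).2) (hr1 m).1.le (by ring : 1 - r m + r m = 1)
    rw [hKo.interior_eq] at h
    convert h using 1
    simp only [hA]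
    module
  have hdA : ∀ m x, HasFDerivAt (A m) (r m • ContinuousLinearMap.id ℝ Plane) x := fun m x =>
    (((hasFDerivAt_id x).sub_const p).const_smul (r m)).const_add p
  have hdw : ∀ x ∈ K, HasFDerivAt w (fderiv ℝ w x) x := fun x hx =>
    ((hd.contDiffAt (hKo.mem_nhds hx)).differentiableAt one_ne_zero).hasFDerivAt
  have hcomp : ∀ m, ∀ x ∈ closure K,
      HasFDerivAt (w ∘ A m) ((fderiv ℝ w (A m x)).comp (r m • ContinuousLinearMap.id ℝ Plane)) x :=
    fun m x hx => (hdw _ (hAK m x hx)).comp x (hdA m x)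
  have hzero : ∀ m, ∑ k, ∫ x in E k, ⟪w (A m x), n k⟫ ∂μH[1] = 0 := by
    intro m
    have hfd : ∀ l, ∀ x ∈ closure K, fderiv ℝ (w ∘ A m) x (EuclideanSpace.single l 1) l =
        r m * fderiv ℝ w (A m x) (EuclideanSpace.single l 1) l := by
      intro l x hx
      rw [(hcomp m x hx).fderiv]
      simp
    have := hF.sum_integral_div hKo hKc hKb (w := w ∘ A m)
      (fun x hx => (hcomp m x hx).continuousAt.continuousWithinAt)
      (fun x hx => (hcomp m x (subset_closure hx)).differentiableAt) (fun l => ?_)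
    · refine this.symm.trans ?_
      rw [setIntegral_congr_fun (g := fun _ => 0) hKo.measurableSet]
      · simp
      · intro x hx
        simp only
        rw [Finset.sum_congr rfl fun l _ => hfd l x (subset_closure hx), ← Finset.mul_sum,
          hdiv _ (hAK m x (subset_closure hx)), mul_zero]
    · have hcont : ContinuousOn
          (fun x => r m * fderiv ℝ w (A m x) (EuclideanSpace.single l 1) l) (closure K) := by
        have h1 : ContinuousOn (fun x => fderiv ℝ w (A m x)) (closure K) :=
          (hd.continuousOn_fderiv_of_isOpen hKo le_rfl).comp (hAc m).continuousOn (hAK m)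
        exact continuousOn_const.mul ((EuclideanSpace.proj (𝕜 := ℝ) l).continuous.comp_continuousOn
          (h1.clm_apply continuousOn_const))
      exact ((hcont.integrableOn_compact hKb.isCompact_closure).mono_set subset_closure).congr_fun
        (fun x hx => (hfd l x (subset_closure hx)).symm) hKo.measurableSet
  obtain ⟨C, hC⟩ := hKb.isCompact_closure.exists_bound_of_continuousOn hw
  have hrlim : Tendsto r atTop (𝓝 1) := by
    have h1 : Tendsto (fun m : ℕ => 1 / ((m : ℝ) + 2)) atTop (𝓝 0) :=
      tendsto_const_nhds.div_atTop (tendsto_natCast_atTop_atTop.atTop_add tendsto_const_nhds)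
    simpa [hr] using h1.const_sub 1
  have hlim : Tendsto (fun m => ∑ k, ∫ x in E k, ⟪w (A m x), n k⟫ ∂μH[1]) atTop
      (𝓝 (∑ k, ∫ x in E k, ⟪w x, n k⟫ ∂μH[1])) := by
    refine tendsto_finsetSum _ fun k _ => ?_
    have := hF.isFiniteMeasure hKb k
    have hsub := (hF.subset_frontier k).trans frontier_subset_closure
    refine tendsto_integral_of_dominated_convergence (fun _ => C) (fun m => ?_)
      (integrable_const C) (fun m => ?_) ?_
    · have h1 : ContinuousOn (fun x => ⟪w (A m x), n k⟫) (E k) := fun x hx =>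
        ((hcomp m x (hsub hx)).continuousAt.inner continuousAt_const).continuousWithinAt
      exact h1.aestronglyMeasurable (hF.measurableSet k)
    · refine (ae_restrict_iff' (hF.measurableSet k)).2 (Eventually.of_forall fun x hx => ?_)
      refine (abs_real_inner_le_norm _ _).trans ?_
      rw [hF.norm_normal, mul_one]
      exact hC _ (subset_closure (hAK m x (hsub hx)))
    · refine (ae_restrict_iff' (hF.measurableSet k)).2 (Eventually.of_forall fun x hx => ?_)
      have hAx : Tendsto (fun m => A m x) atTop (𝓝[closure K] x) := by
        refine tendsto_nhdsWithin_iff.2 ⟨?_, Eventually.of_forall fun m =>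
          subset_closure (hAK m x (hsub hx))⟩
        have := (hrlim.smul_const (x - p)).const_add p
        simpa [hA] using this
      exact ((hw x (hsub hx)).tendsto.comp hAx).inner tendsto_const_nhds
  exact tendsto_nhds_unique hlim (by simp only [hzero]; exact tendsto_const_nhds)

end IsFaceFamily

/-! ### Integration by parts and flux balance on control volumes. -/

namespace AdmissibleMesh

variable {Λ : PolygonalDomain} {M : AdmissibleMesh Λ}

open scoped Classical in
theorem sum_interior (i : Fin M.card) (f : Fin M.card → ℝ) :
    ∑ j : {j // M.Interior i j}, f j = ∑ j, if M.Interior i j then f j else 0 := by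
  rw [← Finset.sum_filter]
  exact (Finset.sum_subtype _ (by simp) f).symm

open scoped Classical in
/-- Integration by parts on a control volume for a test function. -/
theorem integral_fderiv_cell (i : Fin M.card) {φ : Plane → ℝ} (hφ : ContDiff ℝ (⊤ : ℕ∞) φ)
    (hs : tsupport φ ⊆ Λ.carrier) (l : Fin 2) :
    ∫ x in M.cell i, fderiv ℝ φ x (EuclideanSpace.single l 1) =
      ∑ j, if M.Interior i j then M.normal i j l * ∫ x in M.edge i j, φ x ∂μH[1] else 0 := by
  obtain ⟨m, S, R, n, c, c', hF, hR⟩ := exists_faces i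
  have hcont : Continuous (fun x => fderiv ℝ φ x (EuclideanSpace.single l 1)) :=
    PolygonalDomain.continuous_partial hφ _
  rw [integral_fderiv_eq_sum_faces (M.cell_isOpen i) (M.cell_convex i) (cell_isBounded i) hF
    hφ.continuous.continuousOn (fun x _ => (hφ.differentiable (by simp)).differentiableAt) l
    ((hcont.continuousOn.integrableOn_compact (isCompact_closure_cell i)).mono_set subset_closure),
    Fintype.sum_sum_type]
  -- The remaining faces lie in $\partial\Lambda$, off the support of the test function.
  have hz : ∀ k, ∫ x in R k, φ x ∂μH[1] = 0 := by
    intro k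
    obtain ⟨a, b, -, hab, hRk, -⟩ := hR k
    refine setIntegral_eq_zero_of_forall_eq_zero fun x hx => ?_
    have h1 := hab (hRk hx)
    rw [Λ.isOpen.frontier_eq] at h1
    exact image_eq_zero_of_notMem_tsupport fun h => h1.2 (hs h)
  simp only [Sum.elim_inl, Sum.elim_inr, hz, mul_zero, Finset.sum_const_zero, add_zero]
  exact sum_interior i fun j => M.normal i j l * ∫ x in M.edge i j, φ x ∂μH[1]

open scoped Classical in
/-- The convection field has no flux through the interior edges of a control volume. -/
theorem sum_flux_edge {T : ℝ≥0} {v : ℝ → Plane → Plane} (hv : Λ.IsConvectionField T v) {t : ℝ}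
    (ht : t ∈ Icc 0 (T : ℝ)) (i : Fin M.card) :
    ∑ j, (if M.Interior i j then ∫ x in M.edge i j, ⟪v t x, M.normal i j⟫ ∂μH[1] else 0) = 0 := by
  obtain ⟨m, S, R, n, c, c', hF, hR⟩ := exists_faces i
  have hin : ∀ s : Set Plane, MapsTo (fun x : Plane => (t, x)) s (Icc 0 (T : ℝ) ×ˢ s) :=
    fun s x hx => ⟨ht, hx⟩
  have hc : ContinuousOn (v t) (closure (M.cell i)) :=
    (hv.continuousOn.comp (f := fun x : Plane => (t, x)) (by fun_prop) (hin _)).mono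
      (closure_cell_subset i)
  have hd : ContDiffOn ℝ 1 (v t) (M.cell i) :=
    (hv.contDiffOn.comp (f := fun x : Plane => (t, x)) (by fun_prop) (hin _)).mono
      (M.cell_subset i)
  have h0 := hF.sum_flux_eq_zero (M.cell_isOpen i) (M.cell_convex i) (cell_isBounded i)
    (M.cell_nonempty i) hc hd fun x hx => hv.div_eq_zero t ht x (M.cell_subset i hx)
  rw [Fintype.sum_sum_type] at h0
  have hz : ∀ k, ∫ x in R k, ⟪v t x, n k⟫ ∂μH[1] = 0 := by
    intro k
    obtain ⟨a, b, hne, hab, hRk, hn⟩ := hR k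
    have hae : ∀ᵐ x ∂(μH[1] : Measure Plane).restrict (R k), ⟪v t x, n k⟫ = 0 := by
      -- The no-flux condition is available on open segments only; the two end points have length
      -- zero.
      have h1 : ∀ᵐ x ∂(μH[1] : Measure Plane), x ∉ ({a, b} : Set Plane) :=
        measure_eq_zero_iff_ae_notMem.1 ((Set.toFinite _).measure_zero _)
      refine (ae_restrict_iff' (hF.measurableSet (Sum.inr k))).2 ?_
      filter_upwards [h1] with x hx hxR
      refine hv.normal_eq_zero t ht a b hne hab x ?_ (n k) hn
      exact mem_openSegment_of_ne_left_right (fun h => hx (by simp [h])) (fun h => hx (by simp [h]))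
        (hRk hxR)
    rw [integral_congr_ae hae, integral_zero]
  simp only [Sum.elim_inl, Sum.elim_inr, hz, Finset.sum_const_zero, add_zero] at h0
  exact (sum_interior i fun j => ∫ x in M.edge i j, ⟪v t x, M.normal i j⟫ ∂μH[1]).symm.trans h0

theorem Neighbor.hausdorffMeasure_lt_top {i j : Fin M.card} (h : M.Neighbor i j) :
    μH[1] (M.edge i j) < ∞ := by
  obtain ⟨a, ha, -⟩ := exists_ne_of_hausdorffMeasure_pos h.2
  refine hausdorffMeasure_lt_top_of_line h.norm_normal (c := ⟪M.normal i j, a⟫)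
    ((isCompact_closure_cell i).isBounded.subset inter_subset_left) fun x hx => ?_
  have := h.inner_sub ha hx
  rw [inner_sub_right] at this
  linarith

theorem Neighbor.edgeLength_pos {i j : Fin M.card} (h : M.Neighbor i j) : 0 < M.edgeLength i j :=
  ENNReal.toReal_pos h.2.ne' h.hausdorffMeasure_lt_top.ne

/-- Gives the integrability in time that is needed to exchange the sum over the edges with the time
average in `sum_convCoeff`. -/
theorem continuousOn_flux {T : ℝ≥0} {v : ℝ → Plane → Plane} (hv : Λ.IsConvectionField T v)
    {i j : Fin M.card} (h : M.Neighbor i j) (n : Plane) :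
    ContinuousOn (fun t => ∫ x in M.edge i j, ⟪v t x, n⟫ ∂μH[1]) (Icc 0 (T : ℝ)) := by
  have hfin : IsFiniteMeasure ((μH[1] : Measure Plane).restrict (M.edge i j)) :=
    ⟨by simpa using h.hausdorffMeasure_lt_top⟩
  have hm := (isClosed_edge i j).measurableSet
  have hsub : M.edge i j ⊆ closure Λ.carrier := inter_subset_left.trans (closure_cell_subset i)
  obtain ⟨C, hC⟩ := (isCompact_Icc.prod Λ.isBounded.isCompact_closure).exists_bound_of_continuousOn
    hv.continuousOn
  refine continuousOn_of_dominated (bound := fun _ => C * ‖n‖) (fun t ht => ?_) (fun t ht => ?_)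
    (integrable_const _) ?_
  · have h1 : ContinuousOn (v t) (closure Λ.carrier) :=
      hv.continuousOn.comp (f := fun x : Plane => (t, x)) (by fun_prop) fun x hx => ⟨ht, hx⟩
    exact ((h1.mono hsub).inner continuousOn_const).aestronglyMeasurable hm
  · refine (ae_restrict_iff' hm).2 (Eventually.of_forall fun x hx => ?_)
    exact (abs_real_inner_le_norm _ _).trans
      (mul_le_mul_of_nonneg_right (hC (t, x) ⟨ht, hsub hx⟩) (norm_nonneg _))
  · refine (ae_restrict_iff' hm).2 (Eventually.of_forall fun x hx => ?_)
    exact (hv.continuousOn.comp (f := fun t : ℝ => (t, x)) (by fun_prop)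
      fun t ht => ⟨ht, hsub hx⟩).inner continuousOn_const

end AdmissibleMesh

/-! ### The time grid and the convection coefficients. -/

theorem coe_timeNode (T : ℝ≥0) (N n : ℕ) : (timeNode T N n : ℝ) = n * timeStep T N := by
  simp [timeNode, timeStep, mul_div_assoc]

theorem timeStep_pos {T : ℝ≥0} (hT : 0 < T) {N : ℕ} (hN : 0 < N) : 0 < timeStep T N :=
  div_pos (NNReal.coe_pos.2 hT) (Nat.cast_pos.2 hN)

theorem mul_timeStep {T : ℝ≥0} {N : ℕ} (hN : 0 < N) : (N : ℝ) * timeStep T N = T := by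
  rw [timeStep]
  have : (N : ℝ) ≠ 0 := Nat.cast_ne_zero.2 hN.ne'
  field_simp

theorem timeNode_mono (T : ℝ≥0) (N : ℕ) : Monotone (timeNode T N) := fun a b hab => by
  unfold timeNode
  gcongr

theorem timeNode_le {T : ℝ≥0} {N n : ℕ} (hN : 0 < N) (hn : n ≤ N) : timeNode T N n ≤ T := by
  refine (timeNode_mono T N hn).trans (le_of_eq ?_)
  apply NNReal.eq
  rw [coe_timeNode, mul_timeStep hN]

namespace AdmissibleMesh

variable {Λ : PolygonalDomain} {M : AdmissibleMesh Λ}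

open scoped Classical in
/-- The coefficient `m_σ v_{K,σ}` of the convection term. -/
noncomputable def convCoeff (M : AdmissibleMesh Λ) (T : ℝ≥0) (N : ℕ) (v : ℝ → Plane → Plane)
    (n : ℕ) (i j : Fin M.card) : ℝ :=
  if M.Interior i j then M.edgeLength i j * M.edgeVelocity T N v n i j else 0

theorem edgeVelocity_swap (T : ℝ≥0) (N : ℕ) (v : ℝ → Plane → Plane) (n : ℕ)
    (i j : Fin M.card) : M.edgeVelocity T N v n j i = -M.edgeVelocity T N v n i j := by
  rw [edgeVelocity, edgeVelocity, edgeLength_comm, edge_comm, normal_swap]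
  simp_rw [inner_neg_right, integral_neg]
  rw [intervalIntegral.integral_neg, mul_neg]

theorem convCoeff_swap (T : ℝ≥0) (N : ℕ) (v : ℝ → Plane → Plane) (n : ℕ)
    (i j : Fin M.card) : M.convCoeff T N v n j i = -M.convCoeff T N v n i j := by
  rw [convCoeff, convCoeff, edgeVelocity_swap, edgeLength_comm]
  by_cases h : M.Interior i j
  · rw [if_pos h, if_pos h.symm]; ring
  · rw [if_neg h, if_neg fun h' => h h'.symm, neg_zero]

/-- The factor $m_\sigma$ cancels, so the sum is the time average of the total flux through the
interior edges, which vanishes at each instant by `sum_flux_edge`. -/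
theorem sum_convCoeff {T : ℝ≥0} {v : ℝ → Plane → Plane} (hv : Λ.IsConvectionField T v) {N n : ℕ}
    (hN : 0 < N) (hn : n < N) (i : Fin M.card) :
    ∑ j, M.convCoeff T N v n i j = 0 := by
  classical
  have hle : (timeNode T N n : ℝ) ≤ timeNode T N (n + 1) :=
    NNReal.coe_le_coe.2 (timeNode_mono T N n.le_succ)
  have hsub : Icc (timeNode T N n : ℝ) (timeNode T N (n + 1)) ⊆ Icc 0 (T : ℝ) :=
    Icc_subset_Icc (NNReal.coe_nonneg _) (NNReal.coe_le_coe.2 (timeNode_le hN hn))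
  have h1 : ∀ j, M.convCoeff T N v n i j = (timeStep T N)⁻¹ *
      ∫ t in (timeNode T N n : ℝ)..(timeNode T N (n + 1) : ℝ),
        if M.Interior i j then ∫ x in M.edge i j, ⟪v t x, M.normal i j⟫ ∂μH[1] else 0 := by
    intro j
    by_cases h : M.Interior i j
    · have := h.neighbor.edgeLength_pos
      simp only [convCoeff, if_pos h, edgeVelocity]
      rw [mul_inv, ← mul_assoc]
      field_simp
    · simp [convCoeff, if_neg h]
  rw [Finset.sum_congr rfl fun j _ => h1 j, ← Finset.mul_sum,
    ← intervalIntegral.integral_finsetSum]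
  · rw [intervalIntegral.integral_congr (g := fun _ => 0)]
    · simp
    · intro t ht
      rw [uIcc_of_le hle] at ht
      exact sum_flux_edge hv (hsub ht) i
  · intro j _
    by_cases h : M.Interior i j
    · simp only [if_pos h]
      refine ContinuousOn.intervalIntegrable ?_
      rw [uIcc_of_le hle]
      exact (continuousOn_flux hv h.neighbor _).mono hsub
    · simp [if_neg h]

end AdmissibleMesh

/-! ### Areas of triangles. -/

theorem volume_unit_triangle :
    volume {y : Plane | 0 ≤ y 0 ∧ 0 ≤ y 1 ∧ y 0 + y 1 ≤ 1} = ENNReal.ofReal (1 / 2) := by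
  set S : Set Plane := {y : Plane | 0 ≤ y 0 ∧ 0 ≤ y 1 ∧ y 0 + y 1 ≤ 1}
  have hSm : MeasurableSet S := by
    have h0 : Continuous fun y : Plane => y 0 := by fun_prop
    have h1 : Continuous fun y : Plane => y 1 := by fun_prop
    exact ((isClosed_le continuous_const h0).inter ((isClosed_le continuous_const h1).inter
      (isClosed_le (h0.add h1) continuous_const))).measurableSet
  rw [← (measurePreserving_frame 1).measure_preimage hSm.nullMeasurableSet,
    Measure.volume_eq_prod, Measure.prod_apply ((continuous_frame 1).measurable hSm)]
  have hsl : ∀ s : ℝ, volume (Prod.mk s ⁻¹' (frame 1 ⁻¹' S)) =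
      (Icc (0 : ℝ) 1).indicator (fun s => ENNReal.ofReal (1 - s)) s := by
    intro s
    have e : Prod.mk s ⁻¹' (frame 1 ⁻¹' S) = {t | 0 ≤ s ∧ 0 ≤ t ∧ s + t ≤ 1} := by
      ext t
      simp [S, frame]
    rw [e]
    by_cases hs : s ∈ Icc (0 : ℝ) 1
    · rw [indicator_of_mem hs]
      have : {t | 0 ≤ s ∧ 0 ≤ t ∧ s + t ≤ 1} = Icc 0 (1 - s) := by
        ext t
        simp only [mem_ofPred_eq, mem_Icc, hs.1, true_and]
        constructor <;> rintro ⟨h1, h2⟩ <;> exact ⟨h1, by linarith⟩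
      rw [this, Real.volume_Icc, sub_zero]
    · rw [indicator_of_notMem hs]
      have : {t | 0 ≤ s ∧ 0 ≤ t ∧ s + t ≤ 1} = ∅ := by
        refine eq_empty_of_forall_notMem fun t ht => hs ⟨ht.1, by linarith [ht.2.1, ht.2.2]⟩
      rw [this, measure_empty]
  simp_rw [hsl]
  rw [lintegral_indicator measurableSet_Icc, ← ofReal_integral_eq_lintegral_ofReal]
  · rw [integral_Icc_eq_integral_Ioc, ← intervalIntegral.integral_of_le zero_le_one]
    congr 1
    rw [intervalIntegral.integral_sub (by simp) (by simp)]
    simp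
    norm_num
  · exact (continuous_const.sub continuous_id).continuousOn.integrableOn_compact isCompact_Icc
  · exact (ae_restrict_iff' measurableSet_Icc).2 (Eventually.of_forall fun s hs => sub_nonneg.2 hs.2)

/-- Affine chart of a triangle by the unit triangle, which reduces its area to a determinant. -/
theorem convexJoin_eq_image (p a b : Plane) :
    convexJoin ℝ {p} (segment ℝ a b) =
      (fun y : Plane => p + (y 0 • (a - p) + y 1 • (b - p))) ''
        {y : Plane | 0 ≤ y 0 ∧ 0 ≤ y 1 ∧ y 0 + y 1 ≤ 1} := by
  ext x
  simp only [mem_convexJoin, mem_singleton_iff, exists_eq_left, mem_image, mem_ofPred_eq]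
  constructor
  · rintro ⟨y, ⟨γ, δ, hγ, hδ, hγδ, rfl⟩, α, β, hα, hβ, hαβ, rfl⟩
    refine ⟨!₂[β * γ, β * δ], ⟨?_, ?_, ?_⟩, ?_⟩
    · simpa using mul_nonneg hβ hγ
    · simpa using mul_nonneg hβ hδ
    · have : β * γ + β * δ = β := by rw [← mul_add, hγδ, mul_one]
      simp only [Matrix.cons_val_zero, Matrix.cons_val_one]
      linarith
    · obtain rfl : α = 1 - β := by linarith
      obtain rfl : γ = 1 - δ := by linarith
      simp only [Matrix.cons_val_zero, Matrix.cons_val_one]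
      module
  · rintro ⟨y, ⟨h0, h1, h2⟩, rfl⟩
    rcases eq_or_lt_of_le (add_nonneg h0 h1) with hs | hs
    · have e0 : y 0 = 0 := by linarith
      have e1 : y 1 = 0 := by linarith
      refine ⟨a, left_mem_segment ℝ a b, ?_⟩
      simp only [e0, e1, zero_smul, add_zero]
      exact left_mem_segment ℝ p a
    · refine ⟨(y 0 / (y 0 + y 1)) • a + (y 1 / (y 0 + y 1)) • b,
        ⟨_, _, div_nonneg h0 hs.le, div_nonneg h1 hs.le, by field_simp, rfl⟩,
        1 - (y 0 + y 1), y 0 + y 1, by linarith, hs.le, by ring, ?_⟩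
      rw [smul_add, smul_smul, smul_smul, mul_div_cancel₀ _ hs.ne', mul_div_cancel₀ _ hs.ne']
      module

/-- The area of a triangle. -/
theorem volume_triangle {n p a b : Plane} (hn : ‖n‖ = 1) (hab : ⟪n, b - a⟫ = 0) :
    volume (convexJoin ℝ {p} (segment ℝ a b)) =
      ENNReal.ofReal (dist a b * |⟪n, a - p⟫| / 2) := by
  set S : Set Plane := {y : Plane | 0 ≤ y 0 ∧ 0 ≤ y 1 ∧ y 0 + y 1 ≤ 1}
  set A : Plane →ₗ[ℝ] Plane := Matrix.toLin (PiLp.basisFun 2 ℝ (Fin 2)) (PiLp.basisFun 2 ℝ (Fin 2))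
    !![(a - p) 0, (b - p) 0; (a - p) 1, (b - p) 1] with hA
  have hAy : ∀ y, A y = y 0 • (a - p) + y 1 • (b - p) := by
    intro y
    ext j
    fin_cases j <;> simp [hA, Matrix.toLin_apply, Matrix.mulVec, dotProduct, Fin.sum_univ_two] <;>
      ring
  have himg : convexJoin ℝ {p} (segment ℝ a b) = (fun x => p + x) '' (A '' S) := by
    rw [convexJoin_eq_image, image_image]
    simp only [hAy]
    rfl
  have hdet : |LinearMap.det A| = dist a b * |⟪n, a - p⟫| := by
    rw [hA, LinearMap.det_toLin, Matrix.det_fin_two_of]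
    -- The base is a multiple of `perp n`, so the determinant of the two sides is base length times
    -- height along `n`, up to sign.
    have hr := eq_add_perp hn (b - a)
    rw [hab, zero_smul, zero_add] at hr
    set r := ⟪perp n, b - a⟫
    have hd : dist a b = |r| := by
      rw [dist_comm, dist_eq_norm, hr, norm_smul, norm_perp, hn, mul_one, Real.norm_eq_abs]
    rw [hd, ← abs_mul]
    congr 1
    have h0 : b 0 = a 0 - r * n 1 := by
      have := congrArg (fun z : Plane => z 0) hr
      simp [perp] at this
      linarith
    have h1 : b 1 = a 1 + r * n 0 := by
      have := congrArg (fun z : Plane => z 1) hr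
      simp [perp] at this
      linarith
    rw [inner_plane]
    simp only [PiLp.sub_apply, h0, h1]
    ring
  rw [himg, image_add_left, measure_preimage_add, Measure.addHaar_image_linearMap, hdet,
    volume_unit_triangle, ← ENNReal.ofReal_mul (by positivity)]
  congr 1
  ring

/-- A segment lies in a degenerate triangle whose base is a point. -/
theorem volume_segment (p y : Plane) : volume (segment ℝ p y) = 0 := by
  have h := volume_triangle (n := EuclideanSpace.single 0 1) (p := p) (a := y) (b := y)
    (by simp) (by simp)
  rw [dist_self, zero_mul, zero_div, ENNReal.ofReal_zero] at h
  refine measure_mono_null ?_ h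
  intro x hx
  exact mem_convexJoin.2 ⟨p, rfl, y, left_mem_segment ℝ y y, hx⟩

/-- A compact convex subset of a line is a segment. -/
theorem eq_segment_of_line {E : Set Plane} (hE : IsCompact E) (hc : Convex ℝ E) (hne : E.Nonempty)
    {n : Plane} (hn : ‖n‖ = 1) {c : ℝ} (hEn : ∀ x ∈ E, ⟪n, x⟫ = c) :
    ∃ a ∈ E, ∃ b ∈ E, E = segment ℝ a b := by
  have hcont : ContinuousOn (fun x : Plane => ⟪perp n, x⟫) E := by fun_prop
  obtain ⟨a, ha, hamin⟩ := hE.exists_isMinOn hne hcont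
  obtain ⟨b, hb, hbmax⟩ := hE.exists_isMaxOn hne hcont
  refine ⟨a, ha, b, hb, Subset.antisymm (fun x hx => ?_) (hc.segment_subset ha hb)⟩
  have h1 : ⟪perp n, a⟫ ≤ ⟪perp n, x⟫ := hamin hx
  have h2 : ⟪perp n, x⟫ ≤ ⟪perp n, b⟫ := hbmax hx
  have ex := eq_add_perp hn x
  have ea := eq_add_perp hn a
  have eb := eq_add_perp hn b
  rw [hEn x hx] at ex
  rw [hEn a ha] at ea
  rw [hEn b hb] at eb
  rw [segment_eq_image']
  set s := ⟪perp n, x⟫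
  set α := ⟪perp n, a⟫
  set β := ⟪perp n, b⟫
  rcases eq_or_lt_of_le (h1.trans h2) with h | h
  · refine ⟨0, by simp, ?_⟩
    have hs : s = α := le_antisymm (h ▸ h2) h1
    simp only [zero_smul, add_zero]
    rw [ex, ea, hs]
  · refine ⟨(s - α) / (β - α), ⟨?_, ?_⟩, ?_⟩
    · apply div_nonneg <;> linarith
    · rw [div_le_one] <;> linarith
    · have e : b - a = (β - α) • perp n := by
        conv_lhs => rw [eb, ea]
        module
      simp only
      rw [e, smul_smul, div_mul_cancel₀ _ (sub_pos.2 h).ne']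
      conv_rhs => rw [ex]
      conv_lhs => rw [ea]
      module

/-! ### Areas and overlaps of diamonds. -/

namespace AdmissibleMesh

variable {Λ : PolygonalDomain} {M : AdmissibleMesh Λ}

/-- The part of the diamond in the closure of one of the two control volumes. -/
def halfDiamond (M : AdmissibleMesh Λ) (i j : Fin M.card) : Set Plane :=
  convexHull ℝ (insert (M.center i) (M.edge i j))

theorem diamond_eq (i j : Fin M.card) :
    M.diamond i j = interior (M.halfDiamond i j ∪ M.halfDiamond j i) := by
  rw [diamond, halfDiamond, halfDiamond, edge_comm M j i]

theorem edge_convex (i j : Fin M.card) : Convex ℝ (M.edge i j) :=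
  (M.cell_convex i).closure.inter (M.cell_convex j).closure

theorem isCompact_edge (i j : Fin M.card) : IsCompact (M.edge i j) :=
  (isCompact_closure_cell i).inter_right isClosed_closure

theorem halfDiamond_subset (i j : Fin M.card) : M.halfDiamond i j ⊆ closure (M.cell i) :=
  convexHull_min (insert_subset (M.center_mem i) inter_subset_left) (M.cell_convex i).closure

theorem Neighbor.edge_nonempty {i j : Fin M.card} (h : M.Neighbor i j) : (M.edge i j).Nonempty :=
  let ⟨a, ha, _⟩ := exists_ne_of_hausdorffMeasure_pos h.2
  ⟨a, ha⟩

theorem Neighbor.inner_eq {i j : Fin M.card} (h : M.Neighbor i j) {x y : Plane}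
    (hx : x ∈ M.edge i j) (hy : y ∈ M.edge i j) : ⟪M.normal i j, y⟫ = ⟪M.normal i j, x⟫ := by
  have := h.inner_sub hx hy
  rw [inner_sub_right] at this
  linarith

theorem Neighbor.inner_le {i j : Fin M.card} (h : M.Neighbor i j) {a x : Plane}
    (ha : a ∈ M.edge i j) (hx : x ∈ closure (M.cell i)) : ⟪M.normal i j, x⟫ ≤ ⟪M.normal i j, a⟫ :=
  inner_le_of_mem_closure (fun y hy => ((h.separates ha).1 y hy).le) x hx

theorem Neighbor.halfDiamond_eq {i j : Fin M.card} (h : M.Neighbor i j) :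
    M.halfDiamond i j = convexJoin ℝ {M.center i} (M.edge i j) := by
  rw [halfDiamond, convexHull_insert h.edge_nonempty, (edge_convex i j).convexHull_eq]

/-- The area of a half-diamond. -/
theorem Neighbor.volume_halfDiamond {i j : Fin M.card} (h : M.Neighbor i j) {a : Plane}
    (ha : a ∈ M.edge i j) :
    volume (M.halfDiamond i j) =
      ENNReal.ofReal (M.edgeLength i j * ⟪M.normal i j, a - M.center i⟫ / 2) := by
  obtain ⟨b, hb, b', hb', he⟩ := eq_segment_of_line (isCompact_edge i j) (edge_convex i j)
    h.edge_nonempty h.norm_normal (fun x hx => h.inner_eq ha hx)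
  have hlen : M.edgeLength i j = dist b b' := by
    rw [edgeLength, Measure.real, he, hausdorffMeasure_segment, edist_dist,
      ENNReal.toReal_ofReal dist_nonneg]
  have hnn : 0 ≤ ⟪M.normal i j, b - M.center i⟫ := by
    rw [inner_sub_right]
    linarith [h.inner_le hb (M.center_mem i)]
  have hba : ⟪M.normal i j, b - M.center i⟫ = ⟪M.normal i j, a - M.center i⟫ := by
    rw [inner_sub_right, inner_sub_right, h.inner_eq ha hb]
  rw [h.halfDiamond_eq, hlen, ← hba]
  conv_lhs => rw [he]
  rw [volume_triangle h.norm_normal (h.inner_sub hb hb'), abs_of_nonneg hnn]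

theorem volume_closure_inter {i j : Fin M.card} (hij : i ≠ j) :
    volume (closure (M.cell i) ∩ closure (M.cell j)) = 0 :=
  measure_mono_null (edge_subset_frontier hij) ((M.cell_convex i).addHaar_frontier volume)

theorem volume_halfDiamond_inter_of_ne {i i' : Fin M.card} (hij : i ≠ i') (j j' : Fin M.card) :
    volume (M.halfDiamond i j ∩ M.halfDiamond i' j') = 0 :=
  measure_mono_null (inter_subset_inter (halfDiamond_subset _ _) (halfDiamond_subset _ _))
    (volume_closure_inter hij)

theorem volume_frontier_halfDiamond (i j : Fin M.card) :
    volume (frontier (M.halfDiamond i j)) = 0 :=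
  (convex_convexHull ℝ _).addHaar_frontier volume

/-- Two half-diamonds of a control volume overlap in a null set. -/
theorem volume_halfDiamond_inter {i j k : Fin M.card} (hj : M.Neighbor i j) (hk : M.Neighbor i k)
    (hjk : j ≠ k) : volume (M.halfDiamond i j ∩ M.halfDiamond i k) = 0 := by
  obtain ⟨a, ha⟩ := hj.edge_nonempty
  obtain ⟨b, hb⟩ := hk.edge_nonempty
  set p := M.center i
  have hpa := hj.inner_le ha (M.center_mem i)
  have hpb := hk.inner_le hb (M.center_mem i)
  rcases eq_or_lt_of_le hpa with h1 | h1
  -- A center on the line of the edge makes the half-diamond flat. Outside these cases both heights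
  -- are positive.
  · refine measure_mono_null inter_subset_left ?_
    rw [hj.volume_halfDiamond ha, inner_sub_right, h1, sub_self, mul_zero, zero_div,
      ENNReal.ofReal_zero]
  rcases eq_or_lt_of_le hpb with h2 | h2
  · refine measure_mono_null inter_subset_right ?_
    rw [hk.volume_halfDiamond hb, inner_sub_right, h2, sub_self, mul_zero, zero_div,
      ENNReal.ofReal_zero]
  -- Let `z` lie at the fraction `r` of the way from `p` to `y` on one edge, and at the fraction
  -- `r'` of the way to `y'` on the other. The line of each edge bounds the closed cell, so neither
  -- of `y`, `y'` lies beyond the line of the other edge; this gives `r = r'`, and `y = y'` unless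
  -- `z = p`.
  have key : ∀ z ∈ M.halfDiamond i j ∩ M.halfDiamond i k,
      z = p ∨ ∃ y ∈ M.edge i j ∩ M.edge i k, z ∈ segment ℝ p y := by
    rintro z ⟨hz, hz'⟩
    rw [hj.halfDiamond_eq, mem_convexJoin] at hz
    rw [hk.halfDiamond_eq, mem_convexJoin] at hz'
    obtain ⟨_, rfl, y, hy, hzy⟩ := hz
    obtain ⟨_, rfl, y', hy', hzy'⟩ := hz'
    have hzs := hzy
    rw [segment_eq_image'] at hzy hzy'
    obtain ⟨r, hr, hzr⟩ := hzy
    obtain ⟨r', hr', hzr'⟩ := hzy'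
    simp only at hzr hzr'
    have hsum : r • (y - p) = r' • (y' - p) := by
      have := hzr.trans hzr'.symm
      exact add_left_cancel this
    have e1 := congrArg (fun x => ⟪M.normal i j, x⟫) hsum
    have e2 := congrArg (fun x => ⟪M.normal i k, x⟫) hsum
    simp only [real_inner_smul_right, inner_sub_right] at e1 e2
    rw [hj.inner_eq ha hy] at e1
    rw [hk.inner_eq hb hy'] at e2
    have b1 := hj.inner_le ha hy'.1
    have b2 := hk.inner_le hb hy.1
    have hle : r ≤ r' := by
      by_contra! hlt
      nlinarith [hr'.1]
    have hge : r' ≤ r := by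
      by_contra! hlt
      nlinarith [hr.1]
    obtain rfl : r = r' := le_antisymm hle hge
    rcases eq_or_lt_of_le hr.1 with h0 | h0
    · left
      rw [← hzr, ← h0, zero_smul, add_zero]
    · right
      have : y = y' := by
        have := smul_right_injective _ h0.ne' hsum
        exact sub_left_injective this
      exact ⟨y, ⟨hy, this ▸ hy'⟩, hzs⟩
  -- Two common points would span a common segment of positive length, excluded by
  -- `hausdorffMeasure_edge_inter`.
  have hsub : (M.edge i j ∩ M.edge i k).Subsingleton := by
    intro y hy y' hy'
    by_contra hne
    have h0 := hausdorffMeasure_edge_inter hj.1 hk.1 hjk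
    have := measure_mono_null (((edge_convex i j).inter (edge_convex i k)).segment_subset hy hy') h0
    rw [hausdorffMeasure_segment] at this
    exact hne (edist_eq_zero.1 this)
  rcases hsub.eq_empty_or_singleton with he | ⟨y, he⟩
  · refine measure_mono_null (t := {p}) (fun z hz => ?_) (measure_singleton p)
    rcases key z hz with h | ⟨y, hy, -⟩
    · exact h
    · rw [he] at hy
      exact absurd hy (notMem_empty y)
  · refine measure_mono_null (t := segment ℝ p y) (fun z hz => ?_) (volume_segment p y)
    rcases key z hz with h | ⟨y', hy', hz'⟩
    · rw [h]; exact left_mem_segment ℝ p y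
    · rw [he] at hy'
      rwa [mem_singleton_iff.1 hy'] at hz'

/-- Each center lies on its own side of the edge line, so the two heights are nonnegative; being
components of one vector $x_L-x_K=d\,n$, they add up to $d$. Passing to the interior removes only a
null set, since frontiers of convex sets are null. -/
theorem Neighbor.volume_diamond {i j : Fin M.card} (h : M.Neighbor i j) :
    volume (M.diamond i j) = ENNReal.ofReal (M.edgeLength i j * M.centerDist i j / 2) := by
  obtain ⟨a, ha⟩ := h.edge_nonempty
  have ha' : a ∈ M.edge j i := edge_comm M i j ▸ ha
  have hL := h.edgeLength_pos
  set U := M.halfDiamond i j ∪ M.halfDiamond j i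
  have hfr : volume (frontier U) = 0 := by
    refine measure_mono_null (frontier_union_subset _ _) (measure_union_null ?_ ?_)
    · exact measure_mono_null inter_subset_left (volume_frontier_halfDiamond _ _)
    · exact measure_mono_null inter_subset_right (volume_frontier_halfDiamond _ _)
  have h1 : volume (M.diamond i j) = volume U := by
    rw [diamond_eq]
    exact measure_congr (interior_ae_eq_of_null_frontier hfr)
  have h2 : volume U = volume (M.halfDiamond i j) + volume (M.halfDiamond j i) :=
    measure_union₀ ((convex_convexHull ℝ _).nullMeasurableSet volume)
      (volume_halfDiamond_inter_of_ne h.1 j i)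
  rw [h1, h2, h.volume_halfDiamond ha, h.symm.volume_halfDiamond ha', ← ENNReal.ofReal_add]
  · congr 1
    rw [edgeLength_comm j i, normal_swap i j, inner_neg_left]
    have e : ⟪M.normal i j, M.center j - M.center i⟫ = M.centerDist i j := by
      rw [h.center_sub, real_inner_smul_right, real_inner_self_eq_norm_sq, h.norm_normal]
      ring
    rw [inner_sub_right] at e ⊢
    rw [inner_sub_right, ← e]
    ring
  · have := h.inner_le ha (M.center_mem i)
    rw [inner_sub_right]
    have : 0 ≤ ⟪M.normal i j, a⟫ - ⟪M.normal i j, M.center i⟫ := by linarith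
    positivity
  · have := h.symm.inner_le ha' (M.center_mem j)
    have hL' := h.symm.edgeLength_pos
    rw [inner_sub_right]
    have : 0 ≤ ⟪M.normal j i, a⟫ - ⟪M.normal j i, M.center j⟫ := by linarith
    positivity

theorem Neighbor.volume_real_diamond {i j : Fin M.card} (h : M.Neighbor i j) :
    volume.real (M.diamond i j) = M.edgeLength i j * M.centerDist i j / 2 := by
  rw [Measure.real, h.volume_diamond, ENNReal.toReal_ofReal]
  have := h.edgeLength_pos
  have := h.centerDist_pos
  positivity

theorem diamond_subset (i j : Fin M.card) :
    M.diamond i j ⊆ closure (M.cell i) ∪ closure (M.cell j) := by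
  rw [diamond_eq]
  exact interior_subset.trans (union_subset_union (halfDiamond_subset _ _) (halfDiamond_subset _ _))

/-- Compares the four pairs of half-diamonds: those in different cells meet in a null set, and so do
those of different edges of one cell. The orientation `i < j` prevents one edge from appearing in
both orders. -/
theorem volume_diamond_inter {i j k l : Fin M.card} (hij : M.Neighbor i j) (hkl : M.Neighbor k l)
    (h1 : i < j) (h2 : k < l) (hne : (i, j) ≠ (k, l)) :
    volume (M.diamond i j ∩ M.diamond k l) = 0 := by
  have hmain : ∀ {i j k l : Fin M.card}, M.Neighbor i j → M.Neighbor k l → (i, j) ≠ (k, l) →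
      volume (M.halfDiamond i j ∩ M.halfDiamond k l) = 0 := by
    intro i j k l hij hkl hne
    by_cases hik : i = k
    · subst hik
      exact volume_halfDiamond_inter hij hkl fun h => hne (by rw [h])
    · exact volume_halfDiamond_inter_of_ne hik j l
  rw [diamond_eq, diamond_eq]
  refine measure_mono_null (inter_subset_inter interior_subset interior_subset) ?_
  rw [union_inter_distrib_right, inter_union_distrib_left, inter_union_distrib_left]
  refine measure_union_null (measure_union_null ?_ ?_) (measure_union_null ?_ ?_)
  · exact hmain hij hkl hne
  · refine hmain hij hkl.symm fun h => ?_
    rw [Prod.mk.injEq] at h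
    rw [h.1, h.2] at h1
    exact lt_asymm h1 h2
  · refine hmain hij.symm hkl fun h => ?_
    rw [Prod.mk.injEq] at h
    rw [h.1, h.2] at h1
    exact lt_asymm h1 h2
  · refine hmain hij.symm hkl.symm fun h => ?_
    rw [Prod.mk.injEq] at h
    exact hne (by rw [h.1, h.2])

end AdmissibleMesh

/-! ### Indicator functions in $L^2$. -/

section Indicator

variable {X H : Type*} [MeasurableSpace X] {μ : Measure X} [NormedAddCommGroup H]

theorem continuous_indicatorConstLp {s : Set X} (hs : MeasurableSet s) (hμ : μ s ≠ ∞) :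
    Continuous fun c : H => indicatorConstLp 2 hs hμ c := by
  refine continuous_iff_continuousAt.2 fun c => ?_
  refine tendsto_iff_norm_sub_tendsto_zero.2 ?_
  have h1 : ∀ c' : H, ‖indicatorConstLp 2 hs hμ c' - indicatorConstLp 2 hs hμ c‖ =
      ‖c' - c‖ * μ.real s ^ (1 / (2 : ℝ≥0∞).toReal) := fun c' => by
    rw [indicatorConstLp_sub, norm_indicatorConstLp (by simp) (by simp)]
  simp only [h1]
  have h2 : Tendsto (fun c' : H => ‖c' - c‖) (𝓝 c) (𝓝 0) := by
    have : Continuous fun c' : H => ‖c' - c‖ := by fun_prop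
    simpa using this.tendsto c
  simpa using h2.mul_const _

theorem norm_indicatorConstLp_sq {s : Set X} (hs : MeasurableSet s) (hμs : μ s ≠ ∞) (c : H) :
    ‖(indicatorConstLp 2 hs hμs c : Lp H 2 μ)‖ ^ 2 = μ.real s * ‖c‖ ^ 2 := by
  rw [norm_indicatorConstLp (by simp) (by simp), mul_pow, ← Real.rpow_natCast (_ ^ _),
    ← Real.rpow_mul measureReal_nonneg]
  norm_num
  ring

variable [InnerProductSpace ℝ H]

theorem inner_indicatorConstLp_of_null {s t : Set X} (hs : MeasurableSet s) (hμs : μ s ≠ ∞)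
    (ht : MeasurableSet t) (hμt : μ t ≠ ∞) (hst : μ (s ∩ t) = 0) (c d : H) :
    (⟪(indicatorConstLp 2 hs hμs c : Lp H 2 μ), indicatorConstLp 2 ht hμt d⟫ : ℝ) = 0 := by
  rw [L2.inner_indicatorConstLp_eq_setIntegral_inner]
  rw [integral_congr_ae (g := fun _ => 0), integral_zero]
  refine (ae_restrict_iff' hs).2 ?_
  filter_upwards [indicatorConstLp_coeFn_notMem (p := 2) (hs := ht) (hμs := hμt) (c := d),
    measure_eq_zero_iff_ae_notMem.1 hst] with x h1 h2 hxs
  rw [h1 fun hxt => h2 ⟨hxs, hxt⟩, inner_zero_right]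

/-- Pythagoras; overlaps of measure zero suffice, as is the case for diamonds. -/
theorem norm_sum_indicatorConstLp_sq {α : Type*} (Q : Finset α) {s : α → Set X}
    (hs : ∀ p, MeasurableSet (s p)) (hμ : ∀ p, μ (s p) ≠ ∞)
    (hd : ∀ p ∈ Q, ∀ q ∈ Q, p ≠ q → μ (s p ∩ s q) = 0) (c : α → H) :
    ‖(∑ p ∈ Q, indicatorConstLp 2 (hs p) (hμ p) (c p) : Lp H 2 μ)‖ ^ 2 =
      ∑ p ∈ Q, μ.real (s p) * ‖c p‖ ^ 2 := by
  rw [← real_inner_self_eq_norm_sq, sum_inner]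
  refine Finset.sum_congr rfl fun p hp => ?_
  rw [inner_sum, Finset.sum_eq_single p]
  · rw [real_inner_self_eq_norm_sq, norm_indicatorConstLp_sq]
  · intro q hq hqp
    exact inner_indicatorConstLp_of_null _ _ _ _ (hd p hp q hq hqp.symm) _ _
  · exact fun h => absurd hp h

end Indicator

/-! ### Test functions and weak gradients. -/

namespace PolygonalDomain

/-- The test functions on `Λ`. -/
structure TestFunction (Λ : PolygonalDomain) where
  toFun : Plane → ℝ
  contDiff : ContDiff ℝ (⊤ : ℕ∞) toFun
  compact : HasCompactSupport toFun
  subset : tsupport toFun ⊆ Λ.carrier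

namespace TestFunction

variable {Λ : PolygonalDomain} (φ : Λ.TestFunction)

theorem eq_zero {x : Plane} (hx : x ∉ Λ.carrier) : φ.toFun x = 0 :=
  image_eq_zero_of_notMem_tsupport fun h => hx (φ.subset h)

/-- A partial derivative of a test function as an element of `L²`. -/
noncomputable def partialLp (i : Fin 2) : Λ.L2 :=
  ((continuous_partial φ.contDiff (EuclideanSpace.single i 1)).memLp_of_hasCompactSupport
    (hasCompactSupport_partial φ.compact _)).toLp (μ := Λ.measure) (p := 2)
      (fun x => fderiv ℝ φ.toFun x (EuclideanSpace.single i 1))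

/-- A test function times a basis vector as an element of `L²`. -/
noncomputable def vecLp (i : Fin 2) : Λ.L2Vec :=
  ((φ.contDiff.continuous.smul (continuous_const (y := (EuclideanSpace.single i 1 : Plane)))
    ).memLp_of_hasCompactSupport (φ.compact.smul_right)).toLp (μ := Λ.measure) (p := 2)
      (fun x => φ.toFun x • (EuclideanSpace.single i 1 : Plane))

theorem coeFn_partialLp (i : Fin 2) : φ.partialLp i =ᵐ[Λ.measure]
    fun x => fderiv ℝ φ.toFun x (EuclideanSpace.single i 1) := MemLp.coeFn_toLp _

theorem coeFn_vecLp (i : Fin 2) : φ.vecLp i =ᵐ[Λ.measure]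
    fun x => φ.toFun x • (EuclideanSpace.single i 1 : Plane) := MemLp.coeFn_toLp _

theorem inner_partialLp (f : Λ.L2) (i : Fin 2) : ⟪f, φ.partialLp i⟫ =
    ∫ x in Λ.carrier, f x * fderiv ℝ φ.toFun x (EuclideanSpace.single i 1) := by
  rw [L2.inner_def]
  refine integral_congr_ae ?_
  filter_upwards [φ.coeFn_partialLp i] with x hx
  rw [hx, real_inner_comm]
  rfl

theorem inner_vecLp (G : Λ.L2Vec) (i : Fin 2) : ⟪G, φ.vecLp i⟫ =
    ∫ x in Λ.carrier, G x i * φ.toFun x := by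
  rw [L2.inner_def]
  refine integral_congr_ae ?_
  filter_upwards [φ.coeFn_vecLp i] with x hx
  rw [hx, real_inner_smul_right, EuclideanSpace.inner_single_right]
  simp [mul_comm]

end TestFunction

/-- In this form the weak gradient is a family of continuous linear relations on $L^2\times L^2$,
which pass to weak limits. -/
theorem isWeakGradient_iff (Λ : PolygonalDomain) (f : Λ.L2) (G : Λ.L2Vec) :
    Λ.IsWeakGradient f G ↔
      ∀ (φ : Λ.TestFunction) (i : Fin 2), ⟪G, φ.vecLp i⟫ + ⟪f, φ.partialLp i⟫ = 0 := by
  constructor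
  · intro h φ i
    rw [φ.inner_vecLp, φ.inner_partialLp, h φ.toFun φ.contDiff φ.compact φ.subset i, add_neg_cancel]
  · intro h φ h1 h2 h3 i
    have := h ⟨φ, h1, h2, h3⟩ i
    rw [TestFunction.inner_vecLp, TestFunction.inner_partialLp] at this
    linarith

end PolygonalDomain

/-! ### Discrete norms and consistency of the discrete gradient. -/

namespace AdmissibleMesh

variable {Λ : PolygonalDomain} (M : AdmissibleMesh Λ)

open scoped Classical in
/-- The interior edges, each counted once. -/
noncomputable def edges : Finset (Fin M.card × Fin M.card) :=
  Finset.univ.filter fun p => p.1 < p.2 ∧ M.Interior p.1 p.2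

/-- The square of the discrete `H¹` seminorm. -/
noncomputable def seminormSq (w : Fin M.card → ℝ) : ℝ :=
  ∑ p ∈ M.edges, M.edgeLength p.1 p.2 / M.centerDist p.1 p.2 * (w p.2 - w p.1) ^ 2

/-- The square of the discrete `L²` norm. -/
noncomputable def normSq (w : Fin M.card → ℝ) : ℝ := ∑ i, M.cellArea i * w i ^ 2

variable {M}

theorem mem_edges {p : Fin M.card × Fin M.card} :
    p ∈ M.edges ↔ p.1 < p.2 ∧ M.Interior p.1 p.2 := by
  simp [edges]

theorem neighbor_of_mem_edges {p : Fin M.card × Fin M.card} (hp : p ∈ M.edges) :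
    M.Neighbor p.1 p.2 := (mem_edges.1 hp).2.neighbor

open scoped Classical in
-- The mechanism of discrete integration by parts: every interior edge is met once from either side.
theorem sum_interior_eq_sum_edges {A : Type*} [AddCommMonoid A] (f : Fin M.card → Fin M.card → A) :
    ∑ i, ∑ j, (if M.Interior i j then f i j else 0) =
      ∑ p ∈ M.edges, (f p.1 p.2 + f p.2 p.1) := by
  have h1 : ∑ p ∈ M.edges, (f p.1 p.2 + f p.2 p.1) =
      ∑ i, ∑ j, if i < j ∧ M.Interior i j then f i j + f j i else 0 := by
    rw [edges, Finset.sum_filter, Fintype.sum_prod_type]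
  have h2 : ∀ i j, (if M.Interior i j then f i j else 0) =
      (if i < j ∧ M.Interior i j then f i j else 0) +
        if j < i ∧ M.Interior j i then f i j else 0 := by
    intro i j
    by_cases h : M.Interior i j
    · rcases lt_trichotomy i j with hij | hij | hij
      · simp [h, hij, hij.not_gt]
      · exact absurd hij h.1
      · simp [h, h.symm, hij, hij.not_gt]
    · simp [h, mt Interior.symm h]
  simp_rw [h1, h2, Finset.sum_add_distrib]
  rw [Finset.sum_comm (f := fun i j => if j < i ∧ M.Interior j i then f i j else 0),
    ← Finset.sum_add_distrib]
  refine Finset.sum_congr rfl fun i _ => ?_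
  rw [← Finset.sum_add_distrib]
  refine Finset.sum_congr rfl fun j _ => ?_
  split_ifs <;> simp

theorem measurableSet_diamond (i j : Fin M.card) : MeasurableSet (M.diamond i j) :=
  isOpen_interior.measurableSet

theorem discreteGradient_eq (w : Fin M.card → ℝ) : M.discreteGradient w =
    ∑ p ∈ M.edges, indicatorConstLp 2 (measurableSet_diamond p.1 p.2)
      (measure_ne_top Λ.measure _)
      ((2 * ((w p.2 - w p.1) / M.centerDist p.1 p.2)) • M.normal p.1 p.2) := by
  rw [edges, Finset.sum_filter, Fintype.sum_prod_type]
  rfl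

/-- Transfers measurability of the random vectors to the $L^2(\Lambda)$-valued approximations. -/
theorem continuous_cellFunction : Continuous M.cellFunction := by
  unfold cellFunction
  exact continuous_finsetSum _ fun i _ =>
    (continuous_indicatorConstLp (M.cell_isOpen i).measurableSet
      (measure_ne_top Λ.measure _)).comp (continuous_apply i)

theorem continuous_discreteGradient : Continuous M.discreteGradient := by
  rw [funext discreteGradient_eq]
  refine continuous_finsetSum _ fun p _ => (continuous_indicatorConstLp
    (measurableSet_diamond p.1 p.2) (measure_ne_top Λ.measure _)).comp ?_
  fun_prop

theorem cellFunction_sub (w w' : Fin M.card → ℝ) :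
    M.cellFunction (w - w') = M.cellFunction w - M.cellFunction w' := by
  simp only [cellFunction, ← Finset.sum_sub_distrib, Pi.sub_apply]
  exact Finset.sum_congr rfl fun i _ => indicatorConstLp_sub.symm

theorem measure_cell (i : Fin M.card) : Λ.measure.real (M.cell i) = M.cellArea i := by
  rw [cellArea, Measure.real, Measure.real, Measure.restrict_apply (M.cell_isOpen i).measurableSet,
    inter_eq_left.2 (M.cell_subset i)]

theorem norm_cellFunction_sq (w : Fin M.card → ℝ) : ‖M.cellFunction w‖ ^ 2 = M.normSq w := by
  rw [cellFunction, norm_sum_indicatorConstLp_sq]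
  · simp only [measure_cell, Real.norm_eq_abs, sq_abs, normSq]
  · intro i _ j _ hij
    rw [(disjoint_cell hij).inter_eq, measure_empty]

theorem disjoint_diamonds {p q : Fin M.card × Fin M.card} (hp : p ∈ M.edges) (hq : q ∈ M.edges)
    (hpq : p ≠ q) : volume (M.diamond p.1 p.2 ∩ M.diamond q.1 q.2) = 0 :=
  volume_diamond_inter (neighbor_of_mem_edges hp) (neighbor_of_mem_edges hq) (mem_edges.1 hp).1
    (mem_edges.1 hq).1 hpq

/-- Diamonds overlap in null sets, and one of area at most $md/2$ contributes at most
$\frac{md}2\cdot4\frac{(w_L-w_K)^2}{d^2}=2\frac md(w_L-w_K)^2$. -/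
theorem norm_discreteGradient_sq_le (w : Fin M.card → ℝ) :
    ‖M.discreteGradient w‖ ^ 2 ≤ 2 * M.seminormSq w := by
  have h := norm_sum_indicatorConstLp_sq (μ := Λ.measure) (H := Plane) M.edges
    (s := fun p : Fin M.card × Fin M.card => M.diamond p.1 p.2)
    (fun p => measurableSet_diamond p.1 p.2) (fun p => measure_ne_top Λ.measure _)
    (fun p hp q hq hpq => le_antisymm
      ((Measure.restrict_apply_le _ _).trans (disjoint_diamonds hp hq hpq).le) zero_le)
    (fun p => (2 * ((w p.2 - w p.1) / M.centerDist p.1 p.2)) • M.normal p.1 p.2)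
  rw [discreteGradient_eq, seminormSq, Finset.mul_sum]
  refine h.trans_le ?_
  refine Finset.sum_le_sum fun p hp => ?_
  have hN := neighbor_of_mem_edges hp
  have hd := hN.centerDist_pos
  have hfin : volume (M.diamond p.1 p.2) ≠ ∞ := by
    rw [hN.volume_diamond]; exact ENNReal.ofReal_ne_top
  have hle : Λ.measure.real (M.diamond p.1 p.2) ≤ M.edgeLength p.1 p.2 * M.centerDist p.1 p.2 / 2 := by
    rw [← hN.volume_real_diamond]
    exact ENNReal.toReal_mono hfin (Measure.restrict_apply_le _ _)
  rw [norm_smul, hN.norm_normal, mul_one, Real.norm_eq_abs, sq_abs]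
  refine (mul_le_mul_of_nonneg_right hle (sq_nonneg _)).trans (le_of_eq ?_)
  field_simp

/-- Essentially disjoint diamonds of area $m_\sigma d/2$ fit into the closure of $\Lambda$. This
bounds the Cauchy–Schwarz factor in `abs_inner_add_inner_le` uniformly in the mesh. -/
theorem edge_measure_le :
    ∑ p ∈ M.edges, M.edgeLength p.1 p.2 * M.centerDist p.1 p.2 ≤
      2 * volume.real (closure Λ.carrier) := by
  have hfin : volume (closure Λ.carrier) ≠ ∞ := Λ.isBounded.isCompact_closure.measure_lt_top.ne
  have h1 : ∑ p ∈ M.edges, volume (M.diamond p.1 p.2) ≤ volume (closure Λ.carrier) := by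
    rw [← measure_biUnion_finset₀]
    · refine measure_mono (iUnion₂_subset fun p _ => (diamond_subset _ _).trans ?_)
      exact union_subset (closure_cell_subset _) (closure_cell_subset _)
    · exact fun p hp q hq hpq => disjoint_diamonds hp hq hpq
    · exact fun p _ => isOpen_interior.measurableSet.nullMeasurableSet
  have h2 := ENNReal.toReal_mono hfin h1
  rw [ENNReal.toReal_sum] at h2
  · have h3 : ∑ p ∈ M.edges, M.edgeLength p.1 p.2 * M.centerDist p.1 p.2 =
        2 * ∑ p ∈ M.edges, (volume (M.diamond p.1 p.2)).toReal := by
      rw [Finset.mul_sum]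
      refine Finset.sum_congr rfl fun p hp => ?_
      have := (neighbor_of_mem_edges hp).volume_real_diamond
      rw [Measure.real] at this
      rw [this]
      ring
    rw [h3]
    exact mul_le_mul_of_nonneg_left h2 zero_le_two
  · intro p hp
    rw [(neighbor_of_mem_edges hp).volume_diamond]
    exact ENNReal.ofReal_ne_top

theorem seminormSq_nonneg (w : Fin M.card → ℝ) : 0 ≤ M.seminormSq w :=
  Finset.sum_nonneg fun p hp => by
    have h1 := (neighbor_of_mem_edges hp).edgeLength_pos
    have h2 := (neighbor_of_mem_edges hp).centerDist_pos
    positivity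

theorem dist_le_size {i : Fin M.card} {x y : Plane} (hx : x ∈ closure (M.cell i))
    (hy : y ∈ closure (M.cell i)) : dist x y ≤ M.size := by
  refine (Metric.dist_le_diam_of_mem (isCompact_closure_cell i).isBounded hx hy).trans ?_
  rw [Metric.diam_closure]
  exact le_ciSup (f := fun i => Metric.diam (M.cell i)) (Set.finite_range _).bddAbove i

theorem size_nonneg : 0 ≤ M.size := Real.iSup_nonneg fun _ => Metric.diam_nonneg

/-- Integration by parts on each cell; the two sides of an edge carry opposite normals, so only the
jump of `w` remains. -/
theorem inner_cellFunction (w : Fin M.card → ℝ) (φ : Λ.TestFunction) (l : Fin 2) :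
    ⟪M.cellFunction w, φ.partialLp l⟫ = -∑ p ∈ M.edges,
      (w p.2 - w p.1) * (M.normal p.1 p.2 l * ∫ x in M.edge p.1 p.2, φ.toFun x ∂μH[1]) := by
  classical
  have h1 : ∀ i, ⟪(indicatorConstLp 2 (M.cell_isOpen i).measurableSet
      (measure_ne_top Λ.measure _) (w i) : Λ.L2), φ.partialLp l⟫ =
      ∑ j, if M.Interior i j then
        w i * (M.normal i j l * ∫ x in M.edge i j, φ.toFun x ∂μH[1]) else 0 := by
    intro i
    rw [L2.inner_indicatorConstLp_eq_setIntegral_inner]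
    have : ∫ x in M.cell i, ⟪w i, φ.partialLp l x⟫ ∂Λ.measure =
        w i * ∫ x in M.cell i, fderiv ℝ φ.toFun x (EuclideanSpace.single l 1) := by
      rw [← integral_const_mul, Measure.restrict_restrict (M.cell_isOpen i).measurableSet,
        inter_eq_left.2 (M.cell_subset i)]
      refine integral_congr_ae ?_
      have := ae_mono (Measure.restrict_mono_set volume (M.cell_subset i)) (φ.coeFn_partialLp l)
      filter_upwards [this] with x hx
      rw [hx, real_inner_comm]
      rfl
    rw [this, integral_fderiv_cell i φ.contDiff φ.subset l, Finset.mul_sum]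
    exact Finset.sum_congr rfl fun j _ => by split_ifs <;> simp
  rw [cellFunction, sum_inner, Finset.sum_congr rfl fun i _ => h1 i, sum_interior_eq_sum_edges,
    ← Finset.sum_neg_distrib]
  refine Finset.sum_congr rfl fun p _ => ?_
  rw [normal_swap, edge_comm M p.2 p.1, PiLp.neg_apply]
  ring

theorem inner_discreteGradient (w : Fin M.card → ℝ) (φ : Λ.TestFunction) (l : Fin 2) :
    ⟪M.discreteGradient w, φ.vecLp l⟫ = ∑ p ∈ M.edges,
      (w p.2 - w p.1) * (M.normal p.1 p.2 l *
        (2 / M.centerDist p.1 p.2 * ∫ x in M.diamond p.1 p.2, φ.toFun x)) := by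
  rw [discreteGradient_eq, sum_inner]
  refine Finset.sum_congr rfl fun p hp => ?_
  set D := M.diamond p.1 p.2
  have hDm : MeasurableSet D := isOpen_interior.measurableSet
  rw [L2.inner_indicatorConstLp_eq_setIntegral_inner, Measure.restrict_restrict hDm]
  set c : Plane := (2 * ((w p.2 - w p.1) / M.centerDist p.1 p.2)) • M.normal p.1 p.2 with hc
  have h1 : ∫ x in D ∩ Λ.carrier, ⟪c, φ.vecLp l x⟫ = ∫ x in D ∩ Λ.carrier, c l * φ.toFun x := by
    refine integral_congr_ae ?_
    have := ae_mono (Measure.restrict_mono_set volume (inter_subset_right (s := D)))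
      (φ.coeFn_vecLp l)
    filter_upwards [this] with x hx
    rw [hx, real_inner_smul_right, EuclideanSpace.inner_single_right]
    simp [mul_comm]
  have h2 : ∫ x in D ∩ Λ.carrier, c l * φ.toFun x = ∫ x in D, c l * φ.toFun x := by
    symm
    refine setIntegral_eq_of_subset_of_forall_sdiff_eq_zero hDm inter_subset_left fun x hx => ?_
    rw [φ.eq_zero fun h => hx.2 ⟨hx.1, h⟩, mul_zero]
  rw [h1, h2, integral_const_mul, hc, PiLp.smul_apply, smul_eq_mul]
  ring

/-- Because $\frac2d|D_\sigma|=m_\sigma$, both terms are $m_\sigma$ times a mean value of the test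
function over points within one mesh size of a fixed `a` on the edge; each differs from
$m_\sigma\varphi(a)$ by at most $L\,h\,m_\sigma$. This is where the factor 2 in the discrete
gradient matters. -/
theorem abs_diamond_sub_edge_le {p : Fin M.card × Fin M.card} (hp : p ∈ M.edges)
    (φ : Λ.TestFunction) {L : ℝ≥0} (hL : LipschitzWith L φ.toFun) :
    |2 / M.centerDist p.1 p.2 * (∫ x in M.diamond p.1 p.2, φ.toFun x) -
      ∫ x in M.edge p.1 p.2, φ.toFun x ∂μH[1]| ≤ 2 * L * M.size * M.edgeLength p.1 p.2 := by
  have hN := neighbor_of_mem_edges hp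
  have hd := hN.centerDist_pos
  have hm := hN.edgeLength_pos
  obtain ⟨a, ha⟩ := hN.edge_nonempty
  have hci : IntegrableOn φ.toFun (M.diamond p.1 p.2) :=
    (φ.contDiff.continuous.integrable_of_hasCompactSupport φ.compact).integrableOn
  have hfinD : volume (M.diamond p.1 p.2) < ∞ := by
    rw [hN.volume_diamond]; exact ENNReal.ofReal_lt_top
  have hfinE := hN.hausdorffMeasure_lt_top
  have hce : IntegrableOn φ.toFun (M.edge p.1 p.2) μH[1] := by
    have : IsFiniteMeasure ((μH[1] : Measure Plane).restrict (M.edge p.1 p.2)) :=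
      ⟨by simpa using hfinE⟩
    obtain ⟨C, hC⟩ := φ.compact.exists_bound_of_continuous φ.contDiff.continuous
    exact Integrable.of_bound φ.contDiff.continuous.aestronglyMeasurable C
      (Eventually.of_forall hC)
  have hbound : ∀ x, x ∈ closure (M.cell p.1) ∪ closure (M.cell p.2) →
      ‖φ.toFun x - φ.toFun a‖ ≤ L * M.size := by
    intro x hx
    rw [← dist_eq_norm]
    refine (hL.dist_le_mul x a).trans (mul_le_mul_of_nonneg_left ?_ L.coe_nonneg)
    rcases hx with hx | hx
    · exact dist_le_size hx ha.1
    · exact dist_le_size hx ha.2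
  have h1 := norm_setIntegral_le_of_norm_le_const (f := fun x => φ.toFun x - φ.toFun a)
    (C := L * M.size) hfinD (fun x hx => hbound x (diamond_subset _ _ hx))
  have h2 := norm_setIntegral_le_of_norm_le_const (f := fun x => φ.toFun x - φ.toFun a)
    (C := L * M.size) hfinE (fun x hx => hbound x (Or.inl hx.1))
  rw [integral_sub hci (integrableOn_const hfinD.ne), setIntegral_const, hN.volume_real_diamond,
    Real.norm_eq_abs, smul_eq_mul] at h1
  rw [integral_sub hce (integrableOn_const hfinE.ne), setIntegral_const, Real.norm_eq_abs,
    smul_eq_mul] at h2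
  change |_ - M.edgeLength p.1 p.2 * _| ≤ _ * M.edgeLength p.1 p.2 at h2
  set I := ∫ x in M.diamond p.1 p.2, φ.toFun x
  set J := ∫ x in M.edge p.1 p.2, φ.toFun x ∂μH[1]
  set m := M.edgeLength p.1 p.2
  set d := M.centerDist p.1 p.2
  have h3 : |2 / d * I - m * φ.toFun a| ≤ L * M.size * m := by
    have e : 2 / d * I - m * φ.toFun a = 2 / d * (I - m * d / 2 * φ.toFun a) := by
      field_simp
    rw [e, abs_mul, abs_of_pos (by positivity : 0 < 2 / d)]
    refine (mul_le_mul_of_nonneg_left h1 (by positivity)).trans (le_of_eq ?_)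
    field_simp
  rw [abs_le] at h2 h3 ⊢
  constructor <;> linarith [h2.1, h2.2, h3.1, h3.2]

/-- Consistency of the discrete gradient. -/
theorem abs_inner_add_inner_le (φ : Λ.TestFunction) {L : ℝ≥0} (hL : LipschitzWith L φ.toFun)
    (l : Fin 2) (w : Fin M.card → ℝ) :
    |⟪M.discreteGradient w, φ.vecLp l⟫ + ⟪M.cellFunction w, φ.partialLp l⟫| ≤
      2 * L * M.size * √(2 * volume.real (closure Λ.carrier)) * √(M.seminormSq w) := by
  rw [inner_discreteGradient, inner_cellFunction, ← sub_eq_add_neg, ← Finset.sum_sub_distrib]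
  have hterm : ∀ p ∈ M.edges,
      |(w p.2 - w p.1) * (M.normal p.1 p.2 l *
        (2 / M.centerDist p.1 p.2 * ∫ x in M.diamond p.1 p.2, φ.toFun x)) -
      (w p.2 - w p.1) * (M.normal p.1 p.2 l * ∫ x in M.edge p.1 p.2, φ.toFun x ∂μH[1])| ≤
      2 * L * M.size * (√(M.edgeLength p.1 p.2 * M.centerDist p.1 p.2) *
        √(M.edgeLength p.1 p.2 / M.centerDist p.1 p.2 * (w p.2 - w p.1) ^ 2)) := by
    intro p hp
    have hN := neighbor_of_mem_edges hp
    have hd := hN.centerDist_pos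
    have hm := hN.edgeLength_pos
    have hn : |M.normal p.1 p.2 l| ≤ 1 := by
      rw [← hN.norm_normal]
      exact PiLp.norm_apply_le (M.normal p.1 p.2) l
    have hk := abs_diamond_sub_edge_le hp φ hL
    -- Splitting $m|w_L-w_K|=\sqrt{md}\,\sqrt{\tfrac md(w_L-w_K)^2}$ prepares the Cauchy–Schwarz
    -- inequality.
    have hsq : √(M.edgeLength p.1 p.2 * M.centerDist p.1 p.2) *
        √(M.edgeLength p.1 p.2 / M.centerDist p.1 p.2 * (w p.2 - w p.1) ^ 2) =
        M.edgeLength p.1 p.2 * |w p.2 - w p.1| := by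
      rw [← Real.sqrt_mul (by positivity)]
      rw [show M.edgeLength p.1 p.2 * M.centerDist p.1 p.2 *
          (M.edgeLength p.1 p.2 / M.centerDist p.1 p.2 * (w p.2 - w p.1) ^ 2) =
          (M.edgeLength p.1 p.2 * (w p.2 - w p.1)) ^ 2 by field_simp, Real.sqrt_sq_eq_abs, abs_mul,
        abs_of_pos hm]
    rw [hsq, ← mul_sub, ← mul_sub, abs_mul, abs_mul]
    calc |w p.2 - w p.1| * (|M.normal p.1 p.2 l| * _)
        ≤ |w p.2 - w p.1| * (1 * (2 * L * M.size * M.edgeLength p.1 p.2)) := by gcongr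
      _ = _ := by ring
  refine (Finset.abs_sum_le_sum_abs _ _).trans ((Finset.sum_le_sum hterm).trans ?_)
  rw [← Finset.mul_sum, mul_assoc (2 * L * M.size : ℝ)]
  refine mul_le_mul_of_nonneg_left ?_ (by have := M.size_nonneg; positivity)
  refine (Real.sum_sqrt_mul_sqrt_le _ (fun p => ?_) (fun p => ?_)).trans ?_
  · exact mul_nonneg ENNReal.toReal_nonneg dist_nonneg
  · exact mul_nonneg (div_nonneg ENNReal.toReal_nonneg dist_nonneg) (sq_nonneg _)
  · gcongr
    · exact edge_measure_le
    · exact le_rfl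

end AdmissibleMesh

/-! ### The energy and stability inequalities for one step. -/

/-- Positivity of an upwind discretization of a divergence free convection term. -/
theorem sum_upwind_nonneg {ι : Type*} [Fintype ι] (a : ι → ι → ℝ) (ha : ∀ i j, a j i = -a i j)
    (h0 : ∀ i, ∑ j, a i j = 0) (w : ι → ℝ) :
    0 ≤ ∑ i, ∑ j, (max (a i j) 0 * w i - max (-a i j) 0 * w j) * w i := by
  have h1 : ∑ i, ∑ j, max (-a i j) 0 * w j * w i = ∑ i, ∑ j, max (a i j) 0 * w j * w i := by
    rw [Finset.sum_comm]
    refine Finset.sum_congr rfl fun i _ => Finset.sum_congr rfl fun j _ => ?_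
    rw [ha i j, neg_neg]; ring
  -- From $a_{ji}^+-a_{ij}^+=-a_{ij}$ and vanishing row sums. Hence the upwind form is half of the
  -- sum of squares in `h3`.
  have h2 : ∑ i, ∑ j, max (a i j) 0 * w j ^ 2 = ∑ i, ∑ j, max (a i j) 0 * w i ^ 2 := by
    rw [Finset.sum_comm, ← sub_eq_zero, ← Finset.sum_sub_distrib]
    refine Finset.sum_eq_zero fun i _ => ?_
    rw [← Finset.sum_sub_distrib]
    have : ∀ j, max (a j i) 0 * w i ^ 2 - max (a i j) 0 * w i ^ 2 = -(w i ^ 2) * a i j := by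
      intro j
      rw [ha i j]
      rcases le_total (a i j) 0 with h | h
      · rw [max_eq_left (by linarith), max_eq_right h]; ring
      · rw [max_eq_right (by linarith), max_eq_left h]; ring
    rw [Finset.sum_congr rfl fun j _ => this j, ← Finset.mul_sum, h0, mul_zero]
  have h3 : 0 ≤ ∑ i, ∑ j, max (a i j) 0 * (w i - w j) ^ 2 :=
    Finset.sum_nonneg fun i _ => Finset.sum_nonneg fun j _ =>
      mul_nonneg (le_max_right _ _) (sq_nonneg _)
  have h4 : ∑ i, ∑ j, max (a i j) 0 * (w i - w j) ^ 2 =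
      ∑ i, ∑ j, max (a i j) 0 * w i ^ 2 + ∑ i, ∑ j, max (a i j) 0 * w j ^ 2
        - 2 * ∑ i, ∑ j, max (a i j) 0 * w j * w i := by
    simp only [Finset.mul_sum, ← Finset.sum_add_distrib, ← Finset.sum_sub_distrib]
    exact Finset.sum_congr rfl fun i _ => Finset.sum_congr rfl fun j _ => by ring
  have h5 : ∑ i, ∑ j, (max (a i j) 0 * w i - max (-a i j) 0 * w j) * w i =
      ∑ i, ∑ j, max (a i j) 0 * w i ^ 2 - ∑ i, ∑ j, max (-a i j) 0 * w j * w i := by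
    simp only [← Finset.sum_sub_distrib]
    exact Finset.sum_congr rfl fun i _ => Finset.sum_congr rfl fun j _ => by ring
  rw [h5, h1]
  rw [h4, h2] at h3
  linarith

namespace AdmissibleMesh

variable {Λ : PolygonalDomain} {M : AdmissibleMesh Λ}

theorem cellArea_pos (i : Fin M.card) : 0 < M.cellArea i :=
  ENNReal.toReal_pos ((M.cell_isOpen i).measure_pos volume (M.cell_nonempty i)).ne'
    (cell_isBounded i).measure_lt_top.ne

theorem sum_cellArea_le : ∑ i, M.cellArea i ≤ volume.real (closure Λ.carrier) := by
  have hfin : volume (closure Λ.carrier) ≠ ∞ := Λ.isBounded.isCompact_closure.measure_lt_top.ne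
  rw [show ∑ i, M.cellArea i = ∑ i, volume.real (M.cell i) from rfl,
    ← measureReal_iUnion_fintype (h' := fun i => (cell_isBounded i).measure_lt_top.ne)]
  · exact measureReal_mono (iUnion_subset fun i => (M.cell_subset i).trans subset_closure) hfin
  · exact fun i j hij => disjoint_cell hij
  · exact fun i => (M.cell_isOpen i).measurableSet

open scoped Classical in
/-- The convection and diffusion terms of the scheme. -/
noncomputable def stepOperator (M : AdmissibleMesh Λ) (T : ℝ≥0) (N : ℕ) (v : ℝ → Plane → Plane)
    (n : ℕ) (w : Fin M.card → ℝ) (i : Fin M.card) : ℝ :=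
  (∑ j, if M.Interior i j then
      M.edgeLength i j * M.edgeVelocity T N v n i j * M.upwind T N v n w i j else 0)
    + ∑ j, if M.Interior i j then M.edgeLength i j / M.centerDist i j * (w i - w j) else 0

/-- The upwind side is chosen by the velocity alone, so the operator is linear in the grid function.
-/
theorem stepOperator_sub (T : ℝ≥0) (N : ℕ) (v : ℝ → Plane → Plane) (n : ℕ)
    (w z : Fin M.card → ℝ) (i : Fin M.card) :
    M.stepOperator T N v n (w - z) i =
      M.stepOperator T N v n w i - M.stepOperator T N v n z i := by
  simp only [stepOperator, ← Finset.sum_add_distrib, ← Finset.sum_sub_distrib]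
  refine Finset.sum_congr rfl fun j _ => ?_
  simp only [upwind, Pi.sub_apply]
  split_ifs <;> ring

/-- Diffusion gives the seminorm exactly, edge by edge; convection only adds a nonnegative term by
`sum_upwind_nonneg`. -/
theorem sum_stepOperator_mul {T : ℝ≥0} {v : ℝ → Plane → Plane} (hv : Λ.IsConvectionField T v)
    {N n : ℕ} (hN : 0 < N) (hn : n < N) (w : Fin M.card → ℝ) :
    M.seminormSq w ≤ ∑ i, M.stepOperator T N v n w i * w i := by
  classical
  have h1 := sum_upwind_nonneg (M.convCoeff T N v n) (convCoeff_swap T N v n)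
    (sum_convCoeff hv hN hn) w
  have h2 : ∀ i j, (if M.Interior i j then
      M.edgeLength i j * M.edgeVelocity T N v n i j * M.upwind T N v n w i j else 0) =
      max (M.convCoeff T N v n i j) 0 * w i - max (-M.convCoeff T N v n i j) 0 * w j := by
    intro i j
    by_cases h : M.Interior i j
    · have hm := h.neighbor.edgeLength_pos
      simp only [convCoeff, if_pos h, upwind]
      split_ifs with hs
      · have : 0 ≤ M.edgeLength i j * M.edgeVelocity T N v n i j := by positivity
        rw [max_eq_left this, max_eq_right (by linarith)]; ring
      · have : M.edgeLength i j * M.edgeVelocity T N v n i j < 0 :=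
          mul_neg_of_pos_of_neg hm (not_le.1 hs)
        rw [max_eq_right this.le, max_eq_left (by linarith)]; ring
    · simp [convCoeff, h]
  have h3 : ∑ i, (∑ j, if M.Interior i j then
      M.edgeLength i j / M.centerDist i j * (w i - w j) else 0) * w i = M.seminormSq w := by
    simp only [Finset.sum_mul, ite_mul, zero_mul]
    rw [sum_interior_eq_sum_edges]
    refine Finset.sum_congr rfl fun p _ => ?_
    rw [edgeLength_comm p.2 p.1, centerDist_comm p.2 p.1]
    ring
  simp only [stepOperator, add_mul, Finset.sum_add_distrib, h3, h2]
  simp only [Finset.sum_mul]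
  linarith

theorem stepEquation_iff {T : ℝ≥0} (hT : 0 < T) {N : ℕ} (hN : 0 < N) (v : ℝ → Plane → Plane)
    (g β : ℝ → ℝ) (n : ℕ) (w' w : Fin M.card → ℝ) (dW : ℝ) :
    M.StepEquation T N v g β n w' w dW ↔ ∀ i,
      M.cellArea i * w i + timeStep T N * M.stepOperator T N v n w i =
        M.cellArea i * (w' i + g (w' i) * dW) + timeStep T N * (M.cellArea i * β (w i)) := by
  have key : ∀ m τ x x' S₁ S₂ y b : ℝ, τ ≠ 0 →
      (m / τ * (x - x') + S₁ + S₂ = m / τ * y * dW + m * b ↔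
        m * x + τ * (S₁ + S₂) = m * (x' + y * dW) + τ * (m * b)) := by
    intro m τ x x' S₁ S₂ y b hτ
    field_simp
    constructor <;> intro h <;> linarith
  exact forall_congr' fun i => key _ _ _ _ _ _ _ _ (timeStep_pos hT hN).ne'

/-- The weighted inner product on grid functions. -/
noncomputable def gridInner (M : AdmissibleMesh Λ) (w z : Fin M.card → ℝ) : ℝ :=
  ∑ i, M.cellArea i * (w i * z i)

theorem normSq_nonneg (w : Fin M.card → ℝ) : 0 ≤ M.normSq w :=
  Finset.sum_nonneg fun i _ => mul_nonneg (cellArea_pos i).le (sq_nonneg _)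

theorem two_mul_gridInner_le (w z : Fin M.card → ℝ) {c : ℝ} (hc : 0 < c) :
    2 * M.gridInner w z ≤ c * M.normSq w + c⁻¹ * M.normSq z := by
  simp only [gridInner, normSq, Finset.mul_sum, ← Finset.sum_add_distrib]
  refine Finset.sum_le_sum fun i _ => ?_
  have hm := cellArea_pos (M := M) i
  have h : 0 ≤ c⁻¹ * (c * w i - z i) ^ 2 := by positivity
  have e : c⁻¹ * (c * w i - z i) ^ 2 = c * w i ^ 2 + c⁻¹ * z i ^ 2 - 2 * (w i * z i) := by
    field_simp; ring
  rw [e] at h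
  nlinarith

theorem normSq_lipschitz_le {f : ℝ → ℝ} {L : ℝ≥0} (hf : LipschitzWith L f)
    (w z : Fin M.card → ℝ) :
    M.normSq (fun i => f (w i) - f (z i)) ≤ L ^ 2 * M.normSq (w - z) := by
  simp only [normSq, Finset.mul_sum]
  refine Finset.sum_le_sum fun i _ => ?_
  have h := hf.dist_le_mul (w i) (z i)
  rw [Real.dist_eq, Real.dist_eq] at h
  have h2 := pow_le_pow_left₀ (abs_nonneg _) h 2
  rw [mul_pow, sq_abs, sq_abs] at h2
  have := mul_le_mul_of_nonneg_left h2 (cellArea_pos i).le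
  rw [Pi.sub_apply]
  linarith

theorem gridInner_lipschitz_le {f : ℝ → ℝ} {L : ℝ≥0} (hf : LipschitzWith L f)
    (w z : Fin M.card → ℝ) :
    ∑ i, M.cellArea i * (f (w i) - f (z i)) * (w i - z i) ≤ L * M.normSq (w - z) := by
  simp only [normSq, Finset.mul_sum]
  refine Finset.sum_le_sum fun i _ => ?_
  have h := hf.dist_le_mul (w i) (z i)
  rw [Real.dist_eq, Real.dist_eq] at h
  have h1 : (f (w i) - f (z i)) * (w i - z i) ≤ L * (w i - z i) ^ 2 := by
    calc (f (w i) - f (z i)) * (w i - z i) ≤ |f (w i) - f (z i)| * |w i - z i| := by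
          rw [← abs_mul]; exact le_abs_self _
      _ ≤ L * |w i - z i| * |w i - z i| := by gcongr
      _ = _ := by rw [mul_assoc, ← sq, sq_abs]
  have := mul_le_mul_of_nonneg_left h1 (cellArea_pos (M := M) i).le
  rw [Pi.sub_apply]
  linarith

/-- The solution of a step depends Lipschitz continuously on the data. -/
theorem normSq_sub_le {T : ℝ≥0} (hT : 0 < T) {N n : ℕ} (hN : 0 < N) (hn : n < N)
    {v : ℝ → Plane → Plane} (hv : Λ.IsConvectionField T v) {g β : ℝ → ℝ} {L : ℝ≥0}
    (hβ : LipschitzWith L β) (hL : 4 * L * timeStep T N ≤ 1) {w' w z' z : Fin M.card → ℝ}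
    {dW dZ : ℝ} (hw : M.StepEquation T N v g β n w' w dW)
    (hz : M.StepEquation T N v g β n z' z dZ) :
    M.normSq (w - z) ≤
      4 * M.normSq (fun i => (w' i + g (w' i) * dW) - (z' i + g (z' i) * dZ)) := by
  rw [stepEquation_iff hT hN] at hw hz
  have hpos := timeStep_pos hT hN
  set r : Fin M.card → ℝ := fun i => (w' i + g (w' i) * dW) - (z' i + g (z' i) * dZ) with hr
  have h1 : M.normSq (w - z) + timeStep T N * ∑ i, M.stepOperator T N v n (w - z) i * (w - z) i =
      M.gridInner r (w - z) +
        timeStep T N * ∑ i, M.cellArea i * (β (w i) - β (z i)) * (w i - z i) := by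
    simp only [normSq, gridInner, Finset.mul_sum, ← Finset.sum_add_distrib, stepOperator_sub]
    refine Finset.sum_congr rfl fun i _ => ?_
    simp only [Pi.sub_apply, hr]
    linear_combination (w i - z i) * hw i - (w i - z i) * hz i
  have h2 := sum_stepOperator_mul hv hN hn (w - z)
  have h3 := seminormSq_nonneg (M := M) (w - z)
  have h4 := gridInner_lipschitz_le (M := M) hβ w z
  -- Young's inequality spends a quarter of $\|w-z\|^2$ and $4L\Delta t\le1$ another quarter, so
  -- half of it remains on the left.
  have h5 := two_mul_gridInner_le (M := M) r (w - z) (c := 2) two_pos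
  have h6 := normSq_nonneg (M := M) (w - z)
  have h7 := mul_le_mul_of_nonneg_left h4 hpos.le
  have h8 := mul_nonneg hpos.le (h3.trans h2)
  have h9 := mul_le_mul_of_nonneg_right hL h6
  nlinarith

/-- The energy inequality for a step of the scheme. -/
theorem energy_step {T : ℝ≥0} (hT : 0 < T) {N n : ℕ} (hN : 0 < N) (hn : n < N)
    {v : ℝ → Plane → Plane} (hv : Λ.IsConvectionField T v) {g β : ℝ → ℝ} {L : ℝ≥0}
    (hβ : LipschitzWith L β) (hβ0 : β 0 = 0) {w' w : Fin M.card → ℝ} {dW : ℝ}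
    (hw : M.StepEquation T N v g β n w' w dW) :
    (1 - 2 * L * timeStep T N) * M.normSq w + 1 / 2 * M.normSq (w - w') +
      2 * timeStep T N * M.seminormSq w ≤
      M.normSq w' + 2 * (dW * M.gridInner (fun i => g (w' i)) w') +
        2 * (dW ^ 2 * M.normSq fun i => g (w' i)) := by
  rw [stepEquation_iff hT hN] at hw
  have hpos := timeStep_pos hT hN
  -- Uses $2(a-b)a=a^2-b^2+(a-b)^2$. The noise is tested with $w'+(w-w')$: the first part will have
  -- mean zero, the second is absorbed by half of $\|w-w'\|^2$.
  have h1 : M.normSq w + M.normSq (w - w') +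
      2 * (timeStep T N * ∑ i, M.stepOperator T N v n w i * w i) =
      M.normSq w' + 2 * (dW * M.gridInner (fun i => g (w' i)) w') +
        2 * M.gridInner (fun i => dW * g (w' i)) (w - w') +
        2 * (timeStep T N * ∑ i, M.cellArea i * β (w i) * w i) := by
    simp only [normSq, gridInner, Finset.mul_sum, ← Finset.sum_add_distrib]
    refine Finset.sum_congr rfl fun i _ => ?_
    simp only [Pi.sub_apply]
    linear_combination 2 * w i * hw i
  have h2 := mul_le_mul_of_nonneg_left (sum_stepOperator_mul hv hN hn w) hpos.le
  have h4 := gridInner_lipschitz_le (M := M) hβ w 0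
  simp only [Pi.zero_apply, hβ0, sub_zero] at h4
  have h5 := two_mul_gridInner_le (M := M) (fun i => dW * g (w' i)) (w - w') (c := 2) two_pos
  have h6 : M.normSq (fun i => dW * g (w' i)) = dW ^ 2 * M.normSq fun i => g (w' i) := by
    simp only [normSq, Finset.mul_sum]
    exact Finset.sum_congr rfl fun i _ => by ring
  rw [h6] at h5
  have h7 := mul_le_mul_of_nonneg_left h4 hpos.le
  nlinarith

theorem normSq_growth {g : ℝ → ℝ} {L : ℝ≥0} (hg : LipschitzWith L g) (w : Fin M.card → ℝ) :
    M.normSq (fun i => g (w i)) ≤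
      (2 * g 0 ^ 2 * volume.real (closure Λ.carrier) + 2 * L ^ 2) * (1 + M.normSq w) := by
  have h1 := normSq_lipschitz_le (M := M) hg w 0
  rw [sub_zero] at h1
  simp only [Pi.zero_apply] at h1
  have h2 : M.normSq (fun i => g (w i)) ≤
      2 * M.normSq (fun i => g (w i) - g 0) + 2 * g 0 ^ 2 * ∑ i, M.cellArea i := by
    simp only [normSq, Finset.mul_sum, ← Finset.sum_add_distrib]
    refine Finset.sum_le_sum fun i _ => ?_
    have hm := cellArea_pos (M := M) i
    -- Indeed $2(x-y)^2+2y^2-x^2=(x-2y)^2$.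
    nlinarith [mul_nonneg hm.le (sq_nonneg (g (w i) - 2 * g 0))]
  have h3 := sum_cellArea_le (M := M)
  have h4 := normSq_nonneg (M := M) w
  have h5 : 2 * g 0 ^ 2 * ∑ i, M.cellArea i ≤ 2 * g 0 ^ 2 * volume.real (closure Λ.carrier) := by
    gcongr
  have h6 : 0 ≤ 2 * g 0 ^ 2 * volume.real (closure Λ.carrier) := by positivity
  have h7 : 0 ≤ 2 * (L : ℝ) ^ 2 := by positivity
  nlinarith

/-- Averaging over cells is an orthogonal projection: $\langle w,f\rangle=\|w\|^2$, and
Cauchy–Schwarz gives the contraction. -/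
theorem normSq_average_le (f : Λ.L2) (w : Fin M.card → ℝ)
    (hw : ∀ i, w i = (M.cellArea i)⁻¹ * ∫ x in M.cell i, f x) : M.normSq w ≤ ‖f‖ ^ 2 := by
  have h1 : ⟪M.cellFunction w, f⟫ = M.normSq w := by
    rw [cellFunction, sum_inner]
    refine Finset.sum_congr rfl fun i _ => ?_
    rw [L2.inner_indicatorConstLp_eq_inner_setIntegral,
      Measure.restrict_restrict (M.cell_isOpen i).measurableSet, inter_eq_left.2 (M.cell_subset i)]
    have hm := (cellArea_pos (M := M) i).ne'
    have : ∫ x in M.cell i, f x = M.cellArea i * w i := by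
      rw [hw i]; field_simp
    rw [this]
    simp only [RCLike.inner_apply, conj_trivial]
    ring
  have h2 := real_inner_le_norm (M.cellFunction w) f
  rw [h1, ← norm_cellFunction_sq] at h2
  rw [← norm_cellFunction_sq]
  rcases eq_or_lt_of_le (norm_nonneg (M.cellFunction w)) with h | h
  · rw [← h, zero_pow two_ne_zero]; exact sq_nonneg _
  · have : ‖M.cellFunction w‖ ≤ ‖f‖ := by nlinarith
    gcongr

/-- The solution of a step is a Lipschitz continuous function of the data. -/
theorem exists_solution_map (M : AdmissibleMesh Λ) {T : ℝ≥0} (hT : 0 < T) {N n : ℕ} (hN : 0 < N)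
    (hn : n < N) {v : ℝ → Plane → Plane} (hv : Λ.IsConvectionField T v) (g : ℝ → ℝ) {β : ℝ → ℝ}
    {L : ℝ≥0} (hβ : LipschitzWith L β) (hL : 4 * L * timeStep T N ≤ 1) :
    ∃ G : (Fin M.card → ℝ) → Fin M.card → ℝ, Continuous G ∧
      ∀ w' w dW, M.StepEquation T N v g β n w' w dW → w = G fun i => w' i + g (w' i) * dW := by
  classical
  set A := ∑ i, M.cellArea i
  -- `R` is the set of data for which the step is solvable. Solvability for all data is not needed:
  -- the solution is Lipschitz on `R` and is extended from there.
  set R : Set (Fin M.card → ℝ) :=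
    {r | ∃ w' w dW, M.StepEquation T N v g β n w' w dW ∧ r = fun i => w' i + g (w' i) * dW}
  have hex : ∀ r : Fin M.card → ℝ, ∃ w, r ∈ R → ∃ w' dW, M.StepEquation T N v g β n w' w dW ∧
      r = fun i => w' i + g (w' i) * dW := by
    intro r
    by_cases hr : r ∈ R
    · obtain ⟨w', w, dW, h, h'⟩ := hr
      exact ⟨w, fun _ => ⟨w', dW, h, h'⟩⟩
    · exact ⟨0, fun h => absurd h hr⟩
  choose S hS using hex
  have hA : 0 ≤ A := Finset.sum_nonneg fun i _ => (cellArea_pos i).le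
  have hnorm : ∀ r : Fin M.card → ℝ, M.normSq r ≤ A * ‖r‖ ^ 2 := by
    intro r
    rw [normSq, Finset.sum_mul]
    refine Finset.sum_le_sum fun i _ => mul_le_mul_of_nonneg_left ?_ (cellArea_pos i).le
    rw [← sq_abs]
    exact pow_le_pow_left₀ (abs_nonneg _) (norm_le_pi_norm r i) 2
  have hcoord : ∀ (d : Fin M.card → ℝ) (i : Fin M.card), M.cellArea i * d i ^ 2 ≤ M.normSq d :=
    fun d i => Finset.single_le_sum (f := fun i => M.cellArea i * d i ^ 2)
      (fun j _ => mul_nonneg (cellArea_pos j).le (sq_nonneg _)) (Finset.mem_univ i)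
  -- Combines $m_id_i^2\le\|d\|^2$ for the difference $d$ of the solutions, the stability constant
  -- 4, and $\|r\|^2\le A\,|r|_\infty^2$ for the data.
  set k : Fin M.card → ℝ := fun i => √(4 * A / M.cellArea i)
  have hLip : LipschitzOnWith (Real.toNNReal (∑ i, k i)) S R := by
    refine LipschitzOnWith.of_dist_le_mul fun r hr r' hr' => ?_
    have hk : 0 ≤ ∑ i, k i := Finset.sum_nonneg fun i _ => Real.sqrt_nonneg _
    rw [Real.coe_toNNReal _ hk, dist_eq_norm, dist_eq_norm]
    refine (pi_norm_le_iff_of_nonneg (by positivity)).2 fun i => ?_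
    obtain ⟨w', dW, h1, h2⟩ := hS r hr
    obtain ⟨z', dZ, h3, h4⟩ := hS r' hr'
    have h5 := normSq_sub_le hT hN hn hv hβ hL h1 h3
    have h6 : (fun i => (w' i + g (w' i) * dW) - (z' i + g (z' i) * dZ)) = r - r' := by
      rw [h2, h4]; rfl
    rw [h6] at h5
    have h7 := (hcoord (S r - S r') i).trans (h5.trans (mul_le_mul_of_nonneg_left
      (hnorm (r - r')) (by norm_num)))
    have hm := cellArea_pos (M := M) i
    have h8 : |(S r - S r') i| ≤ k i * ‖r - r'‖ := by
      refine abs_le_of_sq_le_sq ?_ (by positivity)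
      rw [mul_pow, Real.sq_sqrt (by positivity), div_mul_eq_mul_div, le_div_iff₀ hm]
      linarith
    rw [Real.norm_eq_abs]
    refine h8.trans (mul_le_mul_of_nonneg_right ?_ (norm_nonneg _))
    exact Finset.single_le_sum (f := k) (fun j _ => Real.sqrt_nonneg _) (Finset.mem_univ i)
  obtain ⟨G, hG, hGS⟩ := hLip.extend_pi
  refine ⟨G, hG.continuous, fun w' w dW h => ?_⟩
  have hr : (fun i => w' i + g (w' i) * dW) ∈ R := ⟨w', w, dW, h, rfl⟩
  rw [← hGS hr]
  -- The selected solution has the same data as `w`; the stability estimate makes them equal.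
  obtain ⟨z', dZ, h1, h2⟩ := hS _ hr
  have h3 := normSq_sub_le hT hN hn hv hβ hL h h1
  have h4 : (fun i => (w' i + g (w' i) * dW) - (z' i + g (z' i) * dZ)) = 0 := by
    funext i
    have := congrFun h2 i
    simp [this]
  rw [h4] at h3
  have h5 : M.normSq (0 : Fin M.card → ℝ) = 0 := by simp [normSq]
  rw [h5, mul_zero] at h3
  funext i
  have h6 := (hcoord _ i).trans h3
  have h7 := cellArea_pos (M := M) i
  have h8 : (w i - S (fun i => w' i + g (w' i) * dW) i) ^ 2 ≤ 0 := by
    by_contra! hlt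
    exact absurd h6 (not_le.2 (mul_pos h7 hlt))
  exact sub_eq_zero.1 (pow_eq_zero_iff two_ne_zero |>.1 (le_antisymm h8 (sq_nonneg _)))

end AdmissibleMesh

/-! ### Moments of Brownian increments. -/

namespace IsBrownianMotionWrt

variable {Ω : Type*} {mΩ : MeasurableSpace Ω} {F : Filtration ℝ≥0 mΩ} {P : Measure Ω}
  {W : ℝ≥0 → Ω → ℝ}

theorem memLp_increment (hW : IsBrownianMotionWrt F P W) (s t : ℝ≥0) :
    MemLp (fun ω => W t ω - W s ω) 2 P :=
  (hW.isBrownian.toIsPreBrownianReal.hasLaw_sub t s).hasGaussianLaw.memLp (by simp)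

theorem integral_increment (hW : IsBrownianMotionWrt F P W) (s t : ℝ≥0) :
    ∫ ω, (W t ω - W s ω) ∂P = 0 := by
  have h := (hW.isBrownian.toIsPreBrownianReal.hasLaw_sub t s).integral_eq
  rw [integral_id_gaussianReal] at h
  exact h

theorem integral_increment_sq (hW : IsBrownianMotionWrt F P W) {s t : ℝ≥0} (hst : s ≤ t) :
    ∫ ω, (W t ω - W s ω) ^ 2 ∂P = t - s := by
  have hl := hW.isBrownian.toIsPreBrownianReal.hasLaw_sub t s
  have h := hl.variance_eq
  rw [variance_id_gaussianReal, variance_eq_integral hl.aemeasurable] at h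
  have h0 : ∫ ω, (W t - W s) ω ∂P = 0 := hW.integral_increment s t
  rw [h0] at h
  simp only [sub_zero, Pi.sub_apply] at h
  rw [h, coe_nndist, Real.dist_eq, abs_of_nonneg]
  · rfl
  · exact sub_nonneg.2 (NNReal.coe_le_coe.2 hst)

theorem indepFun_increment (hW : IsBrownianMotionWrt F P W) {s t : ℝ≥0} (hst : s ≤ t)
    {X : Ω → ℝ} (hX : Measurable[F s] X) : IndepFun (fun ω => W t ω - W s ω) X P :=
  (IndepFun_iff_Indep _ _ _).2
    (indep_of_indep_of_le_right (hW.indep s t hst) hX.comap_le)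

theorem integrable_increment_mul [IsProbabilityMeasure P] (hW : IsBrownianMotionWrt F P W)
    {s t : ℝ≥0} (hst : s ≤ t) {X : Ω → ℝ} (hX : Measurable[F s] X) (hXi : Integrable X P) :
    Integrable (fun ω => (W t ω - W s ω) * X ω) P ∧ ∫ ω, (W t ω - W s ω) * X ω ∂P = 0 := by
  have hind := hW.indepFun_increment hst hX
  have hm := hW.memLp_increment s t
  refine ⟨hind.integrable_mul (hm.integrable one_le_two) hXi, ?_⟩
  rw [hind.integral_fun_mul_eq_mul_integral hm.aestronglyMeasurable hXi.aestronglyMeasurable,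
    hW.integral_increment, zero_mul]

theorem integrable_increment_sq_mul [IsProbabilityMeasure P] (hW : IsBrownianMotionWrt F P W)
    {s t : ℝ≥0} (hst : s ≤ t) {X : Ω → ℝ} (hX : Measurable[F s] X) (hXi : Integrable X P) :
    Integrable (fun ω => (W t ω - W s ω) ^ 2 * X ω) P ∧
      ∫ ω, (W t ω - W s ω) ^ 2 * X ω ∂P = (t - s) * ∫ ω, X ω ∂P := by
  have hind : IndepFun (fun ω => (W t ω - W s ω) ^ 2) X P :=
    (hW.indepFun_increment hst hX).comp (measurable_id.pow_const 2) measurable_id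
  have hm := (hW.memLp_increment s t).integrable_sq
  refine ⟨hind.integrable_mul hm hXi, ?_⟩
  rw [hind.integral_fun_mul_eq_mul_integral hm.aestronglyMeasurable hXi.aestronglyMeasurable,
    hW.integral_increment_sq hst]

end IsBrownianMotionWrt

/-! ### Adaptedness and expected energy of discrete solutions. -/

theorem continuous_toL2 {Λ : PolygonalDomain} :
    Continuous (PolygonalDomain.H1.toL2 : Λ.H1 → Λ.L2) :=
  (WithLp.continuous_fst 2 Λ.L2 Λ.L2Vec).comp continuous_subtype_val

theorem norm_toL2_le {Λ : PolygonalDomain} (w : Λ.H1) : ‖w.toL2‖ ≤ ‖w‖ := by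
  have h := WithLp.prod_norm_sq_eq_of_L2 (w : WithLp 2 (Λ.L2 × Λ.L2Vec))
  refine abs_le_of_sq_le_sq' ?_ (norm_nonneg _) |>.2
  change ‖(w : WithLp 2 (Λ.L2 × Λ.L2Vec)).fst‖ ^ 2 ≤ ‖(w : WithLp 2 (Λ.L2 × Λ.L2Vec))‖ ^ 2
  rw [h]
  exact le_add_of_nonneg_right (sq_nonneg _)

theorem timeNode_zero (T : ℝ≥0) (N : ℕ) : timeNode T N 0 = 0 := by simp [timeNode]

theorem timeNode_succ_sub (T : ℝ≥0) (N n : ℕ) :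
    (timeNode T N (n + 1) : ℝ) - timeNode T N n = timeStep T N := by
  rw [coe_timeNode, coe_timeNode]; push_cast; ring

namespace AdmissibleMesh

variable {Λ : PolygonalDomain} {M : AdmissibleMesh Λ}

theorem continuous_normSq : Continuous M.normSq := by
  unfold normSq
  fun_prop

theorem continuous_seminormSq : Continuous M.seminormSq := by
  unfold seminormSq
  fun_prop

namespace IsDiscreteSolution

variable {Ω : Type*} [mΩ : MeasurableSpace Ω] {P : Measure Ω}
  {F : Filtration ℝ≥0 mΩ} {W : ℝ≥0 → Ω → ℝ} {T : ℝ≥0} {N : ℕ} {v : ℝ → Plane → Plane}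
  {g β : ℝ → ℝ} {u₀ : Ω → Λ.H1} {u : ℕ → Ω → Fin M.card → ℝ}

/-- A discrete solution is adapted, up to null sets. -/
theorem exists_adapted (hu : M.IsDiscreteSolution T N v g β P W u₀ u) (hT : 0 < T) (hN : 0 < N)
    (hW : StronglyAdapted F W) (hv : Λ.IsConvectionField T v) (hu₀ : StronglyMeasurable[F 0] u₀)
    (hg : Continuous g) {L : ℝ≥0} (hβ : LipschitzWith L β) (hL : 4 * L * timeStep T N ≤ 1)
    {n : ℕ} (hn : n ≤ N) :
    ∃ w : Ω → Fin M.card → ℝ, Measurable[F (timeNode T N n)] w ∧ u n =ᵐ[P] w := by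
  induction n with
  | zero =>
    refine ⟨fun ω i => (M.cellArea i)⁻¹ * ∫ x in M.cell i, (u₀ ω).toL2 x, ?_, ?_⟩
    · rw [timeNode_zero]
      refine @measurable_pi_lambda _ _ _ (F 0) _ _ fun i => ?_
      -- The mean over a cell is a continuous functional on $H^1(\Lambda)$, so it inherits
      -- measurability from `u₀`.
      have hc : Continuous fun w : Λ.H1 => (M.cellArea i)⁻¹ * ∫ x in M.cell i, w.toL2 x := by
        have h1 : Continuous fun f : Λ.L2 => ∫ x in M.cell i, f x := by
          have h2 : ∀ f : Λ.L2, ∫ x in M.cell i, f x =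
              ⟪(indicatorConstLp 2 (M.cell_isOpen i).measurableSet
                (measure_ne_top Λ.measure _) (1 : ℝ) : Λ.L2), f⟫ := by
            intro f
            rw [L2.inner_indicatorConstLp_one,
              Measure.restrict_restrict (M.cell_isOpen i).measurableSet,
              inter_eq_left.2 (M.cell_subset i)]
          simp only [h2]
          fun_prop
        exact continuous_const.mul (h1.comp continuous_toL2)
      exact (hc.comp_stronglyMeasurable hu₀).measurable
    · filter_upwards [hu.initial] with ω hω
      exact funext hω
  | succ n ih =>
    obtain ⟨w, hw, huw⟩ := ih (Nat.le_of_succ_le hn)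
    obtain ⟨G, hG, hGu⟩ := M.exists_solution_map hT hN hn hv g hβ hL
    refine ⟨fun ω => G fun i => w ω i + g (w ω i) *
      (W (timeNode T N (n + 1)) ω - W (timeNode T N n) ω), ?_, ?_⟩
    · have hmono := F.mono (timeNode_mono T N n.le_succ)
      refine hG.measurable.comp (@measurable_pi_lambda _ _ _ (F _) _ _ fun i => ?_)
      have h1 : Measurable[F (timeNode T N (n + 1))] fun ω => w ω i :=
        (measurable_pi_apply i).comp (hw.mono hmono le_rfl)
      have h2 : Measurable[F (timeNode T N (n + 1))] (W (timeNode T N (n + 1))) :=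
        (hW _).measurable
      have h3 : Measurable[F (timeNode T N (n + 1))] (W (timeNode T N n)) :=
        (hW _).measurable.mono hmono le_rfl
      exact h1.add ((hg.measurable.comp h1).mul (h2.sub h3))
    · filter_upwards [hu.step n hn, huw] with ω h1 h2
      rw [hGu _ _ _ h1, h2]

/-- The expected energy inequality for one step. -/
theorem energy_expectation [IsProbabilityMeasure P] (hu : M.IsDiscreteSolution T N v g β P W u₀ u) (hT : 0 < T) (hN : 0 < N)
    (hW : IsBrownianMotionWrt F P W) (hv : Λ.IsConvectionField T v)
    (hu₀ : StronglyMeasurable[F 0] u₀) {Lg : ℝ≥0} (hg : LipschitzWith Lg g) {L : ℝ≥0}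
    (hβ : LipschitzWith L β) (hβ0 : β 0 = 0) (hL : 4 * L * timeStep T N ≤ 1) {C : ℝ}
    (hC : ∀ w : Fin M.card → ℝ, M.normSq (fun i => g (w i)) ≤ C * (1 + M.normSq w))
    {n : ℕ} (hn : n < N) (hint : Integrable (fun ω => M.normSq (u n ω)) P) :
    Integrable (fun ω => M.normSq (u (n + 1) ω)) P ∧
    Integrable (fun ω => M.normSq (u (n + 1) ω - u n ω)) P ∧
    Integrable (fun ω => M.seminormSq (u (n + 1) ω)) P ∧
    (1 - 2 * L * timeStep T N) * ∫ ω, M.normSq (u (n + 1) ω) ∂P +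
      1 / 2 * ∫ ω, M.normSq (u (n + 1) ω - u n ω) ∂P +
      2 * timeStep T N * ∫ ω, M.seminormSq (u (n + 1) ω) ∂P ≤
      ∫ ω, M.normSq (u n ω) ∂P +
        2 * timeStep T N * C * (1 + ∫ ω, M.normSq (u n ω) ∂P) := by
  have hpos := timeStep_pos hT hN
  -- `u n` itself need not be measurable; independence of the increment is applied to its adapted
  -- version `w`.
  obtain ⟨w, hwm, huw⟩ := hu.exists_adapted hT hN hW.adapted hv hu₀ hg.continuous hβ hL hn.le
  obtain ⟨z, hzm, huz⟩ := hu.exists_adapted hT hN hW.adapted hv hu₀ hg.continuous hβ hL hn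
  have hwm' := hwm.mono (F.le _) le_rfl
  have hzm' := hzm.mono (F.le _) le_rfl
  have hmn : Measurable M.normSq := continuous_normSq.measurable
  have hms : Measurable M.seminormSq := continuous_seminormSq.measurable
  have hum : AEMeasurable (u n) P := ⟨w, hwm', huw⟩
  have hum' : AEMeasurable (u (n + 1)) P := ⟨z, hzm', huz⟩
  have hst := timeNode_mono T N n.le_succ
  set s := timeNode T N n
  set t := timeNode T N (n + 1)
  have hwi : Integrable (fun ω => M.normSq (w ω)) P :=
    hint.congr (huw.mono fun ω h => by simp only [h])
  have hgc : Continuous fun w : Fin M.card → ℝ => fun i => g (w i) :=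
    continuous_pi fun i => hg.continuous.comp (continuous_apply i)
  have hX2m : Measurable[F s] fun ω => M.normSq fun i => g (w ω i) :=
    (continuous_normSq.comp hgc).measurable.comp hwm
  have hX2i : Integrable (fun ω => M.normSq fun i => g (w ω i)) P := by
    refine Integrable.mono' (((integrable_const 1).add hwi).const_mul C)
      (hX2m.mono (F.le _) le_rfl).aestronglyMeasurable (Eventually.of_forall fun ω => ?_)
    rw [Real.norm_of_nonneg (normSq_nonneg _)]
    exact hC (w ω)
  have hic : Continuous fun w : Fin M.card → ℝ => M.gridInner (fun i => g (w i)) w := by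
    unfold gridInner
    have := hg.continuous
    fun_prop
  have hX1m : Measurable[F s] fun ω => M.gridInner (fun i => g (w ω i)) (w ω) :=
    hic.measurable.comp hwm
  have hX1i : Integrable (fun ω => M.gridInner (fun i => g (w ω i)) (w ω)) P := by
    refine Integrable.mono' (hX2i.add hwi)
      (hX1m.mono (F.le _) le_rfl).aestronglyMeasurable (Eventually.of_forall fun ω => ?_)
    have h1 := two_mul_gridInner_le (M := M) (fun i => g (w ω i)) (w ω) one_pos
    have h2 := two_mul_gridInner_le (M := M) (fun i => -g (w ω i)) (w ω) one_pos
    have h3 : M.gridInner (fun i => -g (w ω i)) (w ω) = -M.gridInner (fun i => g (w ω i)) (w ω) := by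
      simp [gridInner]
    have h4 : M.normSq (fun i => -g (w ω i)) = M.normSq fun i => g (w ω i) := by
      simp [normSq]
    rw [h3, h4] at h2
    have h5 := normSq_nonneg (M := M) fun i => g (w ω i)
    have h6 := normSq_nonneg (M := M) (w ω)
    rw [inv_one, one_mul, one_mul] at h1 h2
    rw [Real.norm_eq_abs, abs_le, Pi.add_apply]
    constructor <;> linarith
  -- The term linear in the increment has mean zero; in the quadratic one $(\Delta W)^2$ is replaced
  -- by $\Delta t$.
  obtain ⟨hY1i, hY1⟩ := hW.integrable_increment_mul hst hX1m hX1i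
  obtain ⟨hY2i, hY2⟩ := hW.integrable_increment_sq_mul hst hX2m hX2i
  set R : Ω → ℝ := fun ω => M.normSq (w ω) +
    2 * ((W t ω - W s ω) * M.gridInner (fun i => g (w ω i)) (w ω)) +
    2 * ((W t ω - W s ω) ^ 2 * M.normSq fun i => g (w ω i)) with hR
  have hRi : Integrable R P := (hwi.add (hY1i.const_mul 2)).add (hY2i.const_mul 2)
  have hRint : ∫ ω, R ω ∂P = ∫ ω, M.normSq (u n ω) ∂P +
      2 * (timeStep T N * ∫ ω, M.normSq (fun i => g (w ω i)) ∂P) := by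
    have hA : Integrable (fun ω => M.normSq (w ω) +
        2 * ((W t ω - W s ω) * M.gridInner (fun i => g (w ω i)) (w ω))) P :=
      hwi.add (hY1i.const_mul 2)
    simp only [hR]
    rw [integral_add hA (hY2i.const_mul 2),
      integral_add hwi (hY1i.const_mul 2), integral_const_mul, integral_const_mul, hY1, hY2,
      timeNode_succ_sub, mul_zero, add_zero]
    congr 1
    exact integral_congr_ae (huw.mono fun ω h => by simp only [h])
  have hX2le : ∫ ω, M.normSq (fun i => g (w ω i)) ∂P ≤ C * (1 + ∫ ω, M.normSq (u n ω) ∂P) := by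
    have h1 : ∫ ω, M.normSq (u n ω) ∂P = ∫ ω, M.normSq (w ω) ∂P :=
      integral_congr_ae (huw.mono fun ω h => by simp only [h])
    calc ∫ ω, M.normSq (fun i => g (w ω i)) ∂P ≤ ∫ ω, C * (1 + M.normSq (w ω)) ∂P :=
          integral_mono hX2i (((integrable_const 1).add hwi).const_mul C) fun ω => hC (w ω)
      _ = C * (1 + ∫ ω, M.normSq (u n ω) ∂P) := by
          rw [integral_const_mul, integral_add (integrable_const 1) hwi, h1]
          simp
  have hpt : ∀ᵐ ω ∂P, (1 - 2 * L * timeStep T N) * M.normSq (u (n + 1) ω) +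
      1 / 2 * M.normSq (u (n + 1) ω - u n ω) +
      2 * timeStep T N * M.seminormSq (u (n + 1) ω) ≤ R ω := by
    filter_upwards [hu.step n hn, huw] with ω h1 h2
    have := energy_step hT hN hn hv hβ hβ0 h1
    rw [h2] at this ⊢
    exact this
  have hnn1 : ∀ ω, 0 ≤ M.normSq (u (n + 1) ω) := fun ω => normSq_nonneg _
  have hnn2 : ∀ ω, 0 ≤ M.normSq (u (n + 1) ω - u n ω) := fun ω => normSq_nonneg _
  have hnn3 : ∀ ω, 0 ≤ M.seminormSq (u (n + 1) ω) := fun ω => seminormSq_nonneg _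
  -- The factor $1-2L\Delta t$ is at least one half, so `2 * R` dominates.
  have hi1 : Integrable (fun ω => M.normSq (u (n + 1) ω)) P := by
    refine Integrable.mono' (hRi.const_mul 2) (hmn.comp_aemeasurable hum').aestronglyMeasurable ?_
    filter_upwards [hpt] with ω h
    rw [Real.norm_of_nonneg (hnn1 ω)]
    have := mul_nonneg hpos.le (hnn3 ω)
    have := mul_le_mul_of_nonneg_right hL (hnn1 ω)
    nlinarith [hnn1 ω, hnn2 ω]
  have hi2 : Integrable (fun ω => M.normSq (u (n + 1) ω - u n ω)) P := by
    refine Integrable.mono' (hRi.const_mul 2)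
      (hmn.comp_aemeasurable (hum'.sub hum)).aestronglyMeasurable ?_
    filter_upwards [hpt] with ω h
    rw [Real.norm_of_nonneg (hnn2 ω)]
    have := mul_nonneg hpos.le (hnn3 ω)
    have := mul_le_mul_of_nonneg_right hL (hnn1 ω)
    nlinarith [hnn1 ω, hnn2 ω]
  have hi3 : Integrable (fun ω => M.seminormSq (u (n + 1) ω)) P := by
    refine Integrable.mono' (hRi.const_mul (2 * timeStep T N)⁻¹)
      (hms.comp_aemeasurable hum').aestronglyMeasurable ?_
    filter_upwards [hpt] with ω h
    rw [Real.norm_of_nonneg (hnn3 ω), inv_mul_eq_div, le_div_iff₀ (by positivity)]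
    have := mul_le_mul_of_nonneg_right hL (hnn1 ω)
    nlinarith [hnn1 ω, hnn2 ω]
  refine ⟨hi1, hi2, hi3, ?_⟩
  have hA : Integrable (fun ω => (1 - 2 * L * timeStep T N) * M.normSq (u (n + 1) ω) +
      1 / 2 * M.normSq (u (n + 1) ω - u n ω)) P := (hi1.const_mul _).add (hi2.const_mul _)
  have hle := integral_mono_ae (f := fun ω => (1 - 2 * L * timeStep T N) * M.normSq (u (n + 1) ω) +
      1 / 2 * M.normSq (u (n + 1) ω - u n ω) + 2 * timeStep T N * M.seminormSq (u (n + 1) ω))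
    (hA.add (hi3.const_mul _)) hRi hpt
  rw [integral_add hA (hi3.const_mul _),
    integral_add (hi1.const_mul _) (hi2.const_mul _), integral_const_mul, integral_const_mul,
    integral_const_mul, hRint] at hle
  refine hle.trans ?_
  have := mul_le_mul_of_nonneg_left hX2le hpos.le
  linarith

end IsDiscreteSolution

end AdmissibleMesh

/-! ### Grönwall and the a priori estimates. -/

/-- A discrete Grönwall argument. -/
theorem discrete_energy_bound {N : ℕ} {E D S : ℕ → ℝ} {L C τ T e : ℝ} (hL : 0 ≤ L) (hC : 0 ≤ C)
    (hτ : 0 < τ) (hLτ : 4 * L * τ ≤ 1) (hT : N * τ = T) (hE : ∀ n, 0 ≤ E n) (hD : ∀ n, 0 ≤ D n)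
    (hS : ∀ n, 0 ≤ S n) (h0 : E 0 ≤ e)
    (h : ∀ n < N, (1 - 2 * L * τ) * E (n + 1) + 1 / 2 * D n + 2 * τ * S n ≤
      E n + 2 * τ * C * (1 + E n)) :
    (∀ n ≤ N, E n ≤ Real.exp ((4 * L + 4 * C) * T) * (1 + e)) ∧
      1 / 2 * ∑ n ∈ Finset.range N, D n + 2 * (τ * ∑ n ∈ Finset.range N, S n) ≤
        e + T * (2 * L + 2 * C) * (1 + Real.exp ((4 * L + 4 * C) * T) * (1 + e)) := by
  have he : 0 ≤ e := (hE 0).trans h0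
  set c := 4 * L + 4 * C with hc
  have hc0 : 0 ≤ c := by positivity
  have hLτ0 : 0 ≤ L * τ := by positivity
  have hCτ0 : 0 ≤ C * τ := by positivity
  have hstep : ∀ n < N, 1 + E (n + 1) ≤ Real.exp (c * τ) * (1 + E n) := by
    intro n hn
    have h1 := h n hn
    have h2 : (1 - 2 * L * τ) * E (n + 1) ≤ E n + 2 * τ * C * (1 + E n) := by
      have := hD n
      have := mul_nonneg hτ.le (hS n)
      linarith
    -- $1+4x\ge(1-2x)^{-1}$ for $0\le x\le\frac14$, here with $x=L\tau$.
    have h3 : E (n + 1) ≤ (1 + 4 * L * τ) * ((1 - 2 * L * τ) * E (n + 1)) := by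
      have : 1 ≤ (1 + 4 * L * τ) * (1 - 2 * L * τ) := by nlinarith
      have := mul_le_mul_of_nonneg_right this (hE (n + 1))
      linarith
    have h4 : E (n + 1) ≤ (1 + 4 * L * τ) * (E n + 2 * τ * C * (1 + E n)) :=
      h3.trans (mul_le_mul_of_nonneg_left h2 (by positivity))
    have h5 : c * τ + 1 ≤ Real.exp (c * τ) := Real.add_one_le_exp _
    have h6 := mul_le_mul_of_nonneg_right h5 (by linarith [hE n] : 0 ≤ 1 + E n)
    have h7 : 4 * L * τ * (2 * τ * C * (1 + E n)) ≤ 2 * τ * C * (1 + E n) :=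
      mul_le_of_le_one_left (mul_nonneg (by positivity) (by linarith [hE n])) hLτ
    have h8 : c * τ = 4 * (L * τ) + 4 * (C * τ) := by rw [hc]; ring
    rw [h8] at h6
    rw [h8]
    nlinarith
  have hbound : ∀ n ≤ N, 1 + E n ≤ Real.exp (c * τ) ^ n * (1 + e) := by
    intro n
    induction n with
    | zero => intro _; simpa using h0
    | succ n ih =>
      intro hn
      have h1 := mul_le_mul_of_nonneg_left (ih (Nat.le_of_succ_le hn)) (Real.exp_pos (c * τ)).le
      refine (hstep n hn).trans (h1.trans (le_of_eq ?_))
      ring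
  have hexp : ∀ n ≤ N, Real.exp (c * τ) ^ n ≤ Real.exp (c * T) := by
    intro n hn
    rw [← Real.exp_nat_mul]
    refine Real.exp_le_exp.2 ?_
    have : (n : ℝ) ≤ N := Nat.cast_le.2 hn
    have := mul_le_mul_of_nonneg_right this (mul_nonneg hc0 hτ.le)
    rw [← hT]
    linarith
  have hEb : ∀ n ≤ N, E n ≤ Real.exp (c * T) * (1 + e) := fun n hn => by
    have := (hbound n hn).trans (mul_le_mul_of_nonneg_right (hexp n hn) (by linarith))
    linarith
  refine ⟨hEb, ?_⟩
  set B := Real.exp (c * T) * (1 + e)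
  -- Second pass: with $E_n\le B$ known, the inequality telescopes, and the terms $2L\tau E_{n+1}$
  -- and $2\tau C(1+E_n)$ cost at most $\tau(2L+2C)(1+B)$ per step.
  have hsum : ∀ n ≤ N, 1 / 2 * ∑ k ∈ Finset.range n, D k + 2 * (τ * ∑ k ∈ Finset.range n, S k) ≤
      e - E n + n * (τ * ((2 * L + 2 * C) * (1 + B))) := by
    intro n
    induction n with
    | zero => intro _; simpa using h0
    | succ n ih =>
      intro hn
      have h1 := ih (Nat.le_of_succ_le hn)
      have h2 := h n hn
      have h3 := mul_le_mul_of_nonneg_left (hEb (n + 1) hn) hLτ0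
      have h4 := mul_le_mul_of_nonneg_left (hEb n (Nat.le_of_succ_le hn)) hCτ0
      rw [Finset.sum_range_succ, Finset.sum_range_succ]
      push_cast
      nlinarith
  have h1 := hsum N le_rfl
  have h2 : (N : ℝ) * (τ * ((2 * L + 2 * C) * (1 + B))) = T * (2 * L + 2 * C) * (1 + B) := by
    rw [← hT]; ring
  rw [h2] at h1
  linarith [hE N]

namespace AdmissibleMesh.IsDiscreteSolution

variable {Ω : Type*} [mΩ : MeasurableSpace Ω] {P : Measure Ω}
  {F : Filtration ℝ≥0 mΩ} {W : ℝ≥0 → Ω → ℝ} {Λ : PolygonalDomain} {T : ℝ≥0}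
  {v : ℝ → Plane → Plane} {g β : ℝ → ℝ} {u₀ : Ω → Λ.H1}

theorem integrable_initial {M : AdmissibleMesh Λ} {N : ℕ} {u : ℕ → Ω → Fin M.card → ℝ}
    (hu : M.IsDiscreteSolution T N v g β P W u₀ u) (hm : AEMeasurable (u 0) P)
    (hu₀ : MemLp u₀ 2 P) :
    Integrable (fun ω => M.normSq (u 0 ω)) P ∧
      ∫ ω, M.normSq (u 0 ω) ∂P ≤ ∫ ω, ‖u₀ ω‖ ^ 2 ∂P := by
  have hi : Integrable (fun ω => ‖u₀ ω‖ ^ 2) P := hu₀.integrable_norm_pow (by norm_num)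
  have hle : ∀ᵐ ω ∂P, M.normSq (u 0 ω) ≤ ‖u₀ ω‖ ^ 2 := by
    filter_upwards [hu.initial] with ω hω
    refine (normSq_average_le _ _ hω).trans ?_
    gcongr
    exact norm_toL2_le _
  have hi' : Integrable (fun ω => M.normSq (u 0 ω)) P := by
    refine Integrable.mono' hi
      (continuous_normSq.measurable.comp_aemeasurable hm).aestronglyMeasurable ?_
    filter_upwards [hle] with ω h
    rwa [Real.norm_of_nonneg (normSq_nonneg _)]
  exact ⟨hi', integral_mono_ae hi' hi hle⟩

/-- The a priori estimates for the scheme. -/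
theorem exists_apriori_bound [IsProbabilityMeasure P] (hT : 0 < T) (hW : IsBrownianMotionWrt F P W)
    (hv : Λ.IsConvectionField T v) (hu₀m : StronglyMeasurable[F 0] u₀) (hu₀ : MemLp u₀ 2 P)
    {Lg : ℝ≥0} (hg : LipschitzWith Lg g) {L : ℝ≥0} (hβ : LipschitzWith L β) (hβ0 : β 0 = 0) :
    ∃ B : ℝ, ∀ (M : AdmissibleMesh Λ) (N : ℕ) (u : ℕ → Ω → Fin M.card → ℝ), 0 < N →
      4 * L * timeStep T N ≤ 1 → M.IsDiscreteSolution T N v g β P W u₀ u →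
      (∀ n ≤ N, Integrable (fun ω => M.normSq (u n ω)) P ∧ ∫ ω, M.normSq (u n ω) ∂P ≤ B) ∧
      (∀ n < N, Integrable (fun ω => M.normSq (u (n + 1) ω - u n ω)) P) ∧
      (∀ n < N, Integrable (fun ω => M.seminormSq (u (n + 1) ω)) P) ∧
      ∑ n ∈ Finset.range N, ∫ ω, M.normSq (u (n + 1) ω - u n ω) ∂P ≤ B ∧
      timeStep T N * ∑ n ∈ Finset.range N, ∫ ω, M.seminormSq (u (n + 1) ω) ∂P ≤ B := by
  set C : ℝ := 2 * g 0 ^ 2 * volume.real (closure Λ.carrier) + 2 * Lg ^ 2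
  set e : ℝ := ∫ ω, ‖u₀ ω‖ ^ 2 ∂P
  have hC : 0 ≤ C := by positivity
  have he : 0 ≤ e := integral_nonneg fun ω => by positivity
  set X := Real.exp ((4 * L + 4 * C) * T) * (1 + e)
  have hX : 0 ≤ X := by positivity
  set Y := e + T * (2 * L + 2 * C) * (1 + X)
  have hY : 0 ≤ Y := by positivity
  -- `X` bounds the energies; the squared increments carry the factor one half, hence `2 * Y`.
  refine ⟨X + 2 * Y, fun M N u hN hL hu => ?_⟩
  have hpos := timeStep_pos hT hN
  obtain ⟨w, hwm, huw⟩ := hu.exists_adapted hT hN hW.adapted hv hu₀m hg.continuous hβ hL (Nat.zero_le N)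
  obtain ⟨hi0, he0⟩ := hu.integrable_initial ⟨w, hwm.mono (F.le _) le_rfl, huw⟩ hu₀
  have hstep := fun n (hn : n < N) => hu.energy_expectation hT hN hW hv hu₀m hg hβ hβ0 hL
    (fun w => normSq_growth hg w) hn
  have hint : ∀ n ≤ N, Integrable (fun ω => M.normSq (u n ω)) P := by
    intro n
    induction n with
    | zero => exact fun _ => hi0
    | succ n ih => exact fun hn => (hstep n hn (ih (Nat.le_of_succ_le hn))).1
  obtain ⟨h1, h2⟩ := discrete_energy_bound (N := N) (E := fun n => ∫ ω, M.normSq (u n ω) ∂P)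
    (D := fun n => ∫ ω, M.normSq (u (n + 1) ω - u n ω) ∂P)
    (S := fun n => ∫ ω, M.seminormSq (u (n + 1) ω) ∂P) L.coe_nonneg hC hpos hL (mul_timeStep hN)
    (fun n => integral_nonneg fun ω => normSq_nonneg _)
    (fun n => integral_nonneg fun ω => normSq_nonneg _)
    (fun n => integral_nonneg fun ω => seminormSq_nonneg _) he0
    (fun n hn => (hstep n hn (hint n hn.le)).2.2.2)
  have hD : 0 ≤ ∑ n ∈ Finset.range N, ∫ ω, M.normSq (u (n + 1) ω - u n ω) ∂P :=
    Finset.sum_nonneg fun n _ => integral_nonneg fun ω => normSq_nonneg _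
  have hS : 0 ≤ timeStep T N * ∑ n ∈ Finset.range N, ∫ ω, M.seminormSq (u (n + 1) ω) ∂P :=
    mul_nonneg hpos.le
      (Finset.sum_nonneg fun n _ => integral_nonneg fun ω => seminormSq_nonneg _)
  refine ⟨fun n hn => ⟨hint n hn, ?_⟩, fun n hn => (hstep n hn (hint n hn.le)).2.1,
    fun n hn => (hstep n hn (hint n hn.le)).2.2.1, ?_, ?_⟩
  · have := h1 n hn
    linarith
  · linarith
  · linarith

end AdmissibleMesh.IsDiscreteSolution

/-! ### Step functions in time as functions on `Ω × (0,T)` -/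

section StepFunction

variable {T : ℝ≥0} {N : ℕ}

theorem stepFunction_of_mem {X : Type*} [AddCommMonoid X] (a : ℕ → X) {n : ℕ} (hn : n < N) {t : ℝ}
    (ht : t ∈ Ico (timeNode T N n : ℝ) (timeNode T N (n + 1) : ℝ)) :
    stepFunction T N a t = a n := by
  unfold stepFunction
  rw [Finset.sum_eq_single_of_mem n (Finset.mem_range.2 hn), indicator_of_mem ht]
  intro m _ hmn
  refine indicator_of_notMem (fun hm => ?_) _
  rcases lt_or_gt_of_ne hmn with h | h
  · have : (timeNode T N (m + 1) : ℝ) ≤ timeNode T N n :=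
      NNReal.coe_le_coe.2 (timeNode_mono T N h)
    exact absurd (hm.2.trans_le (this.trans ht.1)) (lt_irrefl _)
  · have : (timeNode T N (n + 1) : ℝ) ≤ timeNode T N m :=
      NNReal.coe_le_coe.2 (timeNode_mono T N h)
    exact absurd (ht.2.trans_le (this.trans hm.1)) (lt_irrefl _)

theorem stepFunction_of_notMem {X : Type*} [AddCommMonoid X] (a : ℕ → X) {t : ℝ}
    (ht : ∀ n < N, t ∉ Ico (timeNode T N n : ℝ) (timeNode T N (n + 1) : ℝ)) :
    stepFunction T N a t = 0 :=
  Finset.sum_eq_zero fun n hn => indicator_of_notMem (ht n (Finset.mem_range.1 hn)) _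

/-- At any time at most one term of the sum is nonzero, so every map fixing zero commutes with it;
this is applied to the squared norm. -/
theorem stepFunction_map {X Y : Type*} [AddCommMonoid X] [AddCommMonoid Y] {f : X → Y}
    (hf : f 0 = 0) (a : ℕ → X) (t : ℝ) :
    f (stepFunction T N a t) = stepFunction T N (fun n => f (a n)) t := by
  by_cases h : ∃ n < N, t ∈ Ico (timeNode T N n : ℝ) (timeNode T N (n + 1) : ℝ)
  · obtain ⟨n, hn, ht⟩ := h
    rw [stepFunction_of_mem a hn ht, stepFunction_of_mem _ hn ht]
  · push Not at h
    rw [stepFunction_of_notMem a h, stepFunction_of_notMem _ h, hf]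

theorem timeStep_nonneg (T : ℝ≥0) (N : ℕ) : 0 ≤ timeStep T N :=
  div_nonneg T.coe_nonneg N.cast_nonneg

theorem timeNode_self (hN : 0 < N) : timeNode T N N = T := by
  have : (N : ℝ≥0) ≠ 0 := by positivity
  rw [timeNode]
  field_simp

variable {Ω : Type*} [MeasurableSpace Ω] {P : Measure Ω}

theorem aestronglyMeasurable_stepFunction {H : Type*} [NormedAddCommGroup H] {a : ℕ → Ω → H}
    (ha : ∀ n < N, AEStronglyMeasurable (a n) P) :
    AEStronglyMeasurable (fun p : Ω × ℝ => stepFunction T N (fun n => a n p.1) p.2)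
      (timeProduct P T) := by
  unfold stepFunction
  refine Finset.aestronglyMeasurable_fun_sum _ fun n hn => ?_
  have h := ((ha n (Finset.mem_range.1 hn)).comp_fst (ν := volume.restrict (Ioo 0 (T : ℝ)))).indicator
    (measurable_snd (measurableSet_Ico (a := (timeNode T N n : ℝ)) (b := timeNode T N (n + 1))))
  exact h

theorem integral_stepFunction [IsProbabilityMeasure P] {a : ℕ → Ω → ℝ} (hN : 0 < N) (ha : ∀ n < N, Integrable (a n) P) :
    Integrable (fun p : Ω × ℝ => stepFunction T N (fun n => a n p.1) p.2) (timeProduct P T) ∧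
      ∫ p, stepFunction T N (fun n => a n p.1) p.2 ∂timeProduct P T =
        timeStep T N * ∑ n ∈ Finset.range N, ∫ ω, a n ω ∂P := by
  set I : ℕ → Set ℝ := fun n => Ico (timeNode T N n : ℝ) (timeNode T N (n + 1) : ℝ) with hI
  have hterm : ∀ n (p : Ω × ℝ), (I n).indicator (fun _ => a n p.1) p.2 =
      a n p.1 * (I n).indicator (fun _ => (1 : ℝ)) p.2 := by
    intro n p
    by_cases h : p.2 ∈ I n <;> simp [h]
  have hind : ∀ n, Integrable ((I n).indicator fun _ => (1 : ℝ)) (volume.restrict (Ioo 0 (T : ℝ))) :=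
    fun n => (integrable_const _).indicator measurableSet_Ico
  have hi : ∀ n ∈ Finset.range N,
      Integrable (fun p : Ω × ℝ => (I n).indicator (fun _ => a n p.1) p.2) (timeProduct P T) := by
    intro n hn
    simp only [hterm]
    exact (ha n (Finset.mem_range.1 hn)).mul_prod (hind n)
  refine ⟨integrable_finsetSum _ hi, ?_⟩
  unfold stepFunction
  rw [integral_finsetSum _ hi, Finset.mul_sum]
  refine Finset.sum_congr rfl fun n hn => ?_
  have hn' := Finset.mem_range.1 hn
  have hlen : ∫ t in Ioo 0 (T : ℝ), (I n).indicator (fun _ => (1 : ℝ)) t = timeStep T N := by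
    have hsub : I n ⊆ Ico 0 (T : ℝ) := by
      refine Ico_subset_Ico (NNReal.coe_nonneg _) ?_
      have := timeNode_mono T N (Nat.succ_le_of_lt hn')
      rw [timeNode_self hN] at this
      exact NNReal.coe_le_coe.2 this
    rw [Measure.restrict_congr_set Ioo_ae_eq_Ico, integral_indicator measurableSet_Ico,
      Measure.restrict_restrict measurableSet_Ico, inter_eq_left.2 hsub]
    have := timeNode_succ_sub T N n
    have h := timeStep_nonneg T N
    simp [hI, this, h]
  have := integral_prod_mul (μ := P) (ν := volume.restrict (Ioo 0 (T : ℝ))) (a n)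
    ((I n).indicator fun _ => (1 : ℝ))
  simp only [hterm]
  rw [timeProduct, this, hlen, mul_comm]

theorem memLp_stepFunction [IsProbabilityMeasure P] {H : Type*} [NormedAddCommGroup H] {a : ℕ → Ω → H} (hN : 0 < N)
    (hm : ∀ n < N, AEStronglyMeasurable (a n) P)
    (hi : ∀ n < N, Integrable (fun ω => ‖a n ω‖ ^ 2) P) :
    MemLp (fun p : Ω × ℝ => stepFunction T N (fun n => a n p.1) p.2) 2 (timeProduct P T) ∧
      ∫ p, ‖stepFunction T N (fun n => a n p.1) p.2‖ ^ 2 ∂timeProduct P T =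
        timeStep T N * ∑ n ∈ Finset.range N, ∫ ω, ‖a n ω‖ ^ 2 ∂P := by
  obtain ⟨h1, h2⟩ := integral_stepFunction (T := T) hN hi
  have hmap : ∀ p : Ω × ℝ, ‖stepFunction T N (fun n => a n p.1) p.2‖ ^ 2 =
      stepFunction T N (fun n => ‖a n p.1‖ ^ 2) p.2 := fun p =>
    stepFunction_map (f := fun x : H => ‖x‖ ^ 2) (by simp) (fun n => a n p.1) p.2
  refine ⟨(memLp_two_iff_integrable_sq_norm (aestronglyMeasurable_stepFunction hm)).2 ?_, ?_⟩
  · simpa only [hmap] using h1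
  · simpa only [hmap] using h2

end StepFunction

/-! ### Predictability -/

section Predictable

variable {Ω : Type*} {mΩ : MeasurableSpace Ω}

/-- The predictable σ-algebra, transported to `Ω × ℝ`. -/
@[reducible]
def predictableReal (F : Filtration ℝ≥0 mΩ) : MeasurableSpace (Ω × ℝ) :=
  F.predictable.comap fun p => (p.2.toNNReal, p.1)

theorem predictableReal_le (F : Filtration ℝ≥0 mΩ) :
    predictableReal F ≤ (inferInstance : MeasurableSpace (Ω × ℝ)) := by
  have h1 : F.predictable ≤ (inferInstance : MeasurableSpace (ℝ≥0 × Ω)) :=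
    measurableSpace_le_predictable_of_measurableSet
      (fun A hA => (measurableSet_singleton _).prod (F.le _ _ hA))
      fun i A hA => measurableSet_Ioi.prod (F.le _ _ hA)
  have h2 : Measurable fun p : Ω × ℝ => (p.2.toNNReal, p.1) := by fun_prop
  exact (MeasurableSpace.comap_mono h1).trans h2.comap_le

/-- `Real.toNNReal` inverts the coercion, so pulling a predictable set back to `Ω × ℝ` and then to
`ℝ≥0 × Ω` returns it. -/
theorem isStronglyPredictable_of_predictableReal {F : Filtration ℝ≥0 mΩ} {E : Type*}
    [TopologicalSpace E] {f : Ω × ℝ → E} (hf : StronglyMeasurable[predictableReal F] f) :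
    IsStronglyPredictable F (fun (t : ℝ≥0) ω => f (ω, (t : ℝ))) := by
  have hm : @Measurable _ _ F.predictable (predictableReal F)
      fun p : ℝ≥0 × Ω => (p.2, (p.1 : ℝ)) := by
    rintro _ ⟨s, hs, rfl⟩
    have : (fun p : ℝ≥0 × Ω => (p.2, (p.1 : ℝ))) ⁻¹'
        ((fun p : Ω × ℝ => (p.2.toNNReal, p.1)) ⁻¹' s) = s := by
      ext p
      simp
    rwa [this]
  exact hf.comp_measurable hm

/-- Reduces to the predictable rectangles `Ioc s t ×ˢ A` with `A` in `F s`; off the strip the value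
is 0, which accounts for the second set of the decomposition. -/
theorem measurable_indicator_Ioc_predictable {F : Filtration ℝ≥0 mΩ} {E : Type*} [Zero E]
    [MeasurableSpace E] {s t : ℝ≥0} {w : Ω → E} (hw : Measurable[F s] w) :
    Measurable[F.predictable] fun p : ℝ≥0 × Ω => (Ioc s t).indicator (fun _ => w p.2) p.1 := by
  classical
  intro B hB
  have h1 := measurableSet_predictable_Ioc_prod s t (hw hB)
  have h2 := measurableSet_predictable_Ioc_prod s t (𝓕 := F) (@MeasurableSet.univ _ (F s))
  have h : (fun p : ℝ≥0 × Ω => (Ioc s t).indicator (fun _ => w p.2) p.1) ⁻¹' B =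
      Ioc s t ×ˢ (w ⁻¹' B) ∪ ({_p | (0 : E) ∈ B} ∩ (Ioc s t ×ˢ univ)ᶜ) := by
    ext p
    by_cases hp : p.1 ∈ Ioc s t
    · simp only [mem_preimage, indicator_of_mem hp, mem_union, mem_prod, hp, mem_inter_iff,
        mem_compl_iff, mem_univ, true_and, not_true_eq_false, and_false, or_false]
    · simp only [mem_preimage, indicator_of_notMem hp, mem_union, mem_prod, hp, mem_inter_iff,
        mem_compl_iff, false_and, not_false_eq_true, and_true, false_or, mem_ofPred_eq]
  rw [h]
  exact @MeasurableSet.union _ F.predictable _ _ h1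
    (@MeasurableSet.inter _ F.predictable _ _ (@MeasurableSet.const _ F.predictable _)
      (@MeasurableSet.compl _ _ F.predictable h2))

/-- The left-in-time step function of an adapted sequence is predictable. -/
theorem aestronglyMeasurable_stepFunction_predictable {P : Measure Ω} [SFinite P]
    {F : Filtration ℝ≥0 mΩ} {T : ℝ≥0} {N : ℕ} {d : ℕ} {H : Type*} [AddCommMonoid H]
    [TopologicalSpace H]
    {c : (Fin d → ℝ) → H} (hc : Continuous c) (hc0 : c 0 = 0) {u w : ℕ → Ω → Fin d → ℝ}
    (hw : ∀ n < N, Measurable[F (timeNode T N n)] (w n)) (huw : ∀ n < N, u n =ᵐ[P] w n) :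
    AEStronglyMeasurable[predictableReal F]
      (fun p : Ω × ℝ => stepFunction T N (fun n => c (u n p.1)) p.2) (timeProduct P T) := by
  -- Predictable rectangles are open on the left, whereas the scheme uses `Ico`. The two differ only
  -- at the time nodes, a null set.
  set f : ℝ≥0 × Ω → Fin d → ℝ := fun p => ∑ n ∈ Finset.range N,
    (Ioc (timeNode T N n) (timeNode T N (n + 1))).indicator (fun _ => w n p.2) p.1 with hf
  have hfm : Measurable[F.predictable] f := Finset.measurable_fun_sum _ fun n hn =>
    measurable_indicator_Ioc_predictable (hw n (Finset.mem_range.1 hn))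
  have hfm' : @Measurable _ _ (predictableReal F) _ fun p : Ω × ℝ => f (p.2.toNNReal, p.1) :=
    hfm.comp (comap_measurable _)
  refine ⟨fun p => c (f (p.2.toNNReal, p.1)), hc.comp_stronglyMeasurable hfm'.stronglyMeasurable, ?_⟩
  have h1 : ∀ᵐ p ∂timeProduct P T, ∀ n < N, u n p.1 = w n p.1 := by
    have h : ∀ᵐ ω ∂P, ∀ n < N, u n ω = w n ω :=
      ae_all_iff.2 fun n => ae_all_iff.2 fun hn => huw n hn
    exact Measure.quasiMeasurePreserving_fst.ae h
  have h2 : ∀ᵐ p ∂timeProduct P T, 0 < p.2 ∧ ∀ n, p.2 ≠ (timeNode T N n : ℝ) := by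
    have h : ∀ᵐ t ∂volume.restrict (Ioo 0 (T : ℝ)), 0 < t ∧ ∀ n, t ≠ (timeNode T N n : ℝ) := by
      filter_upwards [ae_restrict_mem measurableSet_Ioo,
        ae_restrict_of_ae (ae_all_iff.2 fun n => Measure.ae_ne volume (timeNode T N n : ℝ))]
        with t h1 h2
      exact ⟨h1.1, h2⟩
    exact Measure.quasiMeasurePreserving_snd.ae h
  filter_upwards [h1, h2] with p hp hp'
  rw [← stepFunction_map hc0 (fun n => u n p.1) p.2]
  congr 1
  refine Finset.sum_congr rfl fun n hn => ?_
  simp only [hp n (Finset.mem_range.1 hn)]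
  have hiff : p.2 ∈ Ico (timeNode T N n : ℝ) (timeNode T N (n + 1) : ℝ) ↔
      p.2.toNNReal ∈ Ioc (timeNode T N n) (timeNode T N (n + 1)) := by
    rw [mem_Ico, mem_Ioc, Real.lt_toNNReal_iff_coe_lt, Real.toNNReal_le_iff_le_coe]
    constructor
    · exact fun h => ⟨lt_of_le_of_ne h.1 (hp'.2 n).symm, h.2.le⟩
    · exact fun h => ⟨h.1.le, lt_of_le_of_ne h.2 (hp'.2 (n + 1))⟩
  by_cases h : p.2 ∈ Ico (timeNode T N n : ℝ) (timeNode T N (n + 1) : ℝ)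
  · rw [indicator_of_mem h, indicator_of_mem (hiff.1 h)]
  · rw [indicator_of_notMem h, indicator_of_notMem (mt hiff.2 h)]

end Predictable

/-! ### Weak convergence in Hilbert spaces -/

section Weak

variable {H : Type*} [NormedAddCommGroup H] [InnerProductSpace ℝ H]

/-- Bounded sequences in a Hilbert space have weakly convergent subsequences. -/
theorem exists_subseq_tendsto_inner [CompleteSpace H] (x : ℕ → H) {C : ℝ} (hx : ∀ n, ‖x n‖ ≤ C) :
    ∃ φ : ℕ → ℕ, StrictMono φ ∧ ∃ y : H, ∀ z : H,
      Tendsto (fun k => ⟪x (φ k), z⟫) atTop (𝓝 ⟪y, z⟫) := by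
  -- Sequential compactness of the dual ball needs separability, so the argument takes place in the
  -- closed span of the sequence; general test vectors are projected onto it.
  set S := (Submodule.span ℝ (range x)).topologicalClosure with hS
  have hxS : ∀ n, x n ∈ S := fun n =>
    Submodule.le_topologicalClosure _ (Submodule.subset_span (mem_range_self n))
  have hsep : TopologicalSpace.SeparableSpace S := by
    have h : TopologicalSpace.IsSeparable (S : Set H) := by
      rw [hS, Submodule.topologicalClosure_coe]
      exact ((countable_range x).isSeparable.span (R := ℝ)).closure
    exact h.separableSpace
  have hcomp : CompleteSpace S :=
    (Submodule.isClosed_topologicalClosure _).completeSpace_coe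
  set l : ℕ → WeakDual ℝ S := fun n =>
    StrongDual.toWeakDual ((innerSL ℝ (x n)).comp S.subtypeL)
  obtain ⟨l', -, φ, hφ, hlim⟩ := WeakDual.isSeqCompact_closedBall ℝ S 0 C (x := l) (by
    intro n
    rw [mem_preimage, Metric.mem_closedBall, dist_zero_right]
    refine ContinuousLinearMap.opNorm_le_bound _ ((norm_nonneg _).trans (hx 0)) fun z => ?_
    refine (norm_inner_le_norm (x n) (z : H)).trans ?_
    exact mul_le_mul_of_nonneg_right (hx n) (norm_nonneg _))
  set y : S := (InnerProductSpace.toDual ℝ S).symm (WeakDual.toStrongDual l')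
  refine ⟨φ, hφ, y, fun z => ?_⟩
  have h1 : ∀ a : S, ⟪(a : H), z⟫ = ⟪a, S.orthogonalProjectionOnto z⟫ := fun a =>
    (S.inner_orthogonalProjectionOnto_eq_of_mem_left a z).symm
  rw [h1 y]
  have h2 := (WeakDual.eval_continuous (S.orthogonalProjectionOnto z)).continuousAt.tendsto.comp hlim
  have h3 : ⟪y, S.orthogonalProjectionOnto z⟫ = l' (S.orthogonalProjectionOnto z) :=
    InnerProductSpace.toDual_symm_apply
  rw [h3]
  refine h2.congr fun k => ?_
  exact (h1 ⟨x (φ k), hxS _⟩).symm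

theorem tendsto_toWeakSpace [CompleteSpace H] {x : ℕ → H} {y : H}
    (h : ∀ z : H, Tendsto (fun k => ⟪x k, z⟫) atTop (𝓝 ⟪y, z⟫)) :
    Tendsto (fun k => toWeakSpace ℝ H (x k)) atTop (𝓝 (toWeakSpace ℝ H y)) := by
  refine (WeakBilin.tendsto_iff_forall_eval_tendsto _
    (separatingDual_iff_injective.1 inferInstance)).2 fun l => ?_
  obtain ⟨z, rfl⟩ := (InnerProductSpace.toDual ℝ H).surjective l
  have : ∀ a : H, InnerProductSpace.toDual ℝ H z a = ⟪a, z⟫ := fun a => by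
    rw [InnerProductSpace.toDual_apply_apply, real_inner_comm]
  have h1 := h z
  simp only [← this] at h1
  exact h1

theorem tendsto_inner_of_tendsto_norm_sub {x x' : ℕ → H} {y : H}
    (h : ∀ z : H, Tendsto (fun k => ⟪x k, z⟫) atTop (𝓝 ⟪y, z⟫))
    (hx : Tendsto (fun k => ‖x' k - x k‖) atTop (𝓝 0)) (z : H) :
    Tendsto (fun k => ⟪x' k, z⟫) atTop (𝓝 ⟪y, z⟫) := by
  have h0 : Tendsto (fun k => ⟪x' k - x k, z⟫) atTop (𝓝 0) := by
    refine squeeze_zero_norm (fun k => norm_inner_le_norm (𝕜 := ℝ) (x' k - x k) z) ?_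
    simpa using hx.mul_const ‖z‖
  have := (h z).add h0
  rw [add_zero] at this
  refine this.congr fun k => ?_
  rw [← inner_add_left, add_sub_cancel]

/-- Such a subspace is its double orthogonal complement, and orthogonality to a fixed vector passes
to weak limits. -/
theorem mem_of_tendsto_inner {K : Submodule ℝ H} [K.HasOrthogonalProjection]
    {x : ℕ → H} {y : H} (hx : ∀ k, x k ∈ K)
    (h : ∀ z : H, Tendsto (fun k => ⟪x k, z⟫) atTop (𝓝 ⟪y, z⟫)) : y ∈ K := by
  rw [← Submodule.orthogonal_orthogonal K, Submodule.mem_orthogonal']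
  intro z hz
  refine tendsto_nhds_unique (h z) ?_
  simp only [Submodule.inner_right_of_mem_orthogonal (hx _) hz]
  exact tendsto_const_nhds

theorem tendsto_inner_map {H' : Type*} [NormedAddCommGroup H'] [InnerProductSpace ℝ H']
    [CompleteSpace H] [CompleteSpace H'] (A : H →L[ℝ] H') {x : ℕ → H} {y : H}
    (h : ∀ z : H, Tendsto (fun k => ⟪x k, z⟫) atTop (𝓝 ⟪y, z⟫)) (z : H') :
    Tendsto (fun k => ⟪A (x k), z⟫) atTop (𝓝 ⟪A y, z⟫) := by
  simp only [← ContinuousLinearMap.adjoint_inner_right]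
  exact h _

end Weak

section WeakL2

variable {X H H' : Type*} [mX : MeasurableSpace X] {μ : Measure X}
  [NormedAddCommGroup H] [InnerProductSpace ℝ H]
  [NormedAddCommGroup H'] [InnerProductSpace ℝ H']

theorem norm_toLp_sq {f : X → H} (hf : MemLp f 2 μ) : ‖hf.toLp f‖ ^ 2 = ∫ x, ‖f x‖ ^ 2 ∂μ := by
  rw [← real_inner_self_eq_norm_sq, L2.inner_def]
  refine integral_congr_ae ?_
  filter_upwards [hf.coeFn_toLp] with x hx
  rw [hx, real_inner_self_eq_norm_sq]

variable [CompleteSpace H] [CompleteSpace H']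

/-- A weak limit of sequences satisfying linear relations asymptotically satisfies them
pointwise. -/
theorem ae_forall_inner_add_inner_eq_zero [SecondCountableTopology H] [SecondCountableTopology H']
    {x : ℕ → Lp H 2 μ} {u : Lp H 2 μ} {y : ℕ → Lp H' 2 μ} {G : Lp H' 2 μ}
    (hx : ∀ z, Tendsto (fun k => ⟪x k, z⟫) atTop (𝓝 ⟪u, z⟫))
    (hy : ∀ z, Tendsto (fun k => ⟪y k, z⟫) atTop (𝓝 ⟪G, z⟫)) {S : Set (H × H')}
    (hS : ∀ s ∈ S, Tendsto (fun k => ∫ p, (⟪y k p, s.2⟫ + ⟪x k p, s.1⟫) ^ 2 ∂μ) atTop (𝓝 0)) :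
    ∀ᵐ p ∂μ, ∀ s ∈ S, ⟪G p, s.2⟫ + ⟪u p, s.1⟫ = 0 := by
  have key : ∀ s ∈ S, ∀ᵐ p ∂μ, ⟪G p, s.2⟫ + ⟪u p, s.1⟫ = 0 := by
    intro s hs
    set A := (innerSL ℝ s.1).compLpL 2 μ
    set A' := (innerSL ℝ s.2).compLpL 2 μ
    have hcoe : ∀ (a : Lp H 2 μ) (b : Lp H' 2 μ),
        (A' b + A a : Lp ℝ 2 μ) =ᵐ[μ] fun p => ⟪b p, s.2⟫ + ⟪a p, s.1⟫ := by
      intro a b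
      filter_upwards [Lp.coeFn_add (A' b) (A a), (innerSL ℝ s.1).coeFn_compLpL a,
        (innerSL ℝ s.2).coeFn_compLpL b] with p h1 h2 h3
      rw [h1, Pi.add_apply, h2, h3, innerSL_apply_apply, innerSL_apply_apply, real_inner_comm,
        real_inner_comm (a p)]
    have hw : ∀ z, Tendsto (fun k => ⟪A' (y k) + A (x k), z⟫) atTop (𝓝 ⟪A' G + A u, z⟫) := by
      intro z
      simp only [inner_add_left]
      exact (tendsto_inner_map A' hy z).add (tendsto_inner_map A hx z)
    have hn : Tendsto (fun k => ‖0 - (A' (y k) + A (x k))‖) atTop (𝓝 0) := by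
      have h := (hS s hs).sqrt
      rw [Real.sqrt_zero] at h
      refine h.congr fun k => ?_
      rw [zero_sub, norm_neg, ← Real.sqrt_sq (norm_nonneg (A' (y k) + A (x k))),
        ← real_inner_self_eq_norm_sq, L2.inner_def]
      congr 1
      refine integral_congr_ae ?_
      filter_upwards [hcoe (x k) (y k)] with p hp
      rw [hp, real_inner_self_eq_norm_sq, Real.norm_eq_abs, sq_abs]
    -- The weak limit `A' G + A u` is also the strong limit 0.
    have h0 : A' G + A u = 0 := by
      have h := tendsto_inner_of_tendsto_norm_sub (x' := fun _ => 0) hw hn (A' G + A u)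
      simp only [inner_zero_left] at h
      exact inner_self_eq_zero.1 (tendsto_nhds_unique tendsto_const_nhds h).symm
    have h1 := hcoe u G
    rw [h0] at h1
    filter_upwards [h1, Lp.coeFn_zero ℝ 2 μ] with p hp hp'
    rw [← hp, hp', Pi.zero_apply]
  -- The exceptional null set depends on `s`; a countable dense subset of `S` and continuity in `s`
  -- give a single one.
  obtain ⟨D, hDS, hDc, hD⟩ :=
    (TopologicalSpace.IsSeparable.of_separableSpace S).exists_countable_dense_subset
  filter_upwards [(ae_ball_iff hDc).2 fun s hs => key s (hDS hs)] with p hp s hs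
  have hcl : IsClosed {s : H × H' | ⟪G p, s.2⟫ + ⟪u p, s.1⟫ = 0} :=
    isClosed_eq (by fun_prop) continuous_const
  exact closure_minimal hp hcl (hD hs)

end WeakL2

/-- Weak limits of functions measurable with respect to a sub-σ-algebra are measurable with respect
to it. -/
theorem aestronglyMeasurable_of_tendsto_inner {X H : Type*} {m mX : MeasurableSpace X} {μ : Measure X}
    [NormedAddCommGroup H] [InnerProductSpace ℝ H] [CompleteSpace H] (hm : m ≤ mX)
    {x : ℕ → Lp H 2 μ} {u : Lp H 2 μ} (hx : ∀ k, AEStronglyMeasurable[m] (x k) μ)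
    (h : ∀ z, Tendsto (fun k => ⟪x k, z⟫) atTop (𝓝 ⟪u, z⟫)) : AEStronglyMeasurable[m] u μ := by
  have : Fact (m ≤ mX) := ⟨hm⟩
  exact mem_lpMeas_iff_aestronglyMeasurable.1 (mem_of_tendsto_inner (K := lpMeas H ℝ m 2 μ)
    (fun k => mem_lpMeas_iff_aestronglyMeasurable.2 (hx k)) h)

/-! ### The Sobolev space -/

namespace PolygonalDomain

variable {Λ : PolygonalDomain}

/-- An intersection of zero sets of continuous functionals. Closedness gives completeness, and with
it the orthogonal projection onto $H^1(\Lambda)$. -/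
theorem isClosed_sobolevGraph : IsClosed (Λ.sobolevGraph : Set (WithLp 2 (Λ.L2 × Λ.L2Vec))) := by
  have : (Λ.sobolevGraph : Set (WithLp 2 (Λ.L2 × Λ.L2Vec))) =
      ⋂ (φ : Λ.TestFunction) (i : Fin 2), {w | ⟪w.snd, φ.vecLp i⟫ + ⟪w.fst, φ.partialLp i⟫ = 0} := by
    ext w
    simp only [mem_iInter]
    exact isWeakGradient_iff Λ w.fst w.snd
  rw [this]
  have h1 := WithLp.continuous_fst 2 Λ.L2 Λ.L2Vec
  have h2 := WithLp.continuous_snd 2 Λ.L2 Λ.L2Vec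
  exact isClosed_iInter fun φ => isClosed_iInter fun i =>
    isClosed_eq (by fun_prop) continuous_const

instance instCompleteSpaceH1 : CompleteSpace Λ.H1 :=
  isClosed_sobolevGraph.completeSpace_coe

/-- Square integrable functions with values in `L²(Λ)` and in `L²(Λ; ℝ²)`, the latter being
pointwise the weak gradient of the former, form a square integrable function with values in
`H¹(Λ)`. -/
theorem exists_memLp_H1 {X : Type*} [MeasurableSpace X] {μ : Measure X} {f : X → Λ.L2}
    {G : X → Λ.L2Vec} (hf : MemLp f 2 μ) (hG : MemLp G 2 μ)
    (h : ∀ᵐ p ∂μ, Λ.IsWeakGradient (f p) (G p)) :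
    ∃ V : X → Λ.H1, MemLp V 2 μ ∧ ∀ᵐ p ∂μ, (V p).toL2 = f p ∧ (V p).grad = G p := by
  set e := (WithLp.prodContinuousLinearEquiv 2 ℝ Λ.L2 Λ.L2Vec).symm.toContinuousLinearMap
  -- Projecting onto the graph yields an $H^1$-valued function that is measurable without any
  -- selection; pairs already in the graph are fixed.
  set A := Λ.sobolevGraph.orthogonalProjectionOnto.comp e
  have hsum : MemLp (fun p => (A.comp (ContinuousLinearMap.inl ℝ _ _)) (f p) +
      (A.comp (ContinuousLinearMap.inr ℝ _ _)) (G p)) 2 μ :=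
    ((A.comp (ContinuousLinearMap.inl ℝ _ _)).comp_memLp' hf).add
      ((A.comp (ContinuousLinearMap.inr ℝ _ _)).comp_memLp' hG)
  refine ⟨_, hsum, ?_⟩
  filter_upwards [h] with p hp
  have h1 : (A.comp (ContinuousLinearMap.inl ℝ _ _)) (f p) +
      (A.comp (ContinuousLinearMap.inr ℝ _ _)) (G p) = A (f p, G p) := by
    rw [ContinuousLinearMap.comp_apply, A.comp_apply, ← map_add A]
    simp
  have h2 : A (f p, G p) = ⟨WithLp.toLp 2 (f p, G p), hp⟩ :=
    Submodule.orthogonalProjectionOnto_mem_subspace_eq_self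
      (⟨WithLp.toLp 2 (f p, G p), hp⟩ : Λ.sobolevGraph)
  rw [h1, h2]
  exact ⟨rfl, rfl⟩

end PolygonalDomain

theorem PolygonalDomain.TestFunction.exists_lipschitzWith {Λ : PolygonalDomain}
    (φ : Λ.TestFunction) : ∃ K : ℝ≥0, LipschitzWith K φ.toFun :=
  ContDiff.lipschitzWith_of_hasCompactSupport φ.compact φ.contDiff (by simp)

/-! ### Uniform control of the approximations and passage to the limit. -/

namespace AdmissibleMesh

variable {Ω : Type*} [mΩ : MeasurableSpace Ω] {P : Measure Ω} {F : Filtration ℝ≥0 mΩ}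
  {W : ℝ≥0 → Ω → ℝ} {Λ : PolygonalDomain} {T : ℝ≥0} {v : ℝ → Plane → Plane} {g β : ℝ → ℝ}
  {u₀ : Ω → Λ.H1}

/-- The estimates for the approximations as functions on `Ω × (0,T)`, with constant `B`. -/
structure IsControlled (M : AdmissibleMesh Λ) (F : Filtration ℝ≥0 mΩ) (P : Measure Ω) (T : ℝ≥0)
    (N : ℕ) (u : ℕ → Ω → Fin M.card → ℝ) (B : ℝ) : Prop where
  memLp_right : MemLp (M.rightApprox T N u) 2 (timeProduct P T)
  memLp_left : MemLp (M.leftApprox T N u) 2 (timeProduct P T)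
  memLp_grad : MemLp (M.rightGradient T N u) 2 (timeProduct P T)
  predictable : AEStronglyMeasurable[predictableReal F] (M.leftApprox T N u) (timeProduct P T)
  left_le : ∫ p, ‖M.leftApprox T N u p‖ ^ 2 ∂timeProduct P T ≤ B
  grad_le : ∫ p, ‖M.rightGradient T N u p‖ ^ 2 ∂timeProduct P T ≤ B
  sub_le : ∫ p, ‖M.rightApprox T N u p - M.leftApprox T N u p‖ ^ 2 ∂timeProduct P T ≤
    timeStep T N * B
  consistency : ∀ (φ : Λ.TestFunction) (K : ℝ≥0), LipschitzWith K φ.toFun → ∀ l,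
    ∫ p, (⟪M.rightGradient T N u p, φ.vecLp l⟫ + ⟪M.rightApprox T N u p, φ.partialLp l⟫) ^ 2
      ∂timeProduct P T ≤ (2 * K * M.size * √(2 * volume.real (closure Λ.carrier))) ^ 2 * B

theorem exists_isControlled [IsProbabilityMeasure P] (hT : 0 < T) (hW : IsBrownianMotionWrt F P W)
    (hv : Λ.IsConvectionField T v) (hu₀m : StronglyMeasurable[F 0] u₀) (hu₀ : MemLp u₀ 2 P)
    {Lg : ℝ≥0} (hg : LipschitzWith Lg g) {L : ℝ≥0} (hβ : LipschitzWith L β) (hβ0 : β 0 = 0) :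
    ∃ B : ℝ, ∀ (M : AdmissibleMesh Λ) (N : ℕ) (u : ℕ → Ω → Fin M.card → ℝ), 0 < N →
      4 * L * timeStep T N ≤ 1 → M.IsDiscreteSolution T N v g β P W u₀ u →
      M.IsControlled F P T N u B := by
  obtain ⟨B, hB⟩ := IsDiscreteSolution.exists_apriori_bound hT hW hv hu₀m hu₀ hg hβ hβ0
  -- `T * B` covers the left approximation, `2 * B` the gradient (twice the squared seminorm), and
  -- `B` the increments and the consistency error.
  refine ⟨(T + 2) * B + B, fun M N u hN hL hu => ?_⟩
  obtain ⟨h1, h2, h3, h4, h5⟩ := hB M N u hN hL hu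
  have hτ := timeStep_pos hT hN
  have hB0 : 0 ≤ B := (integral_nonneg fun ω => normSq_nonneg _).trans (h1 0 (Nat.zero_le N)).2
  have hTB : 0 ≤ T * B := by positivity
  have had := fun n (hn : n ≤ N) =>
    hu.exists_adapted hT hN hW.adapted hv hu₀m hg.continuous hβ hL hn
  have hmeas : ∀ n ≤ N, AEMeasurable (u n) P := fun n hn => by
    obtain ⟨w, hw, huw⟩ := had n hn
    exact ⟨w, hw.mono (F.le _) le_rfl, huw⟩
  have hcell : ∀ n ≤ N, AEStronglyMeasurable (fun ω => M.cellFunction (u n ω)) P := fun n hn =>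
    continuous_cellFunction.comp_aestronglyMeasurable (hmeas n hn).aestronglyMeasurable
  have hgrad : ∀ n < N, AEStronglyMeasurable (fun ω => M.discreteGradient (u (n + 1) ω)) P :=
    fun n hn => continuous_discreteGradient.comp_aestronglyMeasurable
      (hmeas (n + 1) hn).aestronglyMeasurable
  have hcellsq : ∀ n ≤ N, Integrable (fun ω => ‖M.cellFunction (u n ω)‖ ^ 2) P := fun n hn => by
    simpa only [norm_cellFunction_sq] using (h1 n hn).1
  have hgradsq : ∀ n < N, Integrable (fun ω => ‖M.discreteGradient (u (n + 1) ω)‖ ^ 2) P :=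
    fun n hn => by
      refine Integrable.mono' ((h3 n hn).const_mul 2) ((hgrad n hn).norm.pow 2)
        (Eventually.of_forall fun ω => ?_)
      rw [Real.norm_of_nonneg (by positivity)]
      exact norm_discreteGradient_sq_le _
  obtain ⟨hr, -⟩ := memLp_stepFunction (T := T) hN (fun n hn => hcell (n + 1) hn)
    fun n hn => hcellsq (n + 1) hn
  obtain ⟨hl, hl'⟩ := memLp_stepFunction (T := T) hN (fun n hn => hcell n hn.le)
    fun n hn => hcellsq n hn.le
  obtain ⟨hd, hd'⟩ := memLp_stepFunction (T := T) hN hgrad hgradsq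
  refine ⟨hr, hl, hd, ?_, ?_, ?_, ?_, ?_⟩
  · choose! w hw huw using had
    exact aestronglyMeasurable_stepFunction_predictable continuous_cellFunction
      (by simpa using cellFunction_sub (M := M) 0 0) (fun n hn => hw n hn.le) fun n hn => huw n hn.le
  · refine hl'.le.trans ?_
    have : ∑ n ∈ Finset.range N, ∫ ω, ‖M.cellFunction (u n ω)‖ ^ 2 ∂P ≤ N * B := by
      refine (Finset.sum_le_card_nsmul _ _ B fun n hn => ?_).trans_eq (by simp)
      simpa only [norm_cellFunction_sq] using (h1 n (Finset.mem_range.1 hn).le).2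
    have h := mul_le_mul_of_nonneg_left this hτ.le
    have : timeStep T N * (N * B) = T * B := by rw [← mul_timeStep (T := T) hN]; ring
    linarith
  · refine hd'.le.trans ?_
    have : ∑ n ∈ Finset.range N, ∫ ω, ‖M.discreteGradient (u (n + 1) ω)‖ ^ 2 ∂P ≤
        ∑ n ∈ Finset.range N, 2 * ∫ ω, M.seminormSq (u (n + 1) ω) ∂P := by
      refine Finset.sum_le_sum fun n hn => ?_
      have hn := Finset.mem_range.1 hn
      rw [← integral_const_mul]
      exact integral_mono (hgradsq n hn) ((h3 n hn).const_mul 2)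
        fun ω => norm_discreteGradient_sq_le _
    rw [← Finset.mul_sum] at this
    have h := mul_le_mul_of_nonneg_left this hτ.le
    linarith
  · obtain ⟨-, hs⟩ := memLp_stepFunction (T := T) hN
      (a := fun n ω => M.cellFunction (u (n + 1) ω - u n ω))
      (fun n hn => by
        simp only [cellFunction_sub]
        exact (hcell (n + 1) hn).sub (hcell n hn.le))
      (fun n hn => by simpa only [norm_cellFunction_sq] using h2 n hn)
    have heq : ∀ p : Ω × ℝ, M.rightApprox T N u p - M.leftApprox T N u p =
        stepFunction T N (fun n => M.cellFunction (u (n + 1) p.1 - u n p.1)) p.2 := by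
      intro p
      unfold rightApprox leftApprox stepFunction
      rw [← Finset.sum_sub_distrib]
      refine Finset.sum_congr rfl fun n _ => ?_
      by_cases h : p.2 ∈ Ico (timeNode T N n : ℝ) (timeNode T N (n + 1) : ℝ)
      · simp only [indicator_of_mem h, cellFunction_sub]
      · simp only [indicator_of_notMem h, sub_zero]
    simp only [heq]
    refine hs.le.trans (mul_le_mul_of_nonneg_left ?_ hτ.le)
    simp only [norm_cellFunction_sq]
    linarith
  · intro φ K hK l
    set c := 2 * K * M.size * √(2 * volume.real (closure Λ.carrier))
    obtain ⟨hi, hi'⟩ := integral_stepFunction (T := T) hN h3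
    have hpt : ∀ p : Ω × ℝ,
        (⟪M.rightGradient T N u p, φ.vecLp l⟫ + ⟪M.rightApprox T N u p, φ.partialLp l⟫) ^ 2 ≤
          c ^ 2 * stepFunction T N (fun n => M.seminormSq (u (n + 1) p.1)) p.2 := by
      intro p
      by_cases h : ∃ n < N, p.2 ∈ Ico (timeNode T N n : ℝ) (timeNode T N (n + 1) : ℝ)
      · obtain ⟨n, hn, hp⟩ := h
        rw [rightGradient, rightApprox, stepFunction_of_mem _ hn hp, stepFunction_of_mem _ hn hp,
          stepFunction_of_mem _ hn hp, ← sq_abs]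
        refine (pow_le_pow_left₀ (abs_nonneg _)
          (abs_inner_add_inner_le φ hK l (u (n + 1) p.1)) 2).trans_eq ?_
        rw [mul_pow, Real.sq_sqrt (seminormSq_nonneg _)]
      · push Not at h
        rw [rightGradient, rightApprox, stepFunction_of_notMem _ h, stepFunction_of_notMem _ h,
          stepFunction_of_notMem _ h]
        simp
    refine (integral_mono_of_nonneg (Eventually.of_forall fun p => sq_nonneg _)
      (hi.const_mul (c ^ 2)) (Eventually.of_forall hpt)).trans ?_
    rw [integral_const_mul, hi']
    exact mul_le_mul_of_nonneg_left (by linarith) (sq_nonneg _)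

/-- Compactness of controlled sequences of approximations. -/
theorem exists_weak_limit [IsProbabilityMeasure P] {M : ℕ → AdmissibleMesh Λ}
    (hM : Tendsto (fun m => (M m).size) atTop (𝓝 0)) {N : ℕ → ℕ}
    (hN : Tendsto (fun m => timeStep T (N m)) atTop (𝓝 0))
    {u : (m : ℕ) → ℕ → Ω → Fin (M m).card → ℝ} {B : ℝ}
    (hu : ∀ m, (M m).IsControlled F P T (N m) (u m) B) :
    ∃ φ : ℕ → ℕ, StrictMono φ ∧
      ∃ (ulim : Ω × ℝ → Λ.L2) (V : Ω × ℝ → Λ.H1),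
        IsStronglyPredictable F (fun (t : ℝ≥0) ω => ulim (ω, (t : ℝ))) ∧
        MemLp ulim 2 (timeProduct P T) ∧
        MemLp V 2 (timeProduct P T) ∧
        (∀ᵐ p ∂(timeProduct P T), (V p).toL2 = ulim p) ∧
        TendstoWeakL2 (timeProduct P T)
          (fun k => (M (φ k)).rightApprox T (N (φ k)) (u (φ k))) ulim ∧
        TendstoWeakL2 (timeProduct P T)
          (fun k => (M (φ k)).leftApprox T (N (φ k)) (u (φ k))) ulim ∧
        TendstoWeakL2 (timeProduct P T)
          (fun k => (M (φ k)).rightGradient T (N (φ k)) (u (φ k))) (fun p => (V p).grad) := by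
  set ℓ : ℕ → Lp Λ.L2 2 (timeProduct P T) := fun m => (hu m).memLp_left.toLp _ with hℓ
  set r : ℕ → Lp Λ.L2 2 (timeProduct P T) := fun m => (hu m).memLp_right.toLp _ with hr
  set d : ℕ → Lp Λ.L2Vec 2 (timeProduct P T) := fun m => (hu m).memLp_grad.toLp _ with hd
  have hℓB : ∀ m, ‖ℓ m‖ ≤ √B := fun m => Real.le_sqrt_of_sq_le <| by
    rw [hℓ, norm_toLp_sq]
    exact (hu m).left_le
  have hdB : ∀ m, ‖d m‖ ≤ √B := fun m => Real.le_sqrt_of_sq_le <| by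
    rw [hd, norm_toLp_sq]
    exact (hu m).grad_le
  have hrl : Tendsto (fun m => ‖r m - ℓ m‖) atTop (𝓝 0) := by
    have h : Tendsto (fun m => √(timeStep T (N m) * B)) atTop (𝓝 0) := by
      simpa using (hN.mul_const B).sqrt
    refine squeeze_zero (fun m => norm_nonneg _) (fun m => Real.le_sqrt_of_sq_le ?_) h
    rw [hr, hℓ]
    simp only
    rw [← MemLp.toLp_sub, norm_toLp_sq]
    exact (hu m).sub_le
  -- Two extractions suffice: the right approximations follow the left ones by `hrl`.
  obtain ⟨φ, hφ, U, hU⟩ := exists_subseq_tendsto_inner ℓ hℓB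
  obtain ⟨ψ, hψ, G, hG⟩ := exists_subseq_tendsto_inner (d ∘ φ) fun m => hdB (φ m)
  have hφψ := (hφ.comp hψ).tendsto_atTop
  have hU' : ∀ z, Tendsto (fun k => ⟪ℓ (φ (ψ k)), z⟫) atTop (𝓝 ⟪U, z⟫) := fun z =>
    (hU z).comp hψ.tendsto_atTop
  have hR : ∀ z, Tendsto (fun k => ⟪r (φ (ψ k)), z⟫) atTop (𝓝 ⟪U, z⟫) :=
    tendsto_inner_of_tendsto_norm_sub hU' (hrl.comp hφψ)
  -- The limit process is this representative, measurable for the predictable σ-algebra everywhere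
  -- and not merely up to null sets.
  obtain ⟨f, hfm, hUf⟩ : AEStronglyMeasurable[predictableReal F] U (timeProduct P T) :=
    aestronglyMeasurable_of_tendsto_inner (predictableReal_le F)
      (fun k => (hu (φ (ψ k))).predictable.congr (hu _).memLp_left.coeFn_toLp.symm) hU'
  have hweak : ∀ᵐ p ∂timeProduct P T, ∀ s ∈ {s : Λ.L2 × Λ.L2Vec |
      ∃ (φ : Λ.TestFunction) (l : Fin 2), s = (φ.partialLp l, φ.vecLp l)},
        ⟪G p, s.2⟫ + ⟪U p, s.1⟫ = 0 := by
    have : Fact ((2 : ℝ≥0∞) ≠ ∞) := ⟨by simp⟩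
    refine ae_forall_inner_add_inner_eq_zero hR hG ?_
    rintro _ ⟨θ, l, rfl⟩
    obtain ⟨K, hK⟩ := θ.exists_lipschitzWith
    -- For a fixed test function the consistency error is of the order of the squared mesh size.
    have h : Tendsto (fun k => (2 * K * (M (φ (ψ k))).size *
        √(2 * volume.real (closure Λ.carrier))) ^ 2 * B) atTop (𝓝 0) := by
      have h0 := ((((hM.comp hφψ).const_mul (2 * (K : ℝ))).mul_const
        √(2 * volume.real (closure Λ.carrier))).pow 2).mul_const B
      simpa using h0
    refine squeeze_zero (fun k => integral_nonneg fun p => sq_nonneg _) (fun k => ?_) h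
    refine le_trans (le_of_eq ?_) ((hu (φ (ψ k))).consistency θ K hK l)
    refine integral_congr_ae ?_
    filter_upwards [(hu (φ (ψ k))).memLp_right.coeFn_toLp,
      (hu (φ (ψ k))).memLp_grad.coeFn_toLp] with p h1 h2
    simp only [hr, hd, Function.comp_apply, h1, h2]
  have hfL : MemLp f 2 (timeProduct P T) := (memLp_congr_ae hUf).1 (Lp.memLp U)
  have hGL : MemLp G 2 (timeProduct P T) := Lp.memLp G
  obtain ⟨V, hV, hVfG⟩ := PolygonalDomain.exists_memLp_H1 hfL hGL (by
    filter_upwards [hweak, hUf] with p hp hf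
    rw [PolygonalDomain.isWeakGradient_iff, ← hf]
    exact fun φ l => hp _ ⟨φ, l, rfl⟩)
  have hgradG : (fun p => (V p).grad) =ᵐ[timeProduct P T] G := hVfG.mono fun p hp => hp.2
  have hfU : hfL.toLp f = U := by
    rw [← Lp.toLp_coeFn U (Lp.memLp U)]
    exact MemLp.toLp_congr _ _ hUf.symm
  have hVL : MemLp (fun p => (V p).grad) 2 (timeProduct P T) := (memLp_congr_ae hgradG).2 hGL
  have hVG : hVL.toLp (fun p => (V p).grad) = G := by
    rw [← Lp.toLp_coeFn G hGL]
    exact MemLp.toLp_congr _ _ hgradG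
  refine ⟨φ ∘ ψ, hφ.comp hψ, f, V, isStronglyPredictable_of_predictableReal hfm, hfL, hV,
    hVfG.mono fun p hp => hp.1, ⟨fun k => (hu _).memLp_right, hfL, ?_⟩,
    ⟨fun k => (hu _).memLp_left, hfL, ?_⟩, ⟨fun k => (hu _).memLp_grad, hVL, ?_⟩⟩
  · rw [hfU]
    exact tendsto_toWeakSpace hR
  · rw [hfU]
    exact tendsto_toWeakSpace hU'
  · rw [hVG]
    exact tendsto_toWeakSpace hG

end AdmissibleMesh

/-! ### Conclusion. -/

theorem tendsto_timeStep (T : ℝ≥0) {N : ℕ → ℕ} (hN : Tendsto N atTop atTop) :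
    Tendsto (fun m => timeStep T (N m)) atTop (𝓝 0) :=
  tendsto_const_nhds.div_atTop (tendsto_natCast_atTop_atTop.comp hN)

theorem proposition4p1 {Ω : Type*} [mΩ : MeasurableSpace Ω] (P : Measure Ω)
    [IsProbabilityMeasure P]
    -- a right-continuous, complete filtration and a Brownian motion with respect to it
    (F : Filtration ℝ≥0 mΩ) (hF : F.IsRightContinuous)
    (hFc : ∀ s : Set Ω, P s = 0 → MeasurableSet[F 0] s)
    (W : ℝ≥0 → Ω → ℝ) (hW : IsBrownianMotionWrt F P W)
    (Λ : PolygonalDomain) (T : ℝ≥0) (hT : 0 < T)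
    -- the data
    (u₀ : Ω → Λ.H1) (hu₀m : StronglyMeasurable[F 0] u₀) (hu₀ : MemLp u₀ 2 P)
    (g : ℝ → ℝ) (hg : ∃ L : ℝ≥0, LipschitzWith L g)
    (β : ℝ → ℝ) (hβ : ∃ L : ℝ≥0, LipschitzWith L β) (hβ0 : β 0 = 0)
    (v : ℝ → Plane → Plane) (hv : Λ.IsConvectionField T v)
    -- the sequence of discretizations
    (M : ℕ → AdmissibleMesh Λ) (hM : Tendsto (fun m => (M m).size) atTop (𝓝 0))
    (N : ℕ → ℕ) (hN : ∀ m, 0 < N m) (hNlim : Tendsto N atTop atTop)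
    -- the discrete solutions
    (u : (m : ℕ) → ℕ → Ω → Fin (M m).card → ℝ)
    (hu : ∀ᶠ m in atTop, (M m).IsDiscreteSolution T (N m) v g β P W u₀ (u m)) :
    ∃ φ : ℕ → ℕ, StrictMono φ ∧
      ∃ (ulim : Ω × ℝ → Λ.L2) (V : Ω × ℝ → Λ.H1),
        -- `ulim` is a predictable process in `L²(Ω × (0,T); L²(Λ))`
        IsStronglyPredictable F (fun (t : ℝ≥0) ω => ulim (ω, (t : ℝ))) ∧
        MemLp ulim 2 (timeProduct P T) ∧
        -- `ulim` belongs to `L²(Ω; L²(0,T; H¹(Λ)))`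
        MemLp V 2 (timeProduct P T) ∧
        (∀ᵐ p ∂(timeProduct P T), (V p).toL2 = ulim p) ∧
        -- weak convergence of the approximations and of the discrete gradients
        TendstoWeakL2 (timeProduct P T)
          (fun k => (M (φ k)).rightApprox T (N (φ k)) (u (φ k))) ulim ∧
        TendstoWeakL2 (timeProduct P T)
          (fun k => (M (φ k)).leftApprox T (N (φ k)) (u (φ k))) ulim ∧
        TendstoWeakL2 (timeProduct P T)
          (fun k => (M (φ k)).rightGradient T (N (φ k)) (u (φ k))) (fun p => (V p).grad) := by
  obtain ⟨Lg, hg⟩ := hg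
  obtain ⟨L, hβ⟩ := hβ
  obtain ⟨B, hB⟩ := AdmissibleMesh.exists_isControlled hT hW hv hu₀m hu₀ hg hβ hβ0
  have hτ := tendsto_timeStep T hNlim
  have hτL : ∀ᶠ m in atTop, 4 * L * timeStep T (N m) ≤ 1 := by
    have h := hτ.const_mul (4 * (L : ℝ))
    rw [mul_zero] at h
    exact h.eventually_le_const one_pos
  -- Beyond `m₀` a discrete solution is given and the time step is small enough for the estimates;
  -- the sequence is shifted by `m₀` and the indices are shifted back at the end.
  obtain ⟨m₀, hm₀⟩ := eventually_atTop.1 (hu.and hτL)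
  have hshift : Tendsto (fun k => k + m₀) atTop atTop := tendsto_add_atTop_nat m₀
  obtain ⟨φ, hφ, h⟩ := AdmissibleMesh.exists_weak_limit (F := F) (P := P) (hM.comp hshift)
    (hτ.comp hshift) (u := fun k => u (k + m₀)) (B := B) fun k =>
      hB _ _ _ (hN _) (hm₀ _ (Nat.le_add_left _ _)).2 (hm₀ _ (Nat.le_add_left _ _)).1
  exact ⟨fun k => φ k + m₀, fun a b hab => Nat.add_lt_add_right (hφ hab) m₀, h⟩
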